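/- **Setting.** Let $(Y_i,X_i)_{i\ge1}$ be i.i.d. copies of $(Y,X)\in\{0,1\}\times\mathbb R^k$ with $0<\pi:=P(Y=1)<1$. Let $G(x,\beta)$, $x\in\mathbb R^k$, $\beta\in\mathbb R^p$, be a (jointly measurable) real-valued predictive index, and put $$TP(c,\beta)=P[G(X,\beta)>c\mid Y=1],\qquad FP(c,\beta)=P[G(X,\beta)>c\mid Y=0],$$ $$\widehat{TP}(c,\beta)=\frac{\sum_{i\le n}1[G(X_i,\beta)>c,Y_i=1]}{\sum_{i\le n}Y_i},\qquad \widehat{FP}(c,\beta)=\frac{\sum_{i\le n}1[G(X_i,\beta)>c,Y_i=0]}{n-\sum_{i\le n}Y_i}.$$ Let $(W_i)_{i\ge1}$ be i.i.d. weights, independent of the data $(Y_i,X_i)_{i\ge1}$, with $E(W_i)=1$, $\mathrm{Var}(W_i)=1$ and $\int_0^\infty P(|W_1|>t)^{1/2}\,dt<\infty$ (which holds, for instance, if $E|W_1|^{2+\delta}<\infty$ for some $\delta>0$), and put $$\widehat{TP}^w(c,\beta)=\frac{\sum_{i\le n} W_i1[G(X_i,\beta)>c,Y_i=1]}{\sum_{i\le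 n} W_iY_i},\qquad \widehat{FP}^w(c,\beta)=\frac{\sum_{i\le n} W_i1[G(X_i,\beta)>c,Y_i=0]}{\sum_{i\le n} W_i(1-Y_i)}.$$ **Assumptions.** 1. $\mathcal B\subset\mathbb R^p$ is compact, $\beta^*$ is an interior point of $\mathcal B$, $\hat\beta$ maximizes $\frac1n\sum_{i\le n}q(Y_i,X_i,\beta)$ over $\beta\in\mathcal B$, and $\sqrt n(\hat\beta-\beta^*)=n^{-1/2}\sum_{i\le n}\psi_\beta(Y_i,X_i,\beta^*)+o_p(1)$, where $\psi_\beta$ takes values in $\mathbb R^p$, $E[\psi_\beta(Y,X,\beta^*)]=0$ and $E\|\psi_\beta(Y,X,\beta^*)\|^{2+\epsilon}<\infty$ for some $\epsilon>0$. 2. For $j=0,1$ the process $(c,\beta)\mapsto\sqrt n(\hat P_j-P_j)1[G(X,\beta)\le c]$ is stochastically equicontinuous over $\mathbb R\times\mathcal B$, where $P_j$ is the probability conditional on $Y=j$ and $\hat P_j$ is the empirical measure of the subsample with $Y_i=j$. 3. For every cutoff $c$ the gradients $\nabla_\beta TP(c,\beta)$ and $\nabla_\beta FP(c,\beta)$ exist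 and are continuous in $\beta$ on some open ball centered at $\beta^*$. 4. $\hat\beta^w$ maximizes $\frac1n\sum_{i\le n}W_iq(Y_i,X_i,\beta)$ over $\beta\in\mathcal B$, and $\sqrt n(\hat\beta^w-\beta^*)=n^{-1/2}\sum_{i\le n}W_i\psi_\beta(Y_i,X_i,\beta^*)+o_p(1)$. Fix a cutoff $c$ and let $\psi=(\psi_{TP},\psi_{FP})'$, where $$\psi_{TP}(y,x)=\tfrac{y}{\pi}\big(1[G(x,\beta^*)>c]-TP(c,\beta^*)\big)+\nabla_\beta TP(c,\beta^*)\,\psi_\beta(y,x,\beta^*),$$ $$\psi_{FP}(y,x)=\tfrac{1-y}{1-\pi}\big(1[G(x,\beta^*)>c]-FP(c,\beta^*)\big)+\nabla_\beta FP(c,\beta^*)\,\psi_\beta(y,x,\beta^*).$$ **Proposition.** Suppose that $E[\psi_{TP}(Y,X)^2]>0$ and $E[\psi_{FP}(Y,X)^2]>0$. Then $\psi(Y,X)$ is square-integrable and $$\sqrt n\begin{pmatrix}\widehat{TP}^w(c,\hat\beta^w)-\widehat{TP}(c,\hat\beta)\\ \widehat{FP}^w(c,\hat\beta^w)-\widehat{FP}(c,\hat\beta)\end{pmatrix}=\frac1{\sqrt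 n}\sum_{i=1}^n(W_i-1)\,\psi(Y_i,X_i)+r_n,$$ where $r_n=o_p(1)$, both unconditionally and conditionally on the data (that is, $P(\|r_n\|\ge\epsilon\mid (Y_i,X_i)_{i\ge1})\to0$ in probability for every $\epsilon>0$). Conditionally on the data, both the left-hand side and $n^{-1/2}\sum_{i\le n}(W_i-1)\psi(Y_i,X_i)$ converge in distribution to $N(0,E[\psi\psi'])$ with probability approaching one: the Lévy–Prokhorov distance between the conditional law and $N(0,E[\psi\psi'])$ tends to $0$ in probability. The weighted bootstrap is therefore valid pointwise: $N(0,E[\psi\psi'])$ is also the limit in distribution of $\sqrt n\big(\widehat{TP}(c,\hat\beta)-TP(c,\beta^*),\ \widehat{FP}(c,\hat\beta)-FP(c,\beta^*)\big)'$. -/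

import Mathlib

open MeasureTheory ProbabilityTheory Filter Topology
open scoped ENNReal

namespace ROCBootstrap

noncomputable section

/-- Column vectors of length `d` with the Euclidean norm. -/
abbrev Vec (d : ℕ) := EuclideanSpace ℝ (Fin d)

open Classical in
/-- The indicator `1[P]` as a real number. -/
def ind (P : Prop) : ℝ := if P then 1 else 0

variable {Ω : Type*} [MeasurableSpace Ω] (μ : Measure Ω) {k p : ℕ}

/-! ### Population quantities; the generic observation `(Y, X)` is `(Y 0, X 0)` -/

/-- The probability `P_j` conditional on `Y = j`. -/
def condProb (Y : ℕ → Ω → ℝ) (j : ℝ) : Measure Ω := μ[|{ω | Y 0 ω = j}]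

/-- `π = P(Y = 1)`. -/
def prevalence (Y : ℕ → Ω → ℝ) : ℝ := μ.real {ω | Y 0 ω = 1}

/-- True positive rate `TP(c, β) = P[G(X, β) > c | Y = 1]`. -/
def TP (Y : ℕ → Ω → ℝ) (X : ℕ → Ω → Vec k) (G : Vec k → Vec p → ℝ) (c : ℝ) (β : Vec p) : ℝ :=
  (condProb μ Y 1).real {ω | G (X 0 ω) β > c}

/-- False positive rate `FP(c, β) = P[G(X, β) > c | Y = 0]`. -/
def FP (Y : ℕ → Ω → ℝ) (X : ℕ → Ω → Vec k) (G : Vec k → Vec p → ℝ) (c : ℝ) (β : Vec p) : ℝ :=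
  (condProb μ Y 0).real {ω | G (X 0 ω) β > c}

/-! ### Sample quantities; a sample of size `n` consists of the observations `i < n` -/

/-- Empirical true positive rate. -/
def TPhat (Y : ℕ → Ω → ℝ) (X : ℕ → Ω → Vec k) (G : Vec k → Vec p → ℝ)
    (n : ℕ) (c : ℝ) (β : Vec p) (ω : Ω) : ℝ :=
  (1 / ∑ i ∈ Finset.range n, Y i ω) *
    ∑ i ∈ Finset.range n, ind (G (X i ω) β > c ∧ Y i ω = 1)

/-- Empirical false positive rate. -/
def FPhat (Y : ℕ → Ω → ℝ) (X : ℕ → Ω → Vec k) (G : Vec k → Vec p → ℝ)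
    (n : ℕ) (c : ℝ) (β : Vec p) (ω : Ω) : ℝ :=
  (1 / ((n : ℝ) - ∑ i ∈ Finset.range n, Y i ω)) *
    ∑ i ∈ Finset.range n, ind (G (X i ω) β > c ∧ Y i ω = 0)

/-- Weighted-bootstrap true positive rate. -/
def TPw (W Y : ℕ → Ω → ℝ) (X : ℕ → Ω → Vec k) (G : Vec k → Vec p → ℝ)
    (n : ℕ) (c : ℝ) (β : Vec p) (ω : Ω) : ℝ :=
  (1 / ∑ i ∈ Finset.range n, W i ω * Y i ω) *
    ∑ i ∈ Finset.range n, W i ω * ind (G (X i ω) β > c ∧ Y i ω = 1)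

/-- Weighted-bootstrap false positive rate. -/
def FPw (W Y : ℕ → Ω → ℝ) (X : ℕ → Ω → Vec k) (G : Vec k → Vec p → ℝ)
    (n : ℕ) (c : ℝ) (β : Vec p) (ω : Ω) : ℝ :=
  (1 / ∑ i ∈ Finset.range n, W i ω * (1 - Y i ω)) *
    ∑ i ∈ Finset.range n, W i ω * ind (G (X i ω) β > c ∧ Y i ω = 0)

/-- The empirical process `√n (P̂_j - P_j) 1[G(X, β) ≤ c]`, where `P̂_j` is the empirical measure
of the subsample with `Y = j`. -/
def empProc (Y : ℕ → Ω → ℝ) (X : ℕ → Ω → Vec k) (G : Vec k → Vec p → ℝ) (j : ℝ)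
    (n : ℕ) (c : ℝ) (β : Vec p) (ω : Ω) : ℝ :=
  √n * ((1 / ∑ i ∈ Finset.range n, ind (Y i ω = j)) *
      (∑ i ∈ Finset.range n, ind (G (X i ω) β ≤ c ∧ Y i ω = j))
    - (condProb μ Y j).real {ω' | G (X 0 ω') β ≤ c})

/-- Stochastic equicontinuity over `ℝ × B`: the oscillation of the process over pairs of indices
at distance less than `δ` is small in (outer) probability. -/
def StochEquicontinuous (B : Set (Vec p)) (ν : ℕ → ℝ → Vec p → Ω → ℝ) : Prop :=
  ∀ ε > (0 : ℝ), ∀ η > (0 : ℝ), ∃ δ > (0 : ℝ), ∀ᶠ n in atTop,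
    μ {ω | ∃ c c' : ℝ, ∃ β ∈ B, ∃ β' ∈ B, |c - c'| < δ ∧ ‖β - β'‖ < δ ∧
      ε < |ν n c β ω - ν n c' β' ω|} ≤ ENNReal.ofReal η

/-! ### Assumptions -/

/-- Random sampling of `(Y_i, X_i) ∈ {0, 1} × ℝ^k`, with both outcomes possible. -/
structure IIDSample (Y : ℕ → Ω → ℝ) (X : ℕ → Ω → Vec k) : Prop where
  measurable_Y : ∀ i, Measurable (Y i)
  measurable_X : ∀ i, Measurable (X i)
  binary : ∀ i ω, Y i ω = 0 ∨ Y i ω = 1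
  indep : iIndepFun (fun i ω => (Y i ω, X i ω)) μ
  ident : ∀ i, IdentDistrib (fun ω => (Y i ω, X i ω)) (fun ω => (Y 0 ω, X 0 ω)) μ μ
  prevalence_pos : 0 < prevalence μ Y
  prevalence_lt_one : prevalence μ Y < 1

/-- `b n` is (a measurable choice of) a maximizer over `B` of the weighted average
`n⁻¹ ∑_{i<n} V_i q(Y_i, X_i, β)`. -/
structure IsMEstimator (V Y : ℕ → Ω → ℝ) (X : ℕ → Ω → Vec k) (B : Set (Vec p))
    (q : ℝ → Vec k → Vec p → ℝ) (b : ℕ → Ω → Vec p) : Prop where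
  measurable : ∀ n, Measurable (b n)
  argmax : ∀ n, ∀ᵐ ω ∂μ, b n ω ∈ B ∧
    IsMaxOn (fun β => (1 / (n : ℝ)) * ∑ i ∈ Finset.range n, V i ω * q (Y i ω) (X i ω) β) B (b n ω)

/-- `√n (b_n - β*) = n^{-1/2} ∑_{i<n} V_i ψβ(Y_i, X_i, β*) + o_p(1)`. -/
def AsympLinear (V Y : ℕ → Ω → ℝ) (X : ℕ → Ω → Vec k) (βstar : Vec p)
    (ψβ : ℝ → Vec k → Vec p → Vec p) (b : ℕ → Ω → Vec p) : Prop :=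
  TendstoInMeasure μ
    (fun (n : ℕ) ω => √n • (b n ω - βstar) -
      (1 / √n) • ∑ i ∈ Finset.range n, V i ω • ψβ (Y i ω) (X i ω) βstar)
    atTop (fun _ => 0)

/-- The first-stage estimator: an M-estimator with an asymptotically linear representation. -/
structure FirstStage (Y : ℕ → Ω → ℝ) (X : ℕ → Ω → Vec k) (B : Set (Vec p)) (βstar : Vec p)
    (q : ℝ → Vec k → Vec p → ℝ) (ψβ : ℝ → Vec k → Vec p → Vec p)
    (βhat : ℕ → Ω → Vec p) : Prop where
  compact : IsCompact B
  interior : βstar ∈ interior B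
  mEstimator : IsMEstimator μ (fun _ _ => 1) Y X B q βhat
  measurable_ψβ : Measurable fun z : ℝ × Vec k => ψβ z.1 z.2 βstar
  mean_zero : ∫ ω, ψβ (Y 0 ω) (X 0 ω) βstar ∂μ = 0
  moment : ∃ ε > (0 : ℝ),
    MemLp (fun ω => ψβ (Y 0 ω) (X 0 ω) βstar) (ENNReal.ofReal (2 + ε)) μ
  linear : AsympLinear μ (fun _ _ => 1) Y X βstar ψβ βhat

/-- For every cutoff the gradients in `β` of `TP` and `FP` exist and are continuous on an open ball
centered at `β*`. -/
def SmoothRates (Y : ℕ → Ω → ℝ) (X : ℕ → Ω → Vec k) (G : Vec k → Vec p → ℝ)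
    (βstar : Vec p) : Prop :=
  ∀ c : ℝ, ∃ r > (0 : ℝ),
    (∀ β ∈ Metric.ball βstar r,
      DifferentiableAt ℝ (TP μ Y X G c) β ∧ DifferentiableAt ℝ (FP μ Y X G c) β) ∧
    ContinuousOn (gradient (TP μ Y X G c)) (Metric.ball βstar r) ∧
    ContinuousOn (gradient (FP μ Y X G c)) (Metric.ball βstar r)

/-- Bootstrap weights: i.i.d., independent of the data, with mean and variance one, and with
`∫₀^∞ P(|W| > t)^{1/2} dt < ∞` (the `L_{2,1}` condition of the multiplier central limit theorem). -/
structure BootstrapWeights (W Y : ℕ → Ω → ℝ) (X : ℕ → Ω → Vec k) : Prop where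
  measurable : ∀ i, Measurable (W i)
  indep : iIndepFun W μ
  ident : ∀ i, IdentDistrib (W i) (W 0) μ μ
  indep_data : IndepFun (fun ω i => W i ω) (fun ω i => (Y i ω, X i ω)) μ
  memLp_two : MemLp (W 0) 2 μ
  mean_one : ∫ ω, W 0 ω ∂μ = 1
  var_one : variance (W 0) μ = 1
  tail : IntegrableOn (fun t : ℝ => √(μ.real {ω | t < |W 0 ω|})) (Set.Ioi 0)

/-! ### Influence functions -/

/-- Influence function of the true positive rate. -/
def psiTP (Y : ℕ → Ω → ℝ) (X : ℕ → Ω → Vec k) (G : Vec k → Vec p → ℝ)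
    (ψβ : ℝ → Vec k → Vec p → Vec p) (βstar : Vec p) (c : ℝ) (y : ℝ) (x : Vec k) : ℝ :=
  y / prevalence μ Y * (ind (G x βstar > c) - TP μ Y X G c βstar)
    + inner ℝ (gradient (TP μ Y X G c) βstar) (ψβ y x βstar)

/-- Influence function of the false positive rate. -/
def psiFP (Y : ℕ → Ω → ℝ) (X : ℕ → Ω → Vec k) (G : Vec k → Vec p → ℝ)
    (ψβ : ℝ → Vec k → Vec p → Vec p) (βstar : Vec p) (c : ℝ) (y : ℝ) (x : Vec k) : ℝ :=
  (1 - y) / (1 - prevalence μ Y) * (ind (G x βstar > c) - FP μ Y X G c βstar)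
    + inner ℝ (gradient (FP μ Y X G c) βstar) (ψβ y x βstar)

/-- The stacked influence function `ψ = (ψ_TP, ψ_FP)'`. -/
def psi (Y : ℕ → Ω → ℝ) (X : ℕ → Ω → Vec k) (G : Vec k → Vec p → ℝ)
    (ψβ : ℝ → Vec k → Vec p → Vec p) (βstar : Vec p) (c : ℝ) (y : ℝ) (x : Vec k) : Vec 2 :=
  !₂[psiTP μ Y X G ψβ βstar c y x, psiFP μ Y X G ψβ βstar c y x]

/-- The matrix `E(ψψ')`. -/
def covPsi (Y : ℕ → Ω → ℝ) (X : ℕ → Ω → Vec k) (G : Vec k → Vec p → ℝ)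
    (ψβ : ℝ → Vec k → Vec p → Vec p) (βstar : Vec p) (c : ℝ) : Matrix (Fin 2) (Fin 2) ℝ :=
  Matrix.of fun a b => ∫ ω, psi μ Y X G ψβ βstar c (Y 0 ω) (X 0 ω) a *
    psi μ Y X G ψβ βstar c (Y 0 ω) (X 0 ω) b ∂μ

/-- The sample deviation `√n (TP̂(c, β̂) - TP(c, β*), FP̂(c, β̂) - FP(c, β*))'`. -/
def sampleDev (Y : ℕ → Ω → ℝ) (X : ℕ → Ω → Vec k) (G : Vec k → Vec p → ℝ) (βstar : Vec p)
    (βhat : ℕ → Ω → Vec p) (c : ℝ) (n : ℕ) (ω : Ω) : Vec 2 :=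
  √n • !₂[TPhat Y X G n c (βhat n ω) ω - TP μ Y X G c βstar,
    FPhat Y X G n c (βhat n ω) ω - FP μ Y X G c βstar]

/-- The weighted-bootstrap deviation
`√n (TP̂^w(c, β̂^w) - TP̂(c, β̂), FP̂^w(c, β̂^w) - FP̂(c, β̂))'`. -/
def bootDev (W Y : ℕ → Ω → ℝ) (X : ℕ → Ω → Vec k) (G : Vec k → Vec p → ℝ)
    (βhat βhatw : ℕ → Ω → Vec p) (c : ℝ) (n : ℕ) (ω : Ω) : Vec 2 :=
  √n • !₂[TPw W Y X G n c (βhatw n ω) ω - TPhat Y X G n c (βhat n ω) ω,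
    FPw W Y X G n c (βhatw n ω) ω - FPhat Y X G n c (βhat n ω) ω]

/-- The multiplier sum `n^{-1/2} ∑_{i<n} (W_i - 1) ψ(Y_i, X_i, c, β*)`. -/
def multSum (W Y : ℕ → Ω → ℝ) (X : ℕ → Ω → Vec k) (G : Vec k → Vec p → ℝ)
    (ψβ : ℝ → Vec k → Vec p → Vec p) (βstar : Vec p) (c : ℝ) (n : ℕ) (ω : Ω) : Vec 2 :=
  (1 / √n) • ∑ i ∈ Finset.range n, (W i ω - 1) • psi μ Y X G ψβ βstar c (Y i ω) (X i ω)

/-! ### Convergence conditional on the sample path -/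

/-- The conditional law of `T`, given the sample path `(Y_i, X_i)_i` of the data, at `ω`. -/
def condLaw [IsFiniteMeasure μ] (Y : ℕ → Ω → ℝ) (X : ℕ → Ω → Vec k) (T : Ω → Vec 2) (ω : Ω) :
    Measure (Vec 2) :=
  condDistrib T (fun ω' (i : ℕ) => (Y i ω', X i ω')) μ (fun i => (Y i ω, X i ω))

/-- Conditional on the data, `T n →_d ν` with probability approaching one: the Lévy–Prokhorov
distance (which metrizes weak convergence) between the conditional law of `T n` and `ν` tends to
zero in probability. -/
def CondTendstoInDistribution [IsFiniteMeasure μ] (Y : ℕ → Ω → ℝ) (X : ℕ → Ω → Vec k)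
    (T : ℕ → Ω → Vec 2) (ν : Measure (Vec 2)) : Prop :=
  TendstoInMeasure μ (fun n ω => levyProkhorovDist (condLaw μ Y X (T n) ω) ν) atTop (fun _ => 0)

/-- Conditional on the data, `R n = o_p(1)` with probability approaching one: for each `ε > 0`, the
conditional probability of `‖R n‖ ≥ ε` tends to zero in probability. -/
def CondNegligible [IsFiniteMeasure μ] (Y : ℕ → Ω → ℝ) (X : ℕ → Ω → Vec k)
    (R : ℕ → Ω → Vec 2) : Prop :=
  ∀ ε > (0 : ℝ), TendstoInMeasure μ (fun n ω => (condLaw μ Y X (R n) ω).real {r | ε ≤ ‖r‖})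
    atTop (fun _ => 0)

end

end ROCBootstrap

/-! Everything follows from one expansion, proved for i.i.d. mean-one weights `V` independent of the
data and applied both to `V = W` and to `V = 1`. Let D_n be the average of V_i 1[Y_i = j], which
converges to π_j = P(Y = j). The weighted rate at an estimate b_n satisfies exactly, when D_n ≠ 0,
√n (rate^V(b_n) - rate(β*)) = D_n⁻¹ n^{-1/2} ∑ V_i (centered indicator at β*) + D_n⁻¹ n^{-1/2} ∑ V_i
(increment from β* to b_n) + √n (rate(b_n) - rate(β*)). In the first term D_n⁻¹ may be replaced by
π_j⁻¹, because the sum is O_p(1); the last term is handled by the delta method and the linear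
representation of b_n. If the increment term is negligible, the rate is linear with influence
function ψ (`smallOP_weightedRate_sub`), and subtracting the expansion for V = 1 from that for V = W
leaves the multipliers W_i - 1.

The increment term is the difficulty: equicontinuity is assumed only for unweighted processes and
only in probability. A nonnegative weight is the integral over t > 0 of 1[t < V_i], so a weighted
sum is an integral of unweighted sums over the random index sets {i : t < V_i}. These sets are
independent of the data, so each yields an i.i.d. subsample, and the expected supremum depends only
on its size (`exists_dominating_multiplier`). If the expected supremum for size k is at most A
min(1, k) + ε √k, integration in t gives o(√n) + ε √n ∫ P(|V| > t)^{1/2} dt. Such a bound in mean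
follows from the assumption in probability because the supremum has bounded differences, hence
variance of order k (`meanSup_le_of_measure_le`). The suprema run over uncountable sets; their level
sets are projections of Borel sets, hence analytic and universally measurable.

For the conditional limit, independence identifies the conditional law of the multiplier sum with
its law when the data are frozen. For almost every data path the averages of ⟨ψ(Y_i, X_i), t⟩²
converge; this alone yields a central limit theorem for deterministic combinations of i.i.d.
variables (`tendsto_prod_of_isLittleO`), since it also forces the largest term to be o(√n). A
conditional Slutsky argument passes to the bootstrap deviation, and the ordinary central limit
theorem gives the same limit for the sample deviation. -/

namespace ROCBootstrap

noncomputable section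

/-! ### Analytic sets are universally measurable -/

/-- Inner approximation of a continuous image of the Baire space by images of boxes. -/
theorem exists_box_lt_measure {α : Type*} [MeasurableSpace α] (μ : Measure α)
    (f : (ℕ → ℕ) → α) {a : ℝ≥0∞} (ha : a < μ (Set.range f)) :
    ∃ N : ℕ → ℕ, ∀ m, a < μ (f '' {σ | ∀ i < m, σ i ≤ N i}) := by
  -- Continuity from below holds for increasing sequences of arbitrary sets, so no measurability of
  -- the images is needed; the coordinates can be bounded one after another.
  have step : ∀ (A : Set (ℕ → ℕ)) (m : ℕ), a < μ (f '' A) →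
      ∃ k : ℕ, a < μ (f '' (A ∩ {σ | σ m ≤ k})) := by
    intro A m hA
    have hmono : Monotone fun k : ℕ => f '' (A ∩ {σ | σ m ≤ k}) := by
      intro k l hkl
      exact Set.image_mono fun σ hσ => ⟨hσ.1, le_trans hσ.2 hkl⟩
    have hU : f '' A = ⋃ k : ℕ, f '' (A ∩ {σ | σ m ≤ k}) := by
      rw [← Set.image_iUnion, ← Set.inter_iUnion]
      congr 1
      ext σ
      simp only [Set.mem_inter_iff, Set.mem_iUnion, Set.mem_ofPred_eq]
      exact ⟨fun h => ⟨h, σ m, le_rfl⟩, fun h => h.1⟩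
    rw [hU, hmono.measure_iUnion] at hA
    exact lt_iSup_iff.1 hA
  choose! k hk using step
  let A : ℕ → Set (ℕ → ℕ) := fun m =>
    Nat.rec Set.univ (fun m A => A ∩ {σ | σ m ≤ k A m}) m
  have hA : ∀ m, a < μ (f '' A m) := by
    intro m
    induction m with
    | zero => simpa [A, Set.image_univ] using ha
    | succ m ih => exact hk (A m) m ih
  refine ⟨fun m => k (A m) m, fun m => ?_⟩
  have : A m = {σ | ∀ i < m, σ i ≤ k (A i) i} := by
    induction m with
    | zero => simp [A]
    | succ m ih =>
      have : A (m + 1) = A m ∩ {σ | σ m ≤ k (A m) m} := rfl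
      rw [this]
      nth_rewrite 1 [ih]
      ext σ
      simp only [Set.mem_inter_iff, Set.mem_ofPred_eq, Order.lt_add_one_iff]
      constructor
      · rintro ⟨h1, h2⟩ i hi
        rcases hi.lt_or_eq with h | rfl
        exacts [h1 i h, h2]
      · exact fun h => ⟨fun i hi => h i hi.le, h m le_rfl⟩
  rw [← this]
  exact hA m

theorem isCompact_box (N : ℕ → ℕ) : IsCompact {σ : ℕ → ℕ | ∀ i, σ i ≤ N i} := by
  have := isCompact_univ_pi (fun i : ℕ => (Set.finite_Iic (N i)).isCompact)
  convert! this using 1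
  ext
  simp [Pi.le_def]

/-- Compactness argument: points of the `m`-th boxes outside `V`, truncated at `N`, have a limit
point in the compact box. The truncation eventually changes no given coordinate, so the untruncated
points have the same limit, which lies in the open set `V`. -/
theorem exists_box_subset_of_isOpen {N : ℕ → ℕ} {V : Set (ℕ → ℕ)} (hV : IsOpen V)
    (hK : {σ : ℕ → ℕ | ∀ i, σ i ≤ N i} ⊆ V) : ∃ m, {σ : ℕ → ℕ | ∀ i < m, σ i ≤ N i} ⊆ V := by
  by_contra! h
  have h' : ∀ m, ∃ σ : ℕ → ℕ, (∀ i < m, σ i ≤ N i) ∧ σ ∉ V := by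
    intro m
    obtain ⟨σ, h1, h2⟩ := Set.not_subset.1 (h m)
    exact ⟨σ, h1, h2⟩
  choose σ hσ hσV using h'
  obtain ⟨τ, hτ, φ, hφ, hlim⟩ := (isCompact_box N).tendsto_subseq (x := fun m i => min (σ m i) (N i))
    (fun m i => min_le_right _ _)
  have hlim' : Tendsto (fun m => σ (φ m)) atTop (𝓝 τ) := by
    rw [tendsto_pi_nhds] at hlim ⊢
    intro i
    refine (hlim i).congr' ?_
    filter_upwards [eventually_gt_atTop i] with m hm
    exact min_eq_left (hσ (φ m) i (hm.trans_le (hφ.id_le m)))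
  obtain ⟨m, hm⟩ := (hlim'.eventually (hV.mem_nhds (hK hτ))).exists
  exact hσV _ hm

/-- Analytic sets are measurable up to null sets, for every finite Borel measure. -/
theorem nullMeasurableSet_of_analyticSet {α : Type*} [TopologicalSpace α] [T2Space α]
    [MeasurableSpace α] [BorelSpace α] (μ : Measure α) [IsFiniteMeasure μ] [μ.OuterRegular]
    {s : Set α} (hs : AnalyticSet s) : NullMeasurableSet s μ := by
  rw [AnalyticSet] at hs
  rcases hs with rfl | ⟨f, hf, rfl⟩
  · exact MeasurableSet.empty.nullMeasurableSet
  -- Inner approximation by the compact image of a full box. By outer regularity only its open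
  -- neighbourhoods have to be measured, and each contains the image of a finite-stage box, of
  -- measure above `a`.
  have key : ∀ a < μ (Set.range f), ∃ t ⊆ Set.range f, MeasurableSet t ∧ a ≤ μ t := by
    intro a ha
    obtain ⟨N, hN⟩ := exists_box_lt_measure μ f ha
    refine ⟨f '' {σ | ∀ i, σ i ≤ N i}, Set.image_subset_range _ _,
      ((isCompact_box N).image hf).isClosed.measurableSet, ?_⟩
    rw [Set.measure_eq_iInf_isOpen]
    refine le_iInf fun U => le_iInf fun hKU => le_iInf fun hU => ?_
    obtain ⟨m, hm⟩ := exists_box_subset_of_isOpen (hU.preimage hf) (Set.image_subset_iff.1 hKU)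
    exact (hN m).le.trans (measure_mono (Set.image_subset_iff.2 hm))
  rcases eq_or_ne (μ (Set.range f)) 0 with h0 | h0
  · exact NullMeasurableSet.of_null h0
  obtain ⟨u, -, hu, hulim⟩ := exists_seq_strictMono_tendsto' (pos_iff_ne_zero.2 h0)
  choose t ht htm hta using fun n => key (u n) (hu n).2
  have hT : MeasurableSet (⋃ n, t n) := MeasurableSet.iUnion htm
  refine hT.nullMeasurableSet.congr (ae_eq_of_subset_of_measure_ge (Set.iUnion_subset ht) ?_
    hT.nullMeasurableSet (measure_ne_top _ _))
  exact le_of_tendsto' hulim fun n => (hta n).trans (measure_mono (Set.subset_iUnion t n))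

/-- A supremum of a jointly measurable family over a Borel set of parameters is measurable up to
null sets. -/
theorem aemeasurable_biSup_of_measurable {α γ : Type*} [TopologicalSpace α] [PolishSpace α]
    [MeasurableSpace α] [BorelSpace α] [TopologicalSpace γ] [PolishSpace γ] [MeasurableSpace γ]
    [BorelSpace γ] (μ : Measure α) [IsFiniteMeasure μ] {S : Set γ} (hS : MeasurableSet S)
    {F : α → γ → ℝ≥0∞} (hF : Measurable fun z : α × γ => F z.1 z.2) :
    AEMeasurable (fun x => ⨆ b ∈ S, F x b) μ := by
  have hnull : NullMeasurable (fun x => ⨆ b ∈ S, F x b) μ := by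
    have : @Measurable (NullMeasurableSpace α μ) ℝ≥0∞ _ _ (fun x => ⨆ b ∈ S, F x b) := by
      refine measurable_of_Ioi fun a => ?_
      -- A supremum exceeds `a` iff one of its members does, so the superlevel set is the projection
      -- of a Borel set.
      have hset : (fun x => ⨆ b ∈ S, F x b) ⁻¹' Set.Ioi a =
          Prod.fst '' {z : α × γ | z.2 ∈ S ∧ a < F z.1 z.2} := by
        ext x
        simp [lt_iSup_iff]
      have hm : MeasurableSet {z : α × γ | z.2 ∈ S ∧ a < F z.1 z.2} :=
        (measurable_snd hS).inter (measurableSet_lt measurable_const hF)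
      have := nullMeasurableSet_of_analyticSet μ (hm.analyticSet_image measurable_fst)
      rw [← hset] at this
      exact this
    exact fun s hs => this hs
  exact hnull.aemeasurable

/-! ### Variance of functions with bounded differences -/

/-- Splitting around the mean `h` of `u` kills the cross term, and `|u - h| ≤ c` because `h`
averages values within `c` of `u x`. This is the contribution of a single coordinate to the variance
bound that follows. -/
theorem integral_sub_sq_le {E : Type*} [MeasurableSpace E] (P : Measure E)
    [IsProbabilityMeasure P] {u : E → ℝ} {M c : ℝ} (hu : AEStronglyMeasurable u P)
    (hM : ∀ x, |u x| ≤ M) (hc : ∀ x y, |u x - u y| ≤ c) (m : ℝ) :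
    ∫ x, (u x - m) ^ 2 ∂P ≤ c ^ 2 + ((∫ x, u x ∂P) - m) ^ 2 := by
  have hi : Integrable u P := Integrable.of_bound hu M (ae_of_all _ hM)
  have hi2 : Integrable (fun x => u x ^ 2) P := by
    refine Integrable.of_bound (hu.pow 2) (M ^ 2) (ae_of_all _ fun x => ?_)
    rw [Real.norm_eq_abs, abs_pow]
    exact pow_le_pow_left₀ (abs_nonneg _) (hM x) 2
  set h := ∫ x, u x ∂P with hh
  have hdev : ∀ x, (u x - h) ^ 2 ≤ c ^ 2 := by
    intro x
    have : |u x - h| ≤ c := by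
      have h1 : u x - h = ∫ y, (u x - u y) ∂P := by
        rw [integral_sub (integrable_const _) hi]
        simp [hh]
      rw [h1, ← Real.norm_eq_abs]
      refine (norm_integral_le_of_norm_le_const (ae_of_all _ fun y => hc x y)).trans ?_
      simp
    rw [← sq_abs]
    exact pow_le_pow_left₀ (abs_nonneg _) this 2
  have e : ∀ x, (u x - m) ^ 2 = (u x - h) ^ 2 + (2 * (h - m) * (u x - h) + (h - m) ^ 2) := by
    intro x; ring
  have hi3 : Integrable (fun x => (u x - h) ^ 2) P := by
    have : (fun x => (u x - h) ^ 2) = fun x => u x ^ 2 - 2 * h * u x + h ^ 2 := by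
      ext x; ring
    rw [this]
    exact (hi2.sub (hi.const_mul _)).add (integrable_const _)
  have hi4 : Integrable (fun x => 2 * (h - m) * (u x - h)) P :=
    (hi.sub (integrable_const _)).const_mul _
  have hi5 : Integrable (fun x => 2 * (h - m) * (u x - h) + (h - m) ^ 2) P :=
    hi4.add (integrable_const _)
  simp_rw [e]
  rw [integral_add hi3 hi5, integral_add hi4 (integrable_const _),
    integral_const_mul, integral_sub hi (integrable_const _)]
  have : ∫ x, (u x - h) ^ 2 ∂P ≤ c ^ 2 := by
    refine (integral_mono hi3 (integrable_const (c ^ 2)) hdev).trans ?_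
    simp
  simp only [integral_const, probReal_univ, smul_eq_mul, one_mul]
  rw [← hh, sub_self, mul_zero, zero_add]
  linarith

/-- A function of `n` independent variables that changes by at most `c` when one of them changes
has variance at most `n c²`. -/
theorem integral_pi_sub_sq_le {E : Type*} [MeasurableSpace E] (P : Measure E)
    [IsProbabilityMeasure P] (c M : ℝ) (n : ℕ) :
    ∀ g : (Fin n → E) → ℝ,
      (∀ ν : Measure (Fin n → E), IsFiniteMeasure ν → AEStronglyMeasurable g ν) →
      (∀ x, |g x| ≤ M) → (∀ x i e, |g (Function.update x i e) - g x| ≤ c) →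
      ∫ x, (g x - ∫ y, g y ∂(Measure.pi fun _ => P)) ^ 2 ∂(Measure.pi fun _ => P) ≤ n * c ^ 2 := by
  induction n with
  | zero =>
    intro g hg hM hc
    have : ∀ x, g x - ∫ y, g y ∂(Measure.pi fun _ => P) = 0 := by
      intro x
      have h1 : ∀ y, g y = g x := fun y => by rw [Subsingleton.elim y x]
      simp_rw [h1]
      simp
    simp [this]
  | succ n ih =>
    intro g hg hM hc
    set Q : Measure (Fin n → E) := Measure.pi fun _ => P with hQ
    let e := MeasurableEquiv.piFinSuccAbove (fun _ : Fin (n + 1) => E) 0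
    have he : MeasurePreserving e (Measure.pi fun _ => P) (P.prod Q) :=
      measurePreserving_piFinSuccAbove (fun _ => P) 0
    let h : (Fin n → E) → ℝ := fun y => ∫ a, g (e.symm (a, y)) ∂P
    have hes : ∀ a y, e.symm (a, y) = Fin.cons a y := by
      intro a y
      simp [e, MeasurableEquiv.piFinSuccAbove, Fin.insertNthEquiv]
    -- Measurability of `g` with respect to every finite measure is what survives the induction:
    -- sections and the partial mean `h` are measurable because pushforwards of finite measures are
    -- finite.
    have hGm : ∀ ν : Measure (Fin n → E), IsFiniteMeasure ν →
        AEStronglyMeasurable (fun z => g (e.symm z)) (P.prod ν) := by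
      intro ν hν
      exact (hg ((P.prod ν).map e.symm) inferInstance).comp_measurable e.symm.measurable
    have hsec : ∀ y, AEStronglyMeasurable (fun a => g (e.symm (a, y))) P := by
      intro y
      exact (hg (P.map fun a => e.symm (a, y)) inferInstance).comp_measurable
        (e.symm.measurable.comp (by fun_prop))
    have hsecint : ∀ y, Integrable (fun a => g (e.symm (a, y))) P := fun y =>
      Integrable.of_bound (hsec y) M (ae_of_all _ fun a => hM _)
    have hsecc : ∀ y a b, |g (e.symm (a, y)) - g (e.symm (b, y))| ≤ c := by
      intro y a b
      have := hc (Fin.cons b y) 0 a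
      rwa [Fin.update_cons_zero, ← hes, ← hes] at this
    have hint : ∀ F : (Fin (n + 1) → E) → ℝ, ∫ x, F x ∂(Measure.pi fun _ => P) =
        ∫ z, F (e.symm z) ∂(P.prod Q) := by
      intro F
      rw [← he.integral_comp']
      simp
    have hmean : ∫ x, g x ∂(Measure.pi fun _ => P) = ∫ y, h y ∂Q := by
      rw [hint, integral_prod_symm]
      exact Integrable.of_bound (hGm Q inferInstance) M (ae_of_all _ fun a => hM _)
    have hhm : ∀ ν : Measure (Fin n → E), IsFiniteMeasure ν → AEStronglyMeasurable h ν := by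
      intro ν hν
      exact (hGm ν hν).prod_swap.integral_prod_right'
    have hhM : ∀ y, |h y| ≤ M := by
      intro y
      rw [← Real.norm_eq_abs]
      refine (norm_integral_le_of_norm_le_const (ae_of_all _ fun a => hM _)).trans ?_
      simp
    have hhc : ∀ y i b, |h (Function.update y i b) - h y| ≤ c := by
      intro y i b
      simp only [h]
      rw [← integral_sub (hsecint _) (hsecint _), ← Real.norm_eq_abs]
      refine (norm_integral_le_of_norm_le_const (C := c) (ae_of_all _ fun a => ?_)).trans (by simp)
      have := hc (Fin.cons a y) i.succ b
      rw [← Fin.cons_update] at this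
      rwa [hes, hes]
    have hbound : ∀ m : ℝ, ∀ z, ‖(g (e.symm z) - m) ^ 2‖ ≤ (M + |m|) ^ 2 := by
      intro m z
      rw [Real.norm_eq_abs, abs_pow]
      exact pow_le_pow_left₀ (abs_nonneg _) ((abs_sub _ _).trans (by gcongr; exact hM _)) 2
    rw [hint, hmean]
    set m := ∫ y, h y ∂Q
    have hint2 : Integrable (fun z => (g (e.symm z) - m) ^ 2) (P.prod Q) :=
      Integrable.of_bound (((hGm Q inferInstance).sub aestronglyMeasurable_const).pow 2) _
        (ae_of_all _ (hbound m))
    have hint3 : Integrable (fun y => (h y - m) ^ 2) Q := by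
      refine Integrable.of_bound (((hhm Q inferInstance).sub aestronglyMeasurable_const).pow 2)
        ((M + |m|) ^ 2) (ae_of_all _ fun y => ?_)
      rw [Real.norm_eq_abs, abs_pow]
      exact pow_le_pow_left₀ (abs_nonneg _) ((abs_sub _ _).trans (by gcongr; exact hhM _)) 2
    rw [integral_prod_symm _ hint2]
    calc ∫ y, ∫ a, (g (e.symm (a, y)) - m) ^ 2 ∂P ∂Q
        ≤ ∫ y, (c ^ 2 + (h y - m) ^ 2) ∂Q := by
          refine integral_mono hint2.integral_prod_right ((integrable_const _).add hint3) fun y => ?_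
          exact integral_sub_sq_le P (hsec y) (fun a => hM _) (hsecc y) m
      _ = c ^ 2 + ∫ y, (h y - m) ^ 2 ∂Q := by
          rw [integral_add (integrable_const _) hint3]; simp
      _ ≤ c ^ 2 + n * c ^ 2 := by
          gcongr
          exact ih h hhm hhM hhc
      _ = ((n + 1 : ℕ) : ℝ) * c ^ 2 := by push_cast; ring

/-! ### Suprema of sums over a class of functions -/

/-- The supremum over `b ∈ S` of `|∑ i, f (z i) b|`. -/
def supSum {E Γ ι : Type*} [Fintype ι] (f : E → Γ → ℝ) (S : Set Γ) (z : ι → E) : ℝ≥0∞ :=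
  ⨆ b ∈ S, ENNReal.ofReal |∑ i, f (z i) b|

theorem le_supSum {E Γ ι : Type*} [Fintype ι] (f : E → Γ → ℝ) {S : Set Γ} (z : ι → E) {b : Γ}
    (hb : b ∈ S) : ENNReal.ofReal |∑ i, f (z i) b| ≤ supSum f S z :=
  le_iSup₂_of_le b hb le_rfl

theorem supSum_comp_equiv {E Γ ι κ : Type*} [Fintype ι] [Fintype κ] (f : E → Γ → ℝ) (S : Set Γ)
    (z : ι → E) (e : κ ≃ ι) : supSum f S (fun j => z (e j)) = supSum f S z := by
  unfold supSum
  refine iSup_congr fun b => iSup_congr fun _ => ?_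
  rw [Equiv.sum_comp e fun i => f (z i) b]

theorem supSum_le {E Γ ι : Type*} [Fintype ι] {f : E → Γ → ℝ} {M : ℝ} (hM : ∀ x b, |f x b| ≤ M)
    (S : Set Γ) (z : ι → E) : supSum f S z ≤ ENNReal.ofReal (Fintype.card ι * M) := by
  refine iSup₂_le fun b _ => ENNReal.ofReal_le_ofReal ?_
  refine (Finset.abs_sum_le_sum_abs _ _).trans ((Finset.sum_le_sum fun i _ => hM (z i) b).trans ?_)
  simp

/-- A single summand changes, by at most `2 * M` uniformly in `b`; this is the bounded-difference
constant of the supremum. -/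
theorem supSum_update_le {E Γ : Type*} {n : ℕ} {f : E → Γ → ℝ} {M : ℝ} (hM : ∀ x b, |f x b| ≤ M)
    (S : Set Γ) (z : Fin n → E) (i : Fin n) (e : E) :
    supSum f S (Function.update z i e) ≤ supSum f S z + ENNReal.ofReal (2 * M) := by
  refine iSup₂_le fun b hb => ?_
  have h : |∑ j, f (Function.update z i e j) b| ≤ |∑ j, f (z j) b| + 2 * M := by
    have h1 : ∑ j, f (Function.update z i e j) b = ∑ j, f (z j) b + (f e b - f (z i) b) := by
      rw [← Finset.add_sum_erase _ _ (Finset.mem_univ i),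
        ← Finset.add_sum_erase _ (fun j => f (z j) b) (Finset.mem_univ i)]
      have : ∑ j ∈ Finset.univ.erase i, f (Function.update z i e j) b =
          ∑ j ∈ Finset.univ.erase i, f (z j) b :=
        Finset.sum_congr rfl fun j hj => by rw [Function.update_of_ne (Finset.ne_of_mem_erase hj)]
      rw [this, Function.update_self]
      ring
    rw [h1]
    have := hM e b
    have := hM (z i) b
    have := abs_add_le (∑ j, f (z j) b) (f e b - f (z i) b)
    have := abs_sub (f e b) (f (z i) b)
    linarith
  refine (ENNReal.ofReal_le_ofReal h).trans (ENNReal.ofReal_add_le.trans ?_)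
  gcongr
  exact le_supSum f z hb

/-- The measure `ν` is arbitrary, not just a product: this is the universal measurability that
`integral_pi_sub_sq_le` asks for. -/
theorem aemeasurable_supSum {E Γ ι : Type*} [Fintype ι] [TopologicalSpace E] [PolishSpace E]
    [MeasurableSpace E] [BorelSpace E] [TopologicalSpace Γ] [PolishSpace Γ] [MeasurableSpace Γ]
    [BorelSpace Γ] {f : E → Γ → ℝ} (hf : Measurable fun z : E × Γ => f z.1 z.2) {S : Set Γ}
    (hS : MeasurableSet S) (ν : Measure (ι → E)) [IsFiniteMeasure ν] :
    AEMeasurable (supSum f S) ν := by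
  refine aemeasurable_biSup_of_measurable ν hS (F := fun z b => ENNReal.ofReal |∑ i, f (z i) b|) ?_
  refine ENNReal.measurable_ofReal.comp (Measurable.abs ?_)
  refine Finset.measurable_fun_sum _ fun i _ => ?_
  exact hf.comp (f := fun z : (ι → E) × Γ => (z.1 i, z.2)) (by fun_prop)

/-- The mean of `supSum` over an i.i.d. sample of size `k`. -/
def meanSup {E Γ : Type*} [MeasurableSpace E] (P : Measure E) (f : E → Γ → ℝ) (S : Set Γ)
    (k : ℕ) : ℝ≥0∞ :=
  ∫⁻ z, supSum f S z ∂(Measure.pi fun _ : Fin k => P)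

theorem meanSup_zero {E Γ : Type*} [MeasurableSpace E] (P : Measure E) (f : E → Γ → ℝ)
    (S : Set Γ) : meanSup P f S 0 = 0 := by
  simp [meanSup, supSum]

theorem meanSup_le {E Γ : Type*} [MeasurableSpace E] (P : Measure E) [IsProbabilityMeasure P]
    {f : E → Γ → ℝ} {M : ℝ} (hM : ∀ x b, |f x b| ≤ M) (S : Set Γ) (k : ℕ) :
    meanSup P f S k ≤ ENNReal.ofReal (k * M) := by
  refine (lintegral_mono fun z => supSum_le hM S z).trans ?_
  simp

/-- If `supSum` is small in probability, then it is small in the mean, since its variance is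
controlled by its bounded differences. -/
theorem meanSup_le_of_measure_le {E Γ : Type*} [TopologicalSpace E] [PolishSpace E]
    [MeasurableSpace E] [BorelSpace E] [TopologicalSpace Γ] [PolishSpace Γ] [MeasurableSpace Γ]
    [BorelSpace Γ] (P : Measure E) [IsProbabilityMeasure P] {f : E → Γ → ℝ}
    (hf : Measurable fun z : E × Γ => f z.1 z.2) {M : ℝ} (hM0 : 0 ≤ M) (hM : ∀ x b, |f x b| ≤ M)
    {S : Set Γ} (hS : MeasurableSet S) {k : ℕ} (hk : 0 < k) {ε s : ℝ} (hε : 0 < ε) (hs : 0 < s)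
    (hs1 : s ^ 2 ≤ 1 / 2)
    (h : (Measure.pi fun _ : Fin k => P) {z | ENNReal.ofReal (ε * √k) < supSum f S z}
      ≤ ENNReal.ofReal (s ^ 2)) :
    meanSup P f S k ≤ ENNReal.ofReal ((2 * ε + s * (4 * M ^ 2 + 1)) * √k) := by
  set Q : Measure (Fin k → E) := Measure.pi fun _ => P with hQ
  let g : (Fin k → E) → ℝ := fun z => (supSum f S z).toReal
  have hfin : ∀ z : Fin k → E, supSum f S z ≠ ∞ := fun z =>
    ((supSum_le hM S z).trans_lt ENNReal.ofReal_lt_top).ne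
  have hg0 : ∀ z, 0 ≤ g z := fun z => ENNReal.toReal_nonneg
  have hgM : ∀ z, |g z| ≤ k * M := by
    intro z
    rw [abs_of_nonneg (hg0 z)]
    refine ENNReal.toReal_le_of_le_ofReal (by positivity) ?_
    simpa using supSum_le hM S z
  have hgm : ∀ ν : Measure (Fin k → E), IsFiniteMeasure ν → AEStronglyMeasurable g ν := fun ν hν =>
    (aemeasurable_supSum hf hS ν).ennreal_toReal.aestronglyMeasurable
  have hup : ∀ z i e, g (Function.update z i e) ≤ g z + 2 * M := by
    intro z i e
    have := ENNReal.toReal_mono (by finiteness [hfin z]) (supSum_update_le hM S z i e)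
    rwa [ENNReal.toReal_add (hfin z) ENNReal.ofReal_ne_top,
      ENNReal.toReal_ofReal (by positivity)] at this
  have hgc : ∀ z i e, |g (Function.update z i e) - g z| ≤ 2 * M := by
    intro z i e
    rw [abs_le]
    have h1 := hup z i e
    have h2 := hup (Function.update z i e) i (z i)
    rw [Function.update_idem, Function.update_eq_self] at h2
    constructor <;> linarith
  have hvar := integral_pi_sub_sq_le P (2 * M) (k * M) k g hgm hgM hgc
  rw [← hQ] at hvar
  set a := ∫ z, g z ∂Q with ha
  have hgi : Integrable g Q := Integrable.of_bound (hgm Q inferInstance) (k * M)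
    (ae_of_all _ hgM)
  have ha0 : 0 ≤ a := integral_nonneg hg0
  have hmean : meanSup P f S k = ENNReal.ofReal a := by
    rw [ha, ofReal_integral_eq_lintegral_ofReal hgi (ae_of_all _ hg0)]
    exact lintegral_congr fun z => (ENNReal.ofReal_toReal (hfin z)).symm
  rw [hmean]
  apply ENNReal.ofReal_le_ofReal
  have hkp : 0 < √(k : ℝ) := Real.sqrt_pos.2 (by exact_mod_cast hk)
  set r := √(k : ℝ) with hr
  have hr2 : r ^ 2 = k := Real.sq_sqrt (Nat.cast_nonneg k)
  let A : Set (Fin k → E) := {z | ε * r < g z}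
  have hAeq : A = {z | ENNReal.ofReal (ε * r) < supSum f S z} := by
    ext z
    simp only [A, g, Set.mem_ofPred_eq]
    rw [← ENNReal.ofReal_lt_iff_lt_toReal (by positivity) (hfin z)]
  have hAm : NullMeasurableSet A Q :=
    nullMeasurableSet_lt aemeasurable_const (hgm Q inferInstance).aemeasurable
  have hAs : Q.real A ≤ s ^ 2 := by
    rw [Measure.real, hAeq]
    exact ENNReal.toReal_le_of_le_ofReal (by positivity) h
  set θ := s / r with hθ
  have hθ0 : 0 < θ := by positivity
  have hvi : Integrable (fun z => (g z - a) ^ 2) Q := by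
    refine Integrable.of_bound (((hgm Q inferInstance).sub aestronglyMeasurable_const).pow 2)
      ((k * M + |a|) ^ 2) (ae_of_all _ fun z => ?_)
    rw [Real.norm_eq_abs, abs_pow]
    exact pow_le_pow_left₀ (abs_nonneg _) ((abs_sub _ _).trans (by gcongr; exact hgM _)) 2
  have hAi : Integrable (A.indicator fun _ => (1 : ℝ)) Q :=
    (integrable_const _).indicator₀ hAm
  -- Off `A` the first term suffices; on `A`, write `g = a + (g - a)` and apply Young's inequality
  -- to `g - a`. After integration the mean `a` reappears with factor at most 1/2 and is absorbed on
  -- the left, which doubles the other constants.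
  have hpt : ∀ z, g z ≤ ε * r + (θ / 2 * (g z - a) ^ 2 +
      (1 / (2 * θ) + a) * A.indicator (fun _ => (1 : ℝ)) z) := by
    intro z
    by_cases hz : z ∈ A
    · rw [Set.indicator_of_mem hz]
      have h1 : g z - a ≤ θ / 2 * (g z - a) ^ 2 + 1 / (2 * θ) := by
        have : θ / 2 * (g z - a) ^ 2 + 1 / (2 * θ) - (g z - a) =
            (θ * (g z - a) - 1) ^ 2 / (2 * θ) := by
          field_simp
          ring
        have h2 : 0 ≤ (θ * (g z - a) - 1) ^ 2 / (2 * θ) := by positivity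
        linarith
      have : 0 < ε * r := by positivity
      linarith
    · rw [Set.indicator_of_notMem hz]
      have h1 : g z ≤ ε * r := not_lt.1 hz
      have : 0 ≤ θ / 2 * (g z - a) ^ 2 := by positivity
      linarith
  have hI2 : Integrable (fun z => θ / 2 * (g z - a) ^ 2 +
      (1 / (2 * θ) + a) * A.indicator (fun _ => (1 : ℝ)) z) Q :=
    (hvi.const_mul _).add (hAi.const_mul _)
  have hle := integral_mono hgi ((integrable_const (ε * r)).add hI2) hpt
  simp only [Pi.add_apply] at hle
  rw [integral_add (integrable_const _) hI2, integral_add (hvi.const_mul _) (hAi.const_mul _),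
    integral_const_mul (θ / 2), integral_const_mul (1 / (2 * θ) + a), integral_indicator₀ hAm] at hle
  simp only [integral_const, probReal_univ, smul_eq_mul, one_mul, mul_one,
    measureReal_restrict_apply_univ] at hle
  rw [← ha] at hle
  have h1 : θ / 2 * ∫ z, (g z - a) ^ 2 ∂Q ≤ θ / 2 * (k * (2 * M) ^ 2) := by gcongr
  have h2 : (1 / (2 * θ) + a) * Q.real A ≤ (1 / (2 * θ) + a) * s ^ 2 := by gcongr
  have h3 : θ / 2 * (k * (2 * M) ^ 2) = 2 * M ^ 2 * s * r := by
    rw [hθ, ← hr2]; field_simp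
  have h4 : 1 / (2 * θ) * s ^ 2 = s * r / 2 := by
    rw [hθ]; field_simp
  have h5 : a * s ^ 2 ≤ a * (1 / 2) := by gcongr
  nlinarith

/-- If `supSum` over the classes `S δ` is asymptotically negligible in probability, then also in the
mean. -/
theorem exists_meanSup_le {E Γ : Type*} [TopologicalSpace E] [PolishSpace E]
    [MeasurableSpace E] [BorelSpace E] [TopologicalSpace Γ] [PolishSpace Γ] [MeasurableSpace Γ]
    [BorelSpace Γ] (P : Measure E) [IsProbabilityMeasure P] {f : E → Γ → ℝ}
    (hf : Measurable fun z : E × Γ => f z.1 z.2) {M : ℝ} (hM0 : 0 ≤ M) (hM : ∀ x b, |f x b| ≤ M)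
    {S : ℝ → Set Γ} (hS : ∀ δ, MeasurableSet (S δ))
    (h : ∀ ε > (0 : ℝ), ∀ η > (0 : ℝ), ∃ δ > (0 : ℝ), ∀ᶠ k : ℕ in atTop,
      (Measure.pi fun _ : Fin k => P) {z | ENNReal.ofReal (ε * √k) < supSum f (S δ) z}
        ≤ ENNReal.ofReal η) {ε : ℝ} (hε : 0 < ε) :
    ∃ δ > (0 : ℝ), ∃ n₀ : ℕ, ∀ k ≥ n₀, meanSup P f (S δ) k ≤ ENNReal.ofReal (ε * √k) := by
  set s : ℝ := min (1 / 2) (ε / 2 / (4 * M ^ 2 + 1)) with hs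
  have hs0 : 0 < s := by positivity
  have hs2 : s ^ 2 ≤ 1 / 2 := by
    have : s ≤ 1 / 2 := min_le_left _ _
    nlinarith
  have hs3 : s * (4 * M ^ 2 + 1) ≤ ε / 2 := by
    rw [← le_div_iff₀ (by positivity)]
    exact min_le_right _ _
  obtain ⟨δ, hδ, hev⟩ := h (ε / 4) (by positivity) (s ^ 2) (by positivity)
  obtain ⟨n₀, hn₀⟩ := eventually_atTop.1 hev
  refine ⟨δ, hδ, max n₀ 1, fun k hk => ?_⟩
  refine (meanSup_le_of_measure_le P hf hM0 hM (hS δ) (by omega) (by positivity : 0 < ε / 4) hs0 hs2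
    (hn₀ k (by omega))).trans (ENNReal.ofReal_le_ofReal ?_)
  gcongr
  linarith

/-! ### A multiplier inequality -/

/-- The indices below `n` whose weight exceeds `t`. -/
def active (n : ℕ) (v : ℕ → ℝ) (t : ℝ) : Finset ℕ := (Finset.range n).filter fun i => t < v i

/-- The active set takes finitely many values; splitting over them replaces conditioning on the
weights. -/
theorem measurableSet_active {n : ℕ} (I : Finset ℕ) :
    MeasurableSet {z : (ℕ → ℝ) × ℝ | active n z.1 z.2 = I} := by
  have : {z : (ℕ → ℝ) × ℝ | active n z.1 z.2 = I} =
      ⋂ i : ℕ, {z : (ℕ → ℝ) × ℝ | (i < n ∧ z.2 < z.1 i) ↔ i ∈ I} := by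
    ext z
    simp [active, Finset.ext_iff]
  rw [this]
  refine MeasurableSet.iInter fun i => ?_
  have h : MeasurableSet {z : (ℕ → ℝ) × ℝ | z.2 < z.1 i} :=
    measurableSet_lt measurable_snd ((measurable_pi_apply i).comp measurable_fst)
  by_cases hi : i < n <;> by_cases hI : i ∈ I <;> simp only [hi, hI, true_and, false_and, iff_true,
    iff_false, MeasurableSet.const]
  · exact h
  · exact h.compl

/-- Layer-cake representation of a sum with nonnegative weights. -/
theorem ofReal_abs_sum_mul_le {n : ℕ} {v : ℕ → ℝ} (hv : ∀ i, 0 ≤ v i) (x : ℕ → ℝ) :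
    ENNReal.ofReal |∑ i ∈ Finset.range n, v i * x i| ≤
      ∫⁻ t in Set.Ioi (0 : ℝ), ENNReal.ofReal |∑ i ∈ active n v t, x i| := by
  -- A nonnegative weight is the length of the set of levels between 0 and itself.
  have h1 : ∀ i, v i * x i = ∫ t in Set.Ioi (0 : ℝ), (Set.Iio (v i)).indicator (fun _ => x i) t := by
    intro i
    rw [integral_indicator measurableSet_Iio, Measure.restrict_restrict measurableSet_Iio,
      setIntegral_const, Set.inter_comm, Set.Ioi_inter_Iio]
    simp [hv i]
  have h2 : ∀ i, Integrable (fun t => (Set.Iio (v i)).indicator (fun _ => x i) t)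
      (volume.restrict (Set.Ioi (0 : ℝ))) := by
    intro i
    rw [integrable_indicator_iff measurableSet_Iio, IntegrableOn,
      Measure.restrict_restrict measurableSet_Iio, Set.inter_comm, Set.Ioi_inter_Iio]
    simp
  have h3 : ∑ i ∈ Finset.range n, v i * x i =
      ∫ t in Set.Ioi (0 : ℝ), ∑ i ∈ active n v t, x i := by
    simp_rw [h1]
    rw [← integral_finsetSum _ fun i _ => h2 i]
    refine integral_congr_ae (ae_of_all _ fun t => ?_)
    simp only [active, Finset.sum_filter]
    exact Finset.sum_congr rfl fun i _ => by simp [Set.indicator_apply]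
  rw [h3, ← Real.enorm_eq_ofReal_abs]
  refine (enorm_integral_le_lintegral_enorm _).trans (lintegral_mono fun t => ?_)
  rw [Real.enorm_eq_ofReal_abs]

section Multiplier

set_option linter.unusedSectionVars false

variable {Ω E Γ : Type*} [MeasurableSpace Ω] {μ : Measure Ω} [IsProbabilityMeasure μ]
  [TopologicalSpace E] [PolishSpace E] [MeasurableSpace E] [BorelSpace E] [TopologicalSpace Γ]
  [PolishSpace Γ] [MeasurableSpace Γ] [BorelSpace Γ] {P : Measure E} [IsProbabilityMeasure P]
  {f : E → Γ → ℝ} {S : Set Γ} {Z : ℕ → Ω → E} {V : ℕ → Ω → ℝ}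

/-- Observations at any fixed set of indices form an i.i.d. sample, and the supremum is insensitive
to their order, so only the cardinality matters. -/
theorem lintegral_supSum_subsample (hZ : ∀ i, Measurable (Z i)) (hi : iIndepFun Z μ)
    (hP : ∀ i, μ.map (Z i) = P) (hf : Measurable fun z : E × Γ => f z.1 z.2)
    (hS : MeasurableSet S) (I : Finset ℕ) :
    ∫⁻ ω, supSum f S (fun i : I => Z i ω) ∂μ = meanSup P f S I.card := by
  have h1 : μ.map (fun ω (j : Fin I.card) => Z (I.equivFin.symm j) ω) =
      Measure.pi fun _ => P := by
    have := hi.precomp (g := fun j => (I.equivFin.symm j : ℕ))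
      (Subtype.val_injective.comp I.equivFin.symm.injective)
    rw [iIndepFun_iff_map_fun_eq_pi_map fun i => (hZ _).aemeasurable] at this
    simpa [hP] using this
  rw [meanSup, ← h1, lintegral_map' (aemeasurable_supSum hf hS _) (by fun_prop)]
  exact lintegral_congr fun ω =>
    (supSum_comp_equiv f S (fun i : I => Z i ω) I.equivFin.symm).symm

/-- Each summand is a function of the weights times a function of the data, the form in which
independence and joint measurability can be used. -/
theorem supSum_active_eq_sum (n : ℕ) (t : ℝ) (ω : Ω) :
    supSum f S (fun i : active n (fun i => V i ω) t => Z i ω) =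
      ∑ I ∈ (Finset.range n).powerset,
        {z : (ℕ → ℝ) × ℝ | active n z.1 z.2 = I}.indicator (fun _ => (1 : ℝ≥0∞))
          ((fun i => V i ω), t) * supSum f S (fun i : I => Z i ω) := by
  rw [Finset.sum_eq_single (active n (fun i => V i ω) t)]
  · simp
  · intro I _ hI
    rw [Set.indicator_of_notMem (by simpa using hI.symm), zero_mul]
  · intro h
    exact absurd (Finset.mem_powerset.2 (Finset.filter_subset _ _)) h

/-- The selected indices depend on the weights alone, so given the weights the selected observations
are an i.i.d. sample of the selected size. -/
theorem lintegral_supSum_active (hZ : ∀ i, Measurable (Z i)) (hi : iIndepFun Z μ)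
    (hP : ∀ i, μ.map (Z i) = P) (hV : ∀ i, Measurable (V i))
    (hind : IndepFun (fun ω i => V i ω) (fun ω i => Z i ω) μ)
    (hf : Measurable fun z : E × Γ => f z.1 z.2) (hS : MeasurableSet S) (n : ℕ) (t : ℝ) :
    ∫⁻ ω, supSum f S (fun i : active n (fun i => V i ω) t => Z i ω) ∂μ =
      ∫⁻ ω, meanSup P f S (active n (fun i => V i ω) t).card ∂μ := by
  have hVm : Measurable fun ω i => V i ω := measurable_pi_iff.2 hV
  have hind1 : ∀ I : Finset ℕ, Measurable ({z : (ℕ → ℝ) × ℝ | active n z.1 z.2 = I}.indicator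
      (fun _ => (1 : ℝ≥0∞))) := fun I => measurable_const.indicator (measurableSet_active I)
  have hsub : ∀ I : Finset ℕ, AEMeasurable (fun ω => supSum f S (fun i : I => Z i ω)) μ := by
    intro I
    exact (aemeasurable_supSum hf hS (μ.map fun ω (i : I) => Z i ω)).comp_measurable (by fun_prop)
  have hindm : ∀ I : Finset ℕ, Measurable fun ω =>
      {z : (ℕ → ℝ) × ℝ | active n z.1 z.2 = I}.indicator (fun _ => (1 : ℝ≥0∞))
        ((fun i => V i ω), t) := fun I => (hind1 I).comp (hVm.prodMk measurable_const)
  simp_rw [supSum_active_eq_sum]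
  have hprod : ∀ I ∈ (Finset.range n).powerset, AEMeasurable (fun ω =>
      {z : (ℕ → ℝ) × ℝ | active n z.1 z.2 = I}.indicator (fun _ => (1 : ℝ≥0∞))
        ((fun i => V i ω), t) * supSum f S (fun i : I => Z i ω)) μ :=
    fun I _ => (hindm I).aemeasurable.mul (hsub I)
  rw [lintegral_finsetSum' _ hprod]
  have hfac : ∀ I : Finset ℕ, ∫⁻ ω, {z : (ℕ → ℝ) × ℝ | active n z.1 z.2 = I}.indicator
      (fun _ => (1 : ℝ≥0∞)) ((fun i => V i ω), t) * supSum f S (fun i : I => Z i ω) ∂μ =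
      ∫⁻ ω, {z : (ℕ → ℝ) × ℝ | active n z.1 z.2 = I}.indicator
      (fun _ => (1 : ℝ≥0∞)) ((fun i => V i ω), t) * meanSup P f S I.card ∂μ := by
    intro I
    have hI : IndepFun (fun ω => {z : (ℕ → ℝ) × ℝ | active n z.1 z.2 = I}.indicator
        (fun _ => (1 : ℝ≥0∞)) ((fun i => V i ω), t)) (fun ω => supSum f S (fun i : I => Z i ω))
        μ := by
      have h1 : IndepFun (fun ω i => V i ω) (fun ω (i : I) => Z i ω) μ :=
        hind.comp (φ := id) (ψ := fun (x : ℕ → E) (i : I) => x i) measurable_id (by fun_prop)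
      exact h1.comp₀ (φ := fun v => {z : (ℕ → ℝ) × ℝ | active n z.1 z.2 = I}.indicator
        (fun _ => (1 : ℝ≥0∞)) (v, t)) (ψ := supSum f S) hVm.aemeasurable
        (by fun_prop) ((hind1 I).comp (by fun_prop)).aemeasurable (aemeasurable_supSum hf hS _)
    rw [lintegral_mul_const _ (hindm I), ← lintegral_supSum_subsample hZ hi hP hf hS I]
    exact lintegral_mul_eq_lintegral_mul_lintegral_of_indepFun'' (hindm I).aemeasurable (hsub I) hI
  rw [Finset.sum_congr rfl fun I _ => hfac I,
    ← lintegral_finsetSum _ fun I _ => (hindm I).mul_const _]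
  refine lintegral_congr fun ω => ?_
  rw [Finset.sum_eq_single (active n (fun i => V i ω) t)]
  · simp
  · intro I _ hI
    rw [Set.indicator_of_notMem (by simpa using hI.symm), zero_mul]
  · intro h
    exact absurd (Finset.mem_powerset.2 (Finset.filter_subset _ _)) h

theorem lintegral_card_active_le (hV : ∀ i, Measurable (V i)) {τ : ℝ≥0∞} {t : ℝ}
    (hτ : ∀ i, μ {ω | t < V i ω} ≤ τ) (n : ℕ) :
    ∫⁻ ω, ((active n (fun i => V i ω) t).card : ℝ≥0∞) ∂μ ≤ n * τ := by
  have h1 : ∀ ω, ((active n (fun i => V i ω) t).card : ℝ≥0∞) =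
      ∑ i ∈ Finset.range n, {ω | t < V i ω}.indicator (fun _ => (1 : ℝ≥0∞)) ω := by
    intro ω
    simp only [active, Finset.card_filter, Nat.cast_sum]
    exact Finset.sum_congr rfl fun i _ => by simp [Set.indicator_apply]
  have hm : ∀ i, MeasurableSet {ω | t < V i ω} := fun i => measurableSet_lt measurable_const (hV i)
  simp_rw [h1]
  rw [lintegral_finsetSum _ fun i _ => measurable_const.indicator (hm i)]
  calc ∑ i ∈ Finset.range n, ∫⁻ ω, {ω | t < V i ω}.indicator (fun _ => (1 : ℝ≥0∞)) ω ∂μ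
      ≤ ∑ i ∈ Finset.range n, τ := by
        refine Finset.sum_le_sum fun i _ => ?_
        rw [lintegral_indicator (hm i)]
        simpa using hτ i
    _ = n * τ := by simp

theorem measurable_active_card (hV : ∀ i, Measurable (V i)) (n : ℕ) (t : ℝ) :
    Measurable fun ω => (active n (fun i => V i ω) t).card := by
  simp only [active, Finset.card_filter]
  refine Finset.measurable_fun_sum _ fun i _ => ?_
  exact Measurable.ite (measurableSet_lt measurable_const (hV i)) measurable_const measurable_const

theorem lintegral_meanSup_active_le (hV : ∀ i, Measurable (V i)) {τ : ℝ≥0∞} {t : ℝ}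
    (hτ : ∀ i, μ {ω | t < V i ω} ≤ τ) {A ε : ℝ≥0∞}
    (hm : ∀ k : ℕ, meanSup P f S k ≤ A * min 1 (k : ℝ≥0∞) + ε * (k : ℝ≥0∞) ^ (1 / 2 : ℝ)) (n : ℕ) :
    ∫⁻ ω, meanSup P f S (active n (fun i => V i ω) t).card ∂μ ≤
      A * min 1 (n * τ) + ε * (n * τ) ^ (1 / 2 : ℝ) := by
  have hcm : Measurable fun ω => ((active n (fun i => V i ω) t).card : ℝ≥0∞) :=
    (measurable_of_countable _).comp (measurable_active_card hV n t)
  have hcard := lintegral_card_active_le hV hτ n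
  refine (lintegral_mono fun ω => hm _).trans ?_
  rw [lintegral_add_left ((measurable_const.min hcm).const_mul _),
    lintegral_const_mul _ (measurable_const.min hcm), lintegral_const_mul _ (hcm.pow_const _)]
  gcongr
  · refine le_min ?_ ((lintegral_mono fun ω => min_le_right _ _).trans hcard)
    refine (lintegral_mono fun ω => min_le_left _ _).trans ?_
    simp
  -- Cauchy–Schwarz against the constant 1: the mean of √N is at most the root of the mean of N.
  · have := ENNReal.lintegral_mul_le_Lp_mul_Lq μ (Real.HolderConjugate.two_two)
      (f := fun ω => ((active n (fun i => V i ω) t).card : ℝ≥0∞) ^ (1 / 2 : ℝ)) (g := fun _ => 1)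
      (hcm.pow_const _).aemeasurable aemeasurable_const
    simp only [Pi.mul_apply, mul_one, ← ENNReal.rpow_mul, ENNReal.one_rpow, lintegral_const,
      measure_univ] at this
    refine this.trans ?_
    norm_num
    gcongr

/-- A multiplier inequality: the suprema of weighted sums are dominated by a random variable whose
mean is controlled by the means of unweighted sums and the tails of the weights. -/
theorem exists_dominating_multiplier (hZ : ∀ i, Measurable (Z i)) (hi : iIndepFun Z μ)
    (hP : ∀ i, μ.map (Z i) = P) (hV : ∀ i, Measurable (V i)) (hV0 : ∀ i ω, 0 ≤ V i ω)
    (hind : IndepFun (fun ω i => V i ω) (fun ω i => Z i ω) μ)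
    (hf : Measurable fun z : E × Γ => f z.1 z.2) (hS : MeasurableSet S)
    {τ : ℝ → ℝ≥0∞} (hτ : ∀ i t, μ {ω | t < V i ω} ≤ τ t) {A ε : ℝ≥0∞}
    (hm : ∀ k : ℕ, meanSup P f S k ≤ A * min 1 (k : ℝ≥0∞) + ε * (k : ℝ≥0∞) ^ (1 / 2 : ℝ)) (n : ℕ) :
    ∃ H : Ω → ℝ≥0∞, AEMeasurable H μ ∧
      (∀ ω, ∀ b ∈ S, ENNReal.ofReal |∑ i ∈ Finset.range n, V i ω * f (Z i ω) b| ≤ H ω) ∧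
      ∫⁻ ω, H ω ∂μ ≤
        ∫⁻ t in Set.Ioi (0 : ℝ), (A * min 1 (n * τ t) + ε * (n * τ t) ^ (1 / 2 : ℝ)) := by
  have hVm : Measurable fun ω i => V i ω := measurable_pi_iff.2 hV
  -- The dominating variable is the integral of `K` over the levels `t`; its mean is computed by
  -- exchanging the integrals.
  let K : Ω × ℝ → ℝ≥0∞ := fun z => supSum f S (fun i : active n (fun i => V i z.1) z.2 => Z i z.1)
  have hK : AEMeasurable K (μ.prod (volume.restrict (Set.Ioi 0))) := by
    have : K = fun z => ∑ I ∈ (Finset.range n).powerset,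
        {z : (ℕ → ℝ) × ℝ | active n z.1 z.2 = I}.indicator (fun _ => (1 : ℝ≥0∞))
          ((fun i => V i z.1), z.2) * supSum f S (fun i : I => Z i z.1) := by
      ext z
      exact supSum_active_eq_sum n z.2 z.1
    rw [this]
    refine Finset.aemeasurable_fun_sum _ fun I _ => AEMeasurable.mul ?_ ?_
    · exact ((measurable_const.indicator (measurableSet_active I)).comp
        ((hVm.comp measurable_fst).prodMk measurable_snd)).aemeasurable
    · have : AEMeasurable (fun ω => supSum f S (fun i : I => Z i ω)) μ :=
        (aemeasurable_supSum hf hS (μ.map fun ω (i : I) => Z i ω)).comp_measurable (by fun_prop)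
      exact this.comp_fst
  refine ⟨fun ω => ∫⁻ t in Set.Ioi (0 : ℝ), K (ω, t), hK.lintegral_prod_right', ?_, ?_⟩
  · intro ω b hb
    refine (ofReal_abs_sum_mul_le (fun i => hV0 i ω) _).trans (lintegral_mono fun t => ?_)
    refine le_trans (le_of_eq ?_) (le_supSum f _ hb)
    rw [← Finset.sum_coe_sort]
  · rw [lintegral_lintegral_swap hK]
    refine lintegral_mono fun t => ?_
    rw [lintegral_supSum_active hZ hi hP hV hind hf hS]
    exact lintegral_meanSup_active_le hV (fun i => hτ i t) hm n

end Multiplier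

/-! ### Asymptotic equicontinuity of weighted empirical processes -/

theorem min_one_le_rpow_half (x : ℝ≥0∞) : min 1 x ≤ x ^ (1 / 2 : ℝ) := by
  rcases le_total x 1 with h | h
  · rw [min_eq_right h]
    nth_rewrite 1 [← ENNReal.rpow_one x]
    exact ENNReal.rpow_le_rpow_of_exponent_ge h (by norm_num)
  · rw [min_eq_left h]
    exact ENNReal.one_le_rpow h (by norm_num)

theorem natCast_rpow_half (n : ℕ) : (n : ℝ≥0∞) ^ (1 / 2 : ℝ) = ENNReal.ofReal √n := by
  rw [Real.sqrt_eq_rpow, ← ENNReal.ofReal_rpow_of_nonneg (by positivity) (by norm_num),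
    ENNReal.ofReal_natCast]

/-- Dominated convergence: the integrand is at most `1 / √n`, and at most `τ t ^ (1 / 2)` by `min 1
x ≤ x ^ (1 / 2)`. The latter is integrable by the `L_{2,1}` condition. -/
theorem tendsto_lintegral_min_div_sqrt {τ : ℝ → ℝ≥0∞} (hτm : Measurable τ)
    (hτ : ∫⁻ t in Set.Ioi (0 : ℝ), τ t ^ (1 / 2 : ℝ) ≠ ∞) :
    Tendsto (fun n : ℕ => ∫⁻ t in Set.Ioi (0 : ℝ), min 1 (n * τ t) / ENNReal.ofReal √n)
      atTop (𝓝 0) := by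
  have hlim : Tendsto (fun n : ℕ => 1 / ENNReal.ofReal √n) atTop (𝓝 0) := by
    simp_rw [one_div]
    rw [← ENNReal.inv_top, tendsto_inv_iff]
    exact ENNReal.tendsto_ofReal_nhds_top.2
      (Real.tendsto_sqrt_atTop.comp tendsto_natCast_atTop_atTop)
  have key := tendsto_lintegral_filter_of_dominated_convergence
    (μ := volume.restrict (Set.Ioi (0 : ℝ))) (l := atTop)
    (F := fun (n : ℕ) t => min 1 (n * τ t) / ENNReal.ofReal √n) (f := fun _ => 0)
    (fun t => τ t ^ (1 / 2 : ℝ)) ?_ ?_ hτ ?_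
  · simpa using key
  · exact Eventually.of_forall fun n =>
      (measurable_const.min (hτm.const_mul _)).div_const _
  · filter_upwards [eventually_gt_atTop 0] with n hn
    refine ae_of_all _ fun t => ?_
    have hn' : 0 < √(n : ℝ) := Real.sqrt_pos.2 (by exact_mod_cast hn)
    rw [ENNReal.div_le_iff (by simpa using hn') ENNReal.ofReal_ne_top]
    refine (min_one_le_rpow_half _).trans (le_of_eq ?_)
    rw [ENNReal.mul_rpow_of_nonneg _ _ (by norm_num), natCast_rpow_half, mul_comm]
  · refine ae_of_all _ fun t => ?_
    refine tendsto_of_tendsto_of_tendsto_of_le_of_le tendsto_const_nhds hlim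
      (fun _ => zero_le) fun n => ?_
    exact ENNReal.div_le_div_right (min_le_left _ _) _

section Multiplier

variable {Ω E Γ : Type*} [MeasurableSpace Ω] {μ : Measure Ω} [IsProbabilityMeasure μ]
  [TopologicalSpace E] [PolishSpace E] [MeasurableSpace E] [BorelSpace E] [TopologicalSpace Γ]
  [PolishSpace Γ] [MeasurableSpace Γ] [BorelSpace Γ] {P : Measure E} [IsProbabilityMeasure P]
  {f : E → Γ → ℝ} {S : ℝ → Set Γ} {Z : ℕ → Ω → E} {V : ℕ → Ω → ℝ}

/-- Weighted sums over shrinking classes are asymptotically negligible if unweighted ones are and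
the weights, independent of the observations, satisfy the `L_{2,1}` condition. -/
theorem exists_measure_weighted_sum_le (hZ : ∀ i, Measurable (Z i)) (hi : iIndepFun Z μ)
    (hP : ∀ i, μ.map (Z i) = P) (hV : ∀ i, Measurable (V i))
    (hind : IndepFun (fun ω i => V i ω) (fun ω i => Z i ω) μ)
    (hf : Measurable fun z : E × Γ => f z.1 z.2) {M : ℝ} (hM0 : 0 ≤ M) (hM : ∀ x b, |f x b| ≤ M)
    (hS : ∀ δ, MeasurableSet (S δ))
    (h : ∀ ε > (0 : ℝ), ∀ η > (0 : ℝ), ∃ δ > (0 : ℝ), ∀ᶠ k : ℕ in atTop,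
      (Measure.pi fun _ : Fin k => P) {z | ENNReal.ofReal (ε * √k) < supSum f (S δ) z}
        ≤ ENNReal.ofReal η)
    {τ : ℝ → ℝ≥0∞} (hτm : Measurable τ) (hτ : ∀ i t, μ {ω | t < |V i ω|} ≤ τ t)
    (hτi : ∫⁻ t in Set.Ioi (0 : ℝ), τ t ^ (1 / 2 : ℝ) ≠ ∞)
    {ε : ℝ} (hε : 0 < ε) {η : ℝ} (hη : 0 < η) :
    ∃ δ > (0 : ℝ), ∀ᶠ n : ℕ in atTop,
      μ {ω | ∃ b ∈ S δ, ε * √n < |∑ i ∈ Finset.range n, V i ω * f (Z i ω) b|}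
        ≤ ENNReal.ofReal η := by
  set C := ∫⁻ t in Set.Ioi (0 : ℝ), τ t ^ (1 / 2 : ℝ) with hC
  -- The constants aim at a mean of at most `ε * η / 8 * √n`, one half from each term of the bound.
  -- Markov's inequality at level `ε / 2 * √n` then costs `η / 4` for each sign of the weights.
  set ε' : ℝ := ε * η / 16 / (C.toReal + 1) with hε'
  have hε'0 : 0 < ε' := by positivity
  obtain ⟨δ, hδ, n₀, hn₀⟩ := exists_meanSup_le P hf hM0 hM hS h hε'0
  refine ⟨δ, hδ, ?_⟩
  -- Subsamples smaller than `n₀` are bounded trivially, and empty ones contribute nothing, whence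
  -- the factor `min 1 k`. Since `δ` and `n₀` are already fixed, this term is `o(√n)`.
  set A := ENNReal.ofReal (n₀ * M) with hA
  have hm : ∀ k : ℕ, meanSup P f (S δ) k ≤
      A * min 1 (k : ℝ≥0∞) + ENNReal.ofReal ε' * (k : ℝ≥0∞) ^ (1 / 2 : ℝ) := by
    intro k
    rcases le_or_gt n₀ k with hk | hk
    · refine (hn₀ k hk).trans (le_add_left ?_)
      rw [ENNReal.ofReal_mul hε'0.le, natCast_rpow_half]
    · rcases Nat.eq_zero_or_pos k with rfl | hk0
      · rw [meanSup_zero]; exact zero_le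
      · refine le_add_right ?_
        rw [min_eq_left (by exact_mod_cast hk0), mul_one]
        refine (meanSup_le P hM (S δ) k).trans (ENNReal.ofReal_le_ofReal ?_)
        gcongr
  have hD : ∀ᶠ n : ℕ in atTop, ∫⁻ t in Set.Ioi (0 : ℝ),
      (A * min 1 (n * τ t) + ENNReal.ofReal ε' * (n * τ t) ^ (1 / 2 : ℝ)) ≤
      ENNReal.ofReal (ε * η / 8) * ENNReal.ofReal √n := by
    have hAlim : Tendsto (fun n : ℕ => A * ∫⁻ t in Set.Ioi (0 : ℝ),
        min 1 (n * τ t) / ENNReal.ofReal √n) atTop (𝓝 0) := by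
      have := ENNReal.Tendsto.const_mul (tendsto_lintegral_min_div_sqrt hτm hτi) (a := A)
        (Or.inr ENNReal.ofReal_ne_top)
      simpa using this
    have hpos : (0 : ℝ≥0∞) < ENNReal.ofReal (ε * η / 16) := by
      rw [ENNReal.ofReal_pos]; positivity
    filter_upwards [hAlim.eventually_lt_const hpos, eventually_gt_atTop 0] with n hn hn0
    have hn' : 0 < √(n : ℝ) := Real.sqrt_pos.2 (by exact_mod_cast hn0)
    have hs0 : ENNReal.ofReal √(n : ℝ) ≠ 0 := by simpa using hn'
    have e1 : ∀ t, A * min 1 (n * τ t) =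
        ENNReal.ofReal √n * (A * (min 1 (n * τ t) / ENNReal.ofReal √n)) := by
      intro t
      rw [mul_left_comm, ENNReal.mul_div_cancel hs0 ENNReal.ofReal_ne_top]
    have e2 : ∀ t, ENNReal.ofReal ε' * (n * τ t) ^ (1 / 2 : ℝ) =
        ENNReal.ofReal √n * (ENNReal.ofReal ε' * τ t ^ (1 / 2 : ℝ)) := by
      intro t
      rw [ENNReal.mul_rpow_of_nonneg _ _ (by norm_num), natCast_rpow_half, mul_left_comm]
    simp_rw [e1, e2]
    have m1 : Measurable fun t => min 1 (n * τ t) / ENNReal.ofReal √n :=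
      (measurable_const.min (hτm.const_mul _)).div_const _
    rw [lintegral_add_left ((m1.const_mul _).const_mul _), lintegral_const_mul _ (m1.const_mul _),
      lintegral_const_mul _ m1, lintegral_const_mul _ ((hτm.pow_const _).const_mul _),
      lintegral_const_mul _ (hτm.pow_const _), ← mul_add, mul_comm]
    gcongr
    have h3 : ENNReal.ofReal ε' * C ≤ ENNReal.ofReal (ε * η / 16) := by
      rw [← ENNReal.ofReal_toReal hτi, ← ENNReal.ofReal_mul hε'0.le]
      apply ENNReal.ofReal_le_ofReal
      rw [hε', div_mul_eq_mul_div, div_le_iff₀ (by positivity)]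
      have : 0 < ε * η / 16 := by positivity
      nlinarith
    refine (add_le_add hn.le h3).trans ?_
    rw [← ENNReal.ofReal_add (by positivity) (by positivity)]
    exact ENNReal.ofReal_le_ofReal (by linarith)
  -- The layer-cake bound needs nonnegative weights, so this is applied to the positive and the
  -- negative parts of `V`, both of which have tails dominated by those of `|V|`.
  have hpart : ∀ U : ℕ → Ω → ℝ, (∀ i, Measurable (U i)) → (∀ i ω, 0 ≤ U i ω) →
      (∀ i ω, U i ω ≤ |V i ω|) → IndepFun (fun ω i => U i ω) (fun ω i => Z i ω) μ →
      ∀ᶠ n : ℕ in atTop, μ {ω | ∃ b ∈ S δ,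
        ε / 2 * √n ≤ |∑ i ∈ Finset.range n, U i ω * f (Z i ω) b|} ≤ ENNReal.ofReal (η / 4) := by
    intro U hU hU0 hUV hUind
    filter_upwards [hD, eventually_gt_atTop 0] with n hn hn0
    have hn' : 0 < √(n : ℝ) := Real.sqrt_pos.2 (by exact_mod_cast hn0)
    obtain ⟨H, hHm, hH, hHi⟩ := exists_dominating_multiplier hZ hi hP hU hU0 hUind hf (hS δ)
      (fun i t => (measure_mono fun ω (hω : t < U i ω) => hω.trans_le (hUV i ω)).trans (hτ i t))
      hm n
    have hx : ENNReal.ofReal (ε / 2 * √n) ≠ 0 := by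
      simp only [ne_eq, ENNReal.ofReal_eq_zero, not_le]; positivity
    calc μ {ω | ∃ b ∈ S δ, ε / 2 * √n ≤ |∑ i ∈ Finset.range n, U i ω * f (Z i ω) b|}
        ≤ μ {ω | ENNReal.ofReal (ε / 2 * √n) ≤ H ω} := by
          refine measure_mono ?_
          rintro ω ⟨b, hb, hω⟩
          exact (ENNReal.ofReal_le_ofReal hω).trans (hH ω b hb)
      _ ≤ (∫⁻ ω, H ω ∂μ) / ENNReal.ofReal (ε / 2 * √n) :=
          meas_ge_le_lintegral_div hHm hx ENNReal.ofReal_ne_top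
      _ ≤ ENNReal.ofReal (ε * η / 8 * √n) / ENNReal.ofReal (ε / 2 * √n) := by
          gcongr
          rw [ENNReal.ofReal_mul (by positivity)]
          exact hHi.trans hn
      _ = ENNReal.ofReal (η / 4) := by
          rw [← ENNReal.ofReal_div_of_pos (by positivity)]
          congr 1
          field_simp
          ring
  have h1 := hpart (fun i ω => max (V i ω) 0) (fun i => (hV i).max measurable_const)
    (fun i ω => le_max_right _ _) (fun i ω => max_le (le_abs_self _) (abs_nonneg _))
    (hind.comp (φ := fun (v : ℕ → ℝ) i => max (v i) 0) (ψ := id)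
      (measurable_pi_iff.2 fun i => (measurable_pi_apply i).max measurable_const) measurable_id)
  have h2 := hpart (fun i ω => max (-V i ω) 0) (fun i => (hV i).neg.max measurable_const)
    (fun i ω => le_max_right _ _) (fun i ω => max_le (neg_le_abs _) (abs_nonneg _))
    (hind.comp (φ := fun (v : ℕ → ℝ) i => max (-v i) 0) (ψ := id)
      (measurable_pi_iff.2 fun i => (measurable_pi_apply i).neg.max measurable_const)
      measurable_id)
  filter_upwards [h1, h2] with n hn1 hn2
  refine (measure_mono ?_).trans ((measure_union_le _ _).trans ((add_le_add hn1 hn2).trans ?_))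
  · rintro ω ⟨b, hb, hω⟩
    by_contra hcon
    simp only [Set.mem_union, Set.mem_ofPred_eq, not_or, not_exists, not_and, not_le] at hcon
    have a1 := hcon.1 b hb
    have a2 := hcon.2 b hb
    have e : ∑ i ∈ Finset.range n, V i ω * f (Z i ω) b =
        ∑ i ∈ Finset.range n, max (V i ω) 0 * f (Z i ω) b -
        ∑ i ∈ Finset.range n, max (-V i ω) 0 * f (Z i ω) b := by
      rw [← Finset.sum_sub_distrib]
      refine Finset.sum_congr rfl fun i _ => ?_
      rw [← sub_mul, max_zero_sub_max_neg_zero_eq_self]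
    rw [e] at hω
    have := abs_sub (∑ i ∈ Finset.range n, max (V i ω) 0 * f (Z i ω) b)
      (∑ i ∈ Finset.range n, max (-V i ω) 0 * f (Z i ω) b)
    linarith
  · rw [← ENNReal.ofReal_add (by positivity) (by positivity)]
    exact ENNReal.ofReal_le_ofReal (by linarith)

end Multiplier

/-! ### Stochastic order symbols, for sequences that need not be measurable -/

section StochasticOrder

variable {Ω : Type*} [MeasurableSpace Ω] {F : Type*} [NormedAddCommGroup F]

/-- `T n = o_p(1)`. -/
def SmallOP (μ : Measure Ω) (T : ℕ → Ω → F) : Prop :=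
  ∀ ε > (0 : ℝ), ∀ η > (0 : ℝ), ∀ᶠ n in atTop, μ {ω | ε ≤ ‖T n ω‖} ≤ ENNReal.ofReal η

/-- `T n = O_p(1)`. -/
def BigOP (μ : Measure Ω) (T : ℕ → Ω → F) : Prop :=
  ∀ η > (0 : ℝ), ∃ K > (0 : ℝ), ∀ᶠ n in atTop, μ {ω | K ≤ ‖T n ω‖} ≤ ENNReal.ofReal η

variable {μ : Measure Ω} {T U : ℕ → Ω → F}

theorem tendsto_measure_zero_iff {u : ℕ → ℝ≥0∞} :
    Tendsto u atTop (𝓝 0) ↔ ∀ η > (0 : ℝ), ∀ᶠ n in atTop, u n ≤ ENNReal.ofReal η := by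
  rw [ENNReal.tendsto_nhds_zero]
  constructor
  · exact fun h η hη => h _ (ENNReal.ofReal_pos.2 hη)
  · intro h a ha
    rcases eq_or_ne a ∞ with rfl | hne
    · simp
    · have := h a.toReal (ENNReal.toReal_pos ha.ne' hne)
      rwa [ENNReal.ofReal_toReal hne] at this

theorem tendstoInMeasure_zero_iff : TendstoInMeasure μ T atTop (fun _ => 0) ↔ SmallOP μ T := by
  rw [tendstoInMeasure_iff_norm]
  refine forall₂_congr fun ε _ => ?_
  rw [tendsto_measure_zero_iff]
  simp

theorem tendstoInMeasure_const_iff {a : F} :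
    TendstoInMeasure μ T atTop (fun _ => a) ↔ SmallOP μ (fun n ω => T n ω - a) := by
  rw [tendstoInMeasure_iff_norm]
  exact forall₂_congr fun ε _ => tendsto_measure_zero_iff

theorem SmallOP.of_le {F' : Type*} [NormedAddCommGroup F'] {U : ℕ → Ω → F'} (hT : SmallOP μ T)
    (h : ∀ n ω, ‖U n ω‖ ≤ ‖T n ω‖) : SmallOP μ U := fun ε hε η hη =>
  (hT ε hε η hη).mono fun n hn => (measure_mono fun ω (hω : ε ≤ ‖U n ω‖) => hω.trans (h n ω)).trans hn

theorem BigOP.of_le {F' : Type*} [NormedAddCommGroup F'] {U : ℕ → Ω → F'} (hT : BigOP μ T)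
    (h : ∀ n ω, ‖U n ω‖ ≤ ‖T n ω‖) : BigOP μ U := fun η hη => by
  obtain ⟨K, hK, hev⟩ := hT η hη
  exact ⟨K, hK, hev.mono fun n hn =>
    (measure_mono fun ω (hω : K ≤ ‖U n ω‖) => hω.trans (h n ω)).trans hn⟩

theorem SmallOP.bigOP (hT : SmallOP μ T) : BigOP μ T := fun η hη =>
  ⟨1, one_pos, hT 1 one_pos η hη⟩

theorem measure_union_le_ofReal {A B C : Set Ω} {η : ℝ} (hη : 0 < η) (h : A ⊆ B ∪ C)
    (hB : μ B ≤ ENNReal.ofReal (η / 2)) (hC : μ C ≤ ENNReal.ofReal (η / 2)) :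
    μ A ≤ ENNReal.ofReal η := by
  refine (measure_mono h).trans ((measure_union_le _ _).trans ((add_le_add hB hC).trans ?_))
  rw [← ENNReal.ofReal_add (by positivity) (by positivity)]
  exact ENNReal.ofReal_le_ofReal (by linarith)

theorem SmallOP.add (hT : SmallOP μ T) (hU : SmallOP μ U) :
    SmallOP μ (fun n ω => T n ω + U n ω) := by
  intro ε hε η hη
  filter_upwards [hT (ε / 2) (by positivity) (η / 2) (by positivity),
    hU (ε / 2) (by positivity) (η / 2) (by positivity)] with n h1 h2
  refine measure_union_le_ofReal hη (fun ω hω => ?_) h1 h2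
  by_contra hcon
  simp only [Set.mem_union, Set.mem_ofPred_eq, not_or, not_le] at hcon hω
  have := norm_add_le (T n ω) (U n ω)
  linarith [hcon.1, hcon.2]

theorem SmallOP.neg (hT : SmallOP μ T) : SmallOP μ (fun n ω => -T n ω) :=
  hT.of_le fun n ω => by simp

theorem SmallOP.sub (hT : SmallOP μ T) (hU : SmallOP μ U) :
    SmallOP μ (fun n ω => T n ω - U n ω) := by
  simpa [sub_eq_add_neg] using hT.add hU.neg

theorem BigOP.add (hT : BigOP μ T) (hU : BigOP μ U) :
    BigOP μ (fun n ω => T n ω + U n ω) := by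
  intro η hη
  obtain ⟨K, hK, h1⟩ := hT (η / 2) (by positivity)
  obtain ⟨L, hL, h2⟩ := hU (η / 2) (by positivity)
  refine ⟨K + L, by positivity, ?_⟩
  filter_upwards [h1, h2] with n h1 h2
  refine measure_union_le_ofReal hη (fun ω hω => ?_) h1 h2
  by_contra hcon
  simp only [Set.mem_union, Set.mem_ofPred_eq, not_or, not_le] at hcon hω
  have := norm_add_le (T n ω) (U n ω)
  linarith [hcon.1, hcon.2]

theorem bigOP_const (a : F) : BigOP μ (fun _ _ => a) := by
  intro η hη
  refine ⟨‖a‖ + 1, by positivity, Eventually.of_forall fun n => ?_⟩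
  have : {ω : Ω | ‖a‖ + 1 ≤ ‖a‖} = ∅ := by
    ext ω; simp
  rw [this]
  simp

theorem BigOP.mul_smallOP {T U : ℕ → Ω → ℝ} (hT : BigOP μ T) (hU : SmallOP μ U) :
    SmallOP μ (fun n ω => T n ω * U n ω) := by
  intro ε hε η hη
  obtain ⟨K, hK, h1⟩ := hT (η / 2) (by positivity)
  filter_upwards [h1, hU (ε / K) (by positivity) (η / 2) (by positivity)] with n h1 h2
  refine measure_union_le_ofReal hη (fun ω hω => ?_) h1 h2
  by_contra hcon
  simp only [Set.mem_union, Set.mem_ofPred_eq, not_or, not_le] at hcon hω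
  have h3 : ‖T n ω * U n ω‖ < K * (ε / K) := by
    rw [norm_mul]
    exact mul_lt_mul'' hcon.1 hcon.2 (norm_nonneg _) (norm_nonneg _)
  rw [mul_div_cancel₀ _ hK.ne'] at h3
  exact absurd hω (not_le.2 h3)

/-- Lets an algebraic identity fail on events of vanishing probability, such as those where a random
denominator may be zero. -/
theorem SmallOP.congr_event {A : ℕ → Set Ω} (hT : SmallOP μ T)
    (hA : ∀ η > (0 : ℝ), ∀ᶠ n in atTop, μ (A n) ≤ ENNReal.ofReal η)
    (h : ∀ᶠ n in atTop, ∀ ω ∉ A n, U n ω = T n ω) : SmallOP μ U := by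
  intro ε hε η hη
  filter_upwards [hT ε hε (η / 2) (by positivity), hA (η / 2) (by positivity), h] with n h1 h2 h3
  refine measure_union_le_ofReal hη (fun ω hω => ?_) h1 h2
  by_cases hω' : ω ∈ A n
  · exact Or.inr hω'
  · left
    simp only [Set.mem_ofPred_eq] at hω ⊢
    rwa [← h3 ω hω']

theorem SmallOP.continuousAt_comp {F' : Type*} [NormedAddCommGroup F'] {a : F} {φ : F → F'}
    (hφ : ContinuousAt φ a) (hT : SmallOP μ (fun n ω => T n ω - a)) :
    SmallOP μ (fun n ω => φ (T n ω) - φ a) := by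
  intro ε hε η hη
  obtain ⟨δ, hδ, hφδ⟩ := Metric.continuousAt_iff.1 hφ ε hε
  filter_upwards [hT δ hδ η hη] with n hn
  refine (measure_mono fun ω hω => ?_).trans hn
  by_contra hcon
  simp only [Set.mem_ofPred_eq, not_le] at hcon hω
  have := hφδ (x := T n ω) (by rwa [dist_eq_norm])
  rw [dist_eq_norm] at this
  linarith

theorem SmallOP.sum {ι : Type*} {T : ι → ℕ → Ω → F} (s : Finset ι)
    (h : ∀ i ∈ s, SmallOP μ (T i)) : SmallOP μ (fun n ω => ∑ i ∈ s, T i n ω) := by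
  classical
  induction s using Finset.induction_on with
  | empty =>
    intro ε hε η hη
    refine Eventually.of_forall fun n => ?_
    have : {ω : Ω | ε ≤ ‖(0 : F)‖} = ∅ := by
      ext ω; simpa using hε
    simp only [Finset.sum_empty, this, measure_empty, zero_le]
  | insert a s ha ih =>
    simp only [Finset.sum_insert ha]
    exact (h a (Finset.mem_insert_self _ _)).add
      (ih fun i hi => h i (Finset.mem_insert_of_mem hi))

theorem BigOP.sum {ι : Type*} {T : ι → ℕ → Ω → F} (s : Finset ι)
    (h : ∀ i ∈ s, BigOP μ (T i)) : BigOP μ (fun n ω => ∑ i ∈ s, T i n ω) := by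
  classical
  induction s using Finset.induction_on with
  | empty => simpa using bigOP_const (0 : F)
  | insert a s ha ih =>
    simp only [Finset.sum_insert ha]
    exact (h a (Finset.mem_insert_self _ _)).add
      (ih fun i hi => h i (Finset.mem_insert_of_mem hi))

theorem norm_le_sum_abs {d : ℕ} (v : Vec d) : ‖v‖ ≤ ∑ i, |v i| := by
  rw [EuclideanSpace.norm_eq, Real.sqrt_le_left (Finset.sum_nonneg fun i _ => abs_nonneg _)]
  simp only [Real.norm_eq_abs]
  exact Finset.sum_sq_le_sq_sum_of_nonneg fun i _ => abs_nonneg _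

theorem SmallOP.of_coord {d : ℕ} {T : ℕ → Ω → Vec d} (h : ∀ i, SmallOP μ (fun n ω => T n ω i)) :
    SmallOP μ T := by
  refine (SmallOP.sum Finset.univ fun i _ => (h i).of_le
    (U := fun n ω => |T n ω i|) fun n ω => by simp).of_le fun n ω => ?_
  rw [Real.norm_eq_abs, abs_of_nonneg (Finset.sum_nonneg fun i _ => abs_nonneg _)]
  exact norm_le_sum_abs (T n ω)

theorem BigOP.of_coord {d : ℕ} {T : ℕ → Ω → Vec d} (h : ∀ i, BigOP μ (fun n ω => T n ω i)) :
    BigOP μ T := by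
  refine (BigOP.sum Finset.univ fun i _ => (h i).of_le
    (U := fun n ω => |T n ω i|) fun n ω => by simp).of_le fun n ω => ?_
  rw [Real.norm_eq_abs, abs_of_nonneg (Finset.sum_nonneg fun i _ => abs_nonneg _)]
  exact norm_le_sum_abs (T n ω)

/-- Consistency from a `√n`-rate. -/
theorem BigOP.smallOP_of_sqrt_smul [NormedSpace ℝ F] (h : BigOP μ (fun n ω => √(n : ℝ) • T n ω)) :
    SmallOP μ T := by
  intro ε hε η hη
  obtain ⟨K, hK, hev⟩ := h η hη
  have hlim : Tendsto (fun n : ℕ => √(n : ℝ)) atTop atTop :=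
    Real.tendsto_sqrt_atTop.comp tendsto_natCast_atTop_atTop
  filter_upwards [hev, hlim.eventually_ge_atTop (K / ε)] with n h1 h2
  refine (measure_mono fun ω (hω : ε ≤ ‖T n ω‖) => ?_).trans h1
  simp only [Set.mem_ofPred_eq]
  rw [norm_smul, Real.norm_eq_abs, abs_of_nonneg (Real.sqrt_nonneg _)]
  calc K = K / ε * ε := by field_simp
    _ ≤ √(n : ℝ) * ‖T n ω‖ := by gcongr

/-- The delta method, as an asymptotic expansion. -/
theorem smallOP_delta {E : Type*} [NormedAddCommGroup E] [InnerProductSpace ℝ E] [CompleteSpace E]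
    {φ : E → ℝ} {x : E} (hφ : DifferentiableAt ℝ φ x) {b : ℕ → Ω → E}
    (hb : BigOP μ (fun n ω => √(n : ℝ) • (b n ω - x))) :
    SmallOP μ (fun n ω => √(n : ℝ) * (φ (b n ω) - φ x) -
      inner ℝ (gradient φ x) (√(n : ℝ) • (b n ω - x))) := by
  have hcons := hb.smallOP_of_sqrt_smul
  have hgrad := hφ.hasGradientAt
  rw [hasGradientAt_iff_isLittleO] at hgrad
  intro ε hε η hη
  obtain ⟨K, hK, hev⟩ := hb (η / 2) (by positivity)
  -- With probability close to one the scaled deviation is below `K`, so this slope bounds the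
  -- scaled remainder by `ε / 2`.
  have hev2 := hgrad.def (c := ε / (2 * K)) (by positivity)
  obtain ⟨δ, hδ, hball⟩ := Metric.eventually_nhds_iff.1 hev2
  filter_upwards [hev, hcons δ hδ (η / 2) (by positivity)] with n h1 h2
  refine measure_union_le_ofReal hη (fun ω hω => ?_) h1 h2
  by_contra hcon
  simp only [Set.mem_union, Set.mem_ofPred_eq, not_or, not_le] at hcon hω
  have h3 := hball (y := b n ω) (by rw [dist_eq_norm]; exact hcon.2)
  rw [inner_smul_right, ← mul_sub, norm_mul, Real.norm_eq_abs,
    abs_of_nonneg (Real.sqrt_nonneg _)] at hω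
  have h4 : √(n : ℝ) * ‖φ (b n ω) - φ x - inner ℝ (gradient φ x) (b n ω - x)‖ ≤
      √(n : ℝ) * (ε / (2 * K) * ‖b n ω - x‖) := by gcongr
  have h5 : √(n : ℝ) * (ε / (2 * K) * ‖b n ω - x‖) = ε / (2 * K) * ‖√(n : ℝ) • (b n ω - x)‖ := by
    rw [norm_smul, Real.norm_eq_abs, abs_of_nonneg (Real.sqrt_nonneg _)]; ring
  have h6 : ε / (2 * K) * ‖√(n : ℝ) • (b n ω - x)‖ ≤ ε / (2 * K) * K := by
    gcongr
    exact hcon.1.le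
  have h7 : ε / (2 * K) * K = ε / 2 := by field_simp
  linarith

end StochasticOrder

/-! ### Sums with weights that are independent of the data -/

/-- Square-integrable i.i.d. weights with mean one, independent of the data, that satisfy the
`L_{2,1}` condition. -/
structure MeanOneWeights {Ω : Type*} [MeasurableSpace Ω] (μ : Measure Ω) {k : ℕ}
    (V Y : ℕ → Ω → ℝ) (X : ℕ → Ω → Vec k) : Prop where
  measurable : ∀ i, Measurable (V i)
  indep : iIndepFun V μ
  ident : ∀ i, IdentDistrib (V i) (V 0) μ μ
  indep_data : IndepFun (fun ω i => V i ω) (fun ω i => (Y i ω, X i ω)) μ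
  memLp_two : MemLp (V 0) 2 μ
  mean_one : ∫ ω, V 0 ω ∂μ = 1
  tail : IntegrableOn (fun t : ℝ => √(μ.real {ω | t < |V 0 ω|})) (Set.Ioi 0)

theorem integral_coord {Ω : Type*} [MeasurableSpace Ω] {μ : Measure Ω} {d : ℕ} {T : Ω → Vec d}
    (h : Integrable T μ) (i : Fin d) : ∫ ω, T ω i ∂μ = (∫ ω, T ω ∂μ) i := by
  have := (EuclideanSpace.proj (𝕜 := ℝ) i).integral_comp_comm h
  simpa using this

section

variable {Ω : Type*} [MeasurableSpace Ω] {μ : Measure Ω} {k p : ℕ} {V W Y : ℕ → Ω → ℝ}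
  {X : ℕ → Ω → Vec k}

theorem BootstrapWeights.meanOneWeights (h : BootstrapWeights μ W Y X) :
    MeanOneWeights μ W Y X :=
  ⟨h.measurable, h.indep, h.ident, h.indep_data, h.memLp_two, h.mean_one, h.tail⟩

/-- Constant weights recover the original estimators, so a single expansion serves the sample and
the bootstrap; for this reason `MeanOneWeights` does not fix the variance. -/
theorem meanOneWeights_one [IsProbabilityMeasure μ] :
    MeanOneWeights μ (fun _ _ => 1) Y X where
  measurable _ := measurable_const
  indep := by
    rw [iIndepFun_iff]
    intro s m hm
    have key : ∀ i ∈ s, m i = ∅ ∨ m i = Set.univ := by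
      intro i hi
      have := hm i hi
      rw [MeasurableSpace.comap_const] at this
      exact MeasurableSpace.measurableSet_bot_iff.1 this
    by_cases he : ∃ i ∈ s, m i = ∅
    · obtain ⟨i, hi, hie⟩ := he
      rw [Finset.prod_eq_zero hi (by simp [hie])]
      exact measure_mono_null (Set.iInter₂_subset i hi) (by simp [hie])
    · push Not at he
      have hu : ∀ i ∈ s, m i = Set.univ := fun i hi =>
        (key i hi).resolve_left (he i hi).ne_empty
      rw [Finset.prod_congr rfl fun i hi => by rw [hu i hi], Set.iInter₂_congr hu]
      simp
  ident _ := IdentDistrib.refl aemeasurable_const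
  indep_data := indepFun_const_left _ _
  memLp_two := memLp_const 1
  mean_one := by simp
  tail := by
    have h : ∀ t : ℝ, √(μ.real {ω : Ω | t < |(1 : ℝ)|}) = (Set.Iio 1).indicator (fun _ => 1) t := by
      intro t
      by_cases ht : t < 1 <;> simp [ht]
    simp_rw [h]
    rw [IntegrableOn, integrable_indicator_iff measurableSet_Iio, IntegrableOn,
      Measure.restrict_restrict measurableSet_Iio, Set.inter_comm, Set.Ioi_inter_Iio]
    simp

theorem IIDSample.measurable_obs (h : IIDSample μ Y X) (i : ℕ) :
    Measurable fun ω => (Y i ω, X i ω) := (h.measurable_Y i).prodMk (h.measurable_X i)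

theorem IIDSample.measurable_path (h : IIDSample μ Y X) :
    Measurable fun ω (i : ℕ) => (Y i ω, X i ω) := measurable_pi_iff.2 h.measurable_obs

theorem IIDSample.integral_comp (h : IIDSample μ Y X) {φ : ℝ × Vec k → ℝ} (hφ : Measurable φ)
    (i : ℕ) : ∫ ω, φ (Y i ω, X i ω) ∂μ = ∫ ω, φ (Y 0 ω, X 0 ω) ∂μ :=
  ((h.ident i).comp hφ).integral_eq

theorem MeanOneWeights.memLp (h : MeanOneWeights μ V Y X) (i : ℕ) : MemLp (V i) 2 μ :=
  (h.ident i).memLp_iff.2 h.memLp_two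

theorem IIDSample.memLp_comp (h : IIDSample μ Y X) {φ : ℝ × Vec k → ℝ} (hφ : Measurable φ)
    {q : ℝ≥0∞} (hm : MemLp (fun ω => φ (Y 0 ω, X 0 ω)) q μ) (i : ℕ) :
    MemLp (fun ω => φ (Y i ω, X i ω)) q μ :=
  ((h.ident i).comp hφ).memLp_iff.2 hm

/-- Two square-integrable factors have a square-integrable product here only because they are
independent. -/
theorem memLp_weighted_mul (hd : IIDSample μ Y X) (hV : MeanOneWeights μ V Y X)
    {φ : ℝ × Vec k → ℝ} (hφ : Measurable φ) (hφ2 : MemLp (fun ω => φ (Y 0 ω, X 0 ω)) 2 μ)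
    (i : ℕ) : MemLp (fun ω => V i ω * φ (Y i ω, X i ω)) 2 μ := by
  have hind : IndepFun (fun ω => V i ω ^ 2) (fun ω => φ (Y i ω, X i ω) ^ 2) μ :=
    hV.indep_data.comp (φ := fun v : ℕ → ℝ => v i ^ 2)
      (ψ := fun z : ℕ → ℝ × Vec k => φ (z i) ^ 2) (by fun_prop) (by fun_prop)
  have hm : AEStronglyMeasurable (fun ω => V i ω * φ (Y i ω, X i ω)) μ :=
    ((hV.measurable i).mul (hφ.comp (hd.measurable_obs i))).aestronglyMeasurable
  rw [memLp_two_iff_integrable_sq hm]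
  simp_rw [mul_pow]
  exact hind.integrable_mul (hV.memLp i).integrable_sq (hd.memLp_comp hφ hφ2 i).integrable_sq

/-- Off the diagonal the data factor already has mean zero, so the weights need not be centered. -/
theorem integral_weighted_cross (hd : IIDSample μ Y X) (hV : MeanOneWeights μ V Y X)
    {φ : ℝ × Vec k → ℝ} (hφ : Measurable φ) (hφ0 : ∫ ω, φ (Y 0 ω, X 0 ω) ∂μ = 0)
    (i j : ℕ) :
    ∫ ω, (V i ω * φ (Y i ω, X i ω)) * (V j ω * φ (Y j ω, X j ω)) ∂μ =
      if i = j then (∫ ω, V 0 ω ^ 2 ∂μ) * ∫ ω, φ (Y 0 ω, X 0 ω) ^ 2 ∂μ else 0 := by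
  have h1 : ∫ ω, (V i ω * φ (Y i ω, X i ω)) * (V j ω * φ (Y j ω, X j ω)) ∂μ =
      (∫ ω, V i ω * V j ω ∂μ) * ∫ ω, φ (Y i ω, X i ω) * φ (Y j ω, X j ω) ∂μ := by
    rw [← hV.indep_data.integral_fun_comp_mul_comp (f := fun v : ℕ → ℝ => v i * v j)
      (g := fun z : ℕ → ℝ × Vec k => φ (z i) * φ (z j))
      (measurable_pi_iff.2 hV.measurable).aemeasurable hd.measurable_path.aemeasurable
      (by fun_prop) (Measurable.aestronglyMeasurable (by fun_prop))]
    exact integral_congr_ae (ae_of_all _ fun ω => by ring)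
  rw [h1]
  split_ifs with hij
  · subst hij
    simp_rw [← sq]
    rw [hd.integral_comp (φ := fun z => φ z ^ 2) (by fun_prop)]
    congr 1
    exact ((hV.ident i).comp (u := fun x => x ^ 2) (by fun_prop)).integral_eq
  · have hi : IndepFun (fun ω => (Y i ω, X i ω)) (fun ω => (Y j ω, X j ω)) μ :=
      hd.indep.indepFun hij
    have := hi.integral_fun_comp_mul_comp (f := φ) (g := φ) (hd.measurable_obs i).aemeasurable
      (hd.measurable_obs j).aemeasurable hφ.aestronglyMeasurable hφ.aestronglyMeasurable
    rw [this, hd.integral_comp hφ i, hφ0]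
    simp

theorem integral_weighted_sum_sq (hd : IIDSample μ Y X) (hV : MeanOneWeights μ V Y X)
    {φ : ℝ × Vec k → ℝ} (hφ : Measurable φ) (hφ2 : MemLp (fun ω => φ (Y 0 ω, X 0 ω)) 2 μ)
    (hφ0 : ∫ ω, φ (Y 0 ω, X 0 ω) ∂μ = 0) (n : ℕ) :
    ∫ ω, (∑ i ∈ Finset.range n, V i ω * φ (Y i ω, X i ω)) ^ 2 ∂μ =
      n * ((∫ ω, V 0 ω ^ 2 ∂μ) * ∫ ω, φ (Y 0 ω, X 0 ω) ^ 2 ∂μ) := by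
  simp_rw [sq (∑ i ∈ Finset.range n, _), Finset.sum_mul_sum]
  have hi : ∀ i j, Integrable (fun ω => (V i ω * φ (Y i ω, X i ω)) *
      (V j ω * φ (Y j ω, X j ω))) μ := fun i j =>
    (memLp_weighted_mul hd hV hφ hφ2 i).integrable_mul (memLp_weighted_mul hd hV hφ hφ2 j)
  rw [integral_finsetSum _ fun i _ => integrable_finsetSum _ fun j _ => hi i j]
  simp_rw [integral_finsetSum _ fun j _ => hi _ j, integral_weighted_cross hd hV hφ hφ0]
  rw [Finset.sum_congr rfl fun i hi => by rw [Finset.sum_ite_eq, if_pos hi]]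
  simp

variable [IsProbabilityMeasure μ]

theorem bigOP_weighted_sum (hd : IIDSample μ Y X) (hV : MeanOneWeights μ V Y X)
    {φ : ℝ × Vec k → ℝ} (hφ : Measurable φ) (hφ2 : MemLp (fun ω => φ (Y 0 ω, X 0 ω)) 2 μ)
    (hφ0 : ∫ ω, φ (Y 0 ω, X 0 ω) ∂μ = 0) :
    BigOP μ (fun (n : ℕ) ω => 1 / √n * ∑ i ∈ Finset.range n, V i ω * φ (Y i ω, X i ω)) := by
  intro η hη
  set σ := (∫ ω, V 0 ω ^ 2 ∂μ) * ∫ ω, φ (Y 0 ω, X 0 ω) ^ 2 ∂μ with hσ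
  have hσ0 : 0 ≤ σ := mul_nonneg (integral_nonneg fun _ => sq_nonneg _)
    (integral_nonneg fun _ => sq_nonneg _)
  -- Chebyshev's constant; the added 1 keeps it positive when `σ = 0`.
  set K := √((σ + 1) / η) with hK
  have hK0 : 0 < K := Real.sqrt_pos.2 (by positivity)
  refine ⟨K, hK0, ?_⟩
  filter_upwards [eventually_gt_atTop 0] with n hn
  have hn' : 0 < √(n : ℝ) := Real.sqrt_pos.2 (by exact_mod_cast hn)
  have hint : Integrable (fun ω => (∑ i ∈ Finset.range n, V i ω * φ (Y i ω, X i ω)) ^ 2) μ :=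
    (memLp_finsetSum _ fun i _ => memLp_weighted_mul hd hV hφ hφ2 i).integrable_sq
  have hmk := mul_meas_ge_le_integral_of_nonneg (ae_of_all _ fun ω => sq_nonneg _) hint (K ^ 2 * n)
  rw [integral_weighted_sum_sq hd hV hφ hφ2 hφ0, ← hσ] at hmk
  have hsub : {ω | K ≤ ‖1 / √(n : ℝ) * ∑ i ∈ Finset.range n, V i ω * φ (Y i ω, X i ω)‖} ⊆
      {ω | K ^ 2 * n ≤ (∑ i ∈ Finset.range n, V i ω * φ (Y i ω, X i ω)) ^ 2} := by
    intro ω hω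
    simp only [Set.mem_ofPred_eq] at hω ⊢
    rw [norm_mul, Real.norm_eq_abs, Real.norm_eq_abs, abs_of_pos (by positivity),
      one_div_mul_eq_div, le_div_iff₀ hn'] at hω
    have := pow_le_pow_left₀ (by positivity) hω 2
    rwa [mul_pow, Real.sq_sqrt (Nat.cast_nonneg n), sq_abs] at this
  have hn0 : (0 : ℝ) < n := by exact_mod_cast hn
  have h2 : K ^ 2 = (σ + 1) / η := Real.sq_sqrt (by positivity)
  have h3 : μ.real {ω | K ^ 2 * n ≤ (∑ i ∈ Finset.range n, V i ω * φ (Y i ω, X i ω)) ^ 2} ≤ η := by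
    set m := μ.real {ω | K ^ 2 * n ≤ (∑ i ∈ Finset.range n, V i ω * φ (Y i ω, X i ω)) ^ 2}
    have h4 : K ^ 2 * m ≤ σ := by
      have : (n : ℝ) * (K ^ 2 * m) ≤ n * σ := by linarith
      exact le_of_mul_le_mul_left this hn0
    rw [h2, div_mul_eq_mul_div, div_le_iff₀ hη] at h4
    have : (σ + 1) * m ≤ (σ + 1) * η := by linarith [mul_comm σ η]
    exact le_of_mul_le_mul_left this (by positivity)
  refine (measure_mono hsub).trans ?_
  rw [← ENNReal.ofReal_toReal (measure_ne_top μ _)]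
  exact ENNReal.ofReal_le_ofReal h3

theorem smallOP_mean_weights (hV : MeanOneWeights μ V Y X) :
    SmallOP μ (fun (n : ℕ) ω => (∑ i ∈ Finset.range n, V i ω) / n - 1) := by
  rw [← tendstoInMeasure_const_iff]
  refine tendstoInMeasure_of_tendsto_ae (fun n => ?_) ?_
  · exact ((Finset.measurable_fun_sum _ fun i _ => hV.measurable i).div_const
      _).aestronglyMeasurable
  · have := strong_law_ae_real V (hV.memLp_two.integrable (by norm_num))
      (fun i j hij => hV.indep.indepFun hij) hV.ident
    rwa [hV.mean_one] at this

end

/-! ### Rates within the group `Y = j` -/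

theorem ind_of {q : Prop} (h : q) : ind q = 1 := if_pos h

theorem ind_of_not {q : Prop} (h : ¬q) : ind q = 0 := if_neg h

theorem ind_mem (q : Prop) : 0 ≤ ind q ∧ ind q ≤ 1 := by
  by_cases h : q
  · simp [ind_of h]
  · simp [ind_of_not h]

theorem ind_and (q r : Prop) : ind (q ∧ r) = ind r * ind q := by
  by_cases hq : q <;> by_cases hr : r <;> simp [ind, hq, hr]

theorem measurable_ind {α : Type*} [MeasurableSpace α] {s : α → Prop}
    (h : MeasurableSet {a | s a}) : Measurable fun a => ind (s a) :=
  Measurable.ite h measurable_const measurable_const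

section

variable {Ω : Type*} [MeasurableSpace Ω] (μ : Measure Ω) {k p : ℕ} (V Y : ℕ → Ω → ℝ)
  (X : ℕ → Ω → Vec k) (G : Vec k → Vec p → ℝ) (βs : Vec p) (j c : ℝ)

/-- The probability `P(Y = j)`. -/
def labelProb : ℝ := μ.real {ω | Y 0 ω = j}

/-- The rate `P[G(X, β) > c | Y = j]`. -/
def rate (β : Vec p) : ℝ := (condProb μ Y j).real {ω | G (X 0 ω) β > c}

/-- The weighted empirical rate. -/
def weightedRate (n : ℕ) (β : Vec p) (ω : Ω) : ℝ :=
  (1 / ∑ i ∈ Finset.range n, V i ω * ind (Y i ω = j)) *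
    ∑ i ∈ Finset.range n, V i ω * ind (G (X i ω) β > c ∧ Y i ω = j)

/-- The centered indicator `1[y = j] (1[G(x, β*) > c] - P[G(X, β*) > c | Y = j])`. -/
def centeredInd (z : ℝ × Vec k) : ℝ :=
  ind (z.1 = j) * (ind (G z.2 βs > c) - rate μ Y X G j c βs)

/-- The increments of the centered indicators with respect to `β*`. -/
def incrementInd (z : ℝ × Vec k) (β : Vec p) : ℝ :=
  ind (z.1 = j) * ((ind (G z.2 β > c) - rate μ Y X G j c β) -
    (ind (G z.2 βs > c) - rate μ Y X G j c βs))

variable {μ V Y X G βs j c}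

theorem isProbabilityMeasure_condProb [IsFiniteMeasure μ] (hj : 0 < labelProb μ Y j) :
    IsProbabilityMeasure (condProb μ Y j) :=
  cond_isProbabilityMeasure fun h => by simp [labelProb, Measure.real, h] at hj

theorem IIDSample.labelProb_zero [IsProbabilityMeasure μ] (hd : IIDSample μ Y X) :
    labelProb μ Y 0 = 1 - prevalence μ Y := by
  have hm : MeasurableSet {ω | Y 0 ω = 1} := measurableSet_eq_fun (hd.measurable_Y 0)
    measurable_const
  rw [prevalence, ← probReal_compl_eq_one_sub hm, labelProb]
  congr 1
  ext ω
  rcases hd.binary 0 ω with h | h <;> simp [h]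

theorem rate_mem [IsProbabilityMeasure μ] (hj : 0 < labelProb μ Y j) (β : Vec p) :
    0 ≤ rate μ Y X G j c β ∧ rate μ Y X G j c β ≤ 1 := by
  have := isProbabilityMeasure_condProb hj
  exact ⟨measureReal_nonneg, measureReal_le_one⟩

theorem measurable_rate [IsProbabilityMeasure μ] (hd : IIDSample μ Y X)
    (hG : Measurable fun z : Vec k × Vec p => G z.1 z.2) (hj : 0 < labelProb μ Y j) :
    Measurable (rate μ Y X G j c) := by
  have := isProbabilityMeasure_condProb hj
  have hs : MeasurableSet {z : Vec p × Ω | G (X 0 z.2) z.1 > c} :=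
    measurableSet_lt measurable_const
      (hG.comp (((hd.measurable_X 0).comp measurable_snd).prodMk measurable_fst))
  exact (measurable_measure_prodMk_left hs).ennreal_toReal

theorem measurable_centeredInd (hG : Measurable fun z : Vec k × Vec p => G z.1 z.2) :
    Measurable (centeredInd μ Y X G βs j c) := by
  refine (measurable_ind (measurableSet_eq_fun measurable_fst measurable_const)).mul
    (Measurable.sub_const (measurable_ind ?_) _)
  exact measurableSet_lt measurable_const (hG.comp (measurable_snd.prodMk measurable_const))

theorem measurable_incrementInd [IsProbabilityMeasure μ] (hd : IIDSample μ Y X)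
    (hG : Measurable fun z : Vec k × Vec p => G z.1 z.2) (hj : 0 < labelProb μ Y j) :
    Measurable fun z : (ℝ × Vec k) × Vec p => incrementInd μ Y X G βs j c z.1 z.2 := by
  have hr : Measurable (rate μ Y X G j c) := measurable_rate hd hG hj
  refine (measurable_ind (measurableSet_eq_fun (measurable_fst.comp measurable_fst)
    measurable_const)).mul (Measurable.sub (Measurable.sub (measurable_ind ?_)
      (hr.comp measurable_snd)) (Measurable.sub_const (measurable_ind ?_) _))
  · exact measurableSet_lt measurable_const
      (hG.comp ((measurable_snd.comp measurable_fst).prodMk measurable_snd))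
  · exact measurableSet_lt measurable_const
      (hG.comp ((measurable_snd.comp measurable_fst).prodMk measurable_const))

theorem abs_centeredInd_le [IsProbabilityMeasure μ] (hj : 0 < labelProb μ Y j)
    (z : ℝ × Vec k) : |centeredInd μ Y X G βs j c z| ≤ 1 := by
  have h1 := ind_mem (z.1 = j)
  have h2 := ind_mem (G z.2 βs > c)
  have h3 := rate_mem (X := X) (G := G) (c := c) hj βs
  rw [centeredInd, abs_mul, abs_of_nonneg h1.1]
  refine mul_le_one₀ h1.2 (abs_nonneg _) ?_
  rw [abs_le]
  constructor <;> linarith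

theorem abs_incrementInd_le [IsProbabilityMeasure μ] (hj : 0 < labelProb μ Y j)
    (z : ℝ × Vec k) (β : Vec p) : |incrementInd μ Y X G βs j c z β| ≤ 2 := by
  have h1 := ind_mem (z.1 = j)
  have h2 := ind_mem (G z.2 βs > c)
  have h3 := rate_mem (X := X) (G := G) (c := c) hj βs
  have h4 := ind_mem (G z.2 β > c)
  have h5 := rate_mem (X := X) (G := G) (c := c) hj β
  rw [incrementInd, abs_mul, abs_of_nonneg h1.1]
  have : |ind (G z.2 β > c) - rate μ Y X G j c β - (ind (G z.2 βs > c) - rate μ Y X G j c βs)| ≤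
      2 := by
    rw [abs_le]
    constructor <;> linarith
  nlinarith [abs_nonneg
    (ind (G z.2 β > c) - rate μ Y X G j c β - (ind (G z.2 βs > c) - rate μ Y X G j c βs))]

theorem memLp_centeredInd [IsProbabilityMeasure μ] (hd : IIDSample μ Y X)
    (hG : Measurable fun z : Vec k × Vec p => G z.1 z.2) (hj : 0 < labelProb μ Y j) :
    MemLp (fun ω => centeredInd μ Y X G βs j c (Y 0 ω, X 0 ω)) 2 μ :=
  MemLp.of_bound ((measurable_centeredInd hG).comp (hd.measurable_obs 0)).aestronglyMeasurable 1
    (ae_of_all _ fun _ => abs_centeredInd_le hj _)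

theorem integral_ind {s : Set Ω} (hs : MeasurableSet s) :
    ∫ ω, ind (ω ∈ s) ∂μ = μ.real s := by
  have : (fun ω => ind (ω ∈ s)) = s.indicator (fun _ => (1 : ℝ)) := by
    ext ω
    by_cases h : ω ∈ s <;> simp [ind, h]
  rw [this, integral_indicator hs]
  simp

theorem integral_centeredInd [IsProbabilityMeasure μ] (hd : IIDSample μ Y X)
    (hG : Measurable fun z : Vec k × Vec p => G z.1 z.2) (hj : 0 < labelProb μ Y j) :
    ∫ ω, centeredInd μ Y X G βs j c (Y 0 ω, X 0 ω) ∂μ = 0 := by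
  set s : Set Ω := {ω | Y 0 ω = j} with hs
  set t : Set Ω := {ω | G (X 0 ω) βs > c} with ht
  have hsm : MeasurableSet s := measurableSet_eq_fun (hd.measurable_Y 0) measurable_const
  have htm : MeasurableSet t := measurableSet_lt measurable_const
    (hG.comp ((hd.measurable_X 0).prodMk measurable_const))
  have h1 : ∀ ω, centeredInd μ Y X G βs j c (Y 0 ω, X 0 ω) =
      ind (ω ∈ s ∩ t) - rate μ Y X G j c βs * ind (ω ∈ s) := by
    intro ω
    have : ind (ω ∈ s ∩ t) = ind (ω ∈ s) * ind (ω ∈ t) := by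
      rw [Set.mem_inter_iff, and_comm, ind_and]
    rw [this]
    change ind (ω ∈ s) * (ind (ω ∈ t) - _) = _
    ring
  have hi : ∀ u : Set Ω, MeasurableSet u → Integrable (fun ω => ind (ω ∈ u)) μ := fun u hu =>
    Integrable.of_bound (measurable_ind (s := fun ω => ω ∈ u) hu).aestronglyMeasurable 1
      (ae_of_all _ fun ω => by
        rw [Real.norm_eq_abs, abs_of_nonneg (ind_mem _).1]; exact (ind_mem _).2)
  simp_rw [h1]
  rw [integral_sub (hi _ (hsm.inter htm)) ((hi s hsm).const_mul _), integral_const_mul,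
    integral_ind (hsm.inter htm), integral_ind hsm]
  have h2 : rate μ Y X G j c βs = (μ.real s)⁻¹ * μ.real (s ∩ t) := by
    rw [rate, condProb, Measure.real, cond_apply hsm, ENNReal.toReal_mul, ENNReal.toReal_inv]
    rfl
  have h3 : μ.real s ≠ 0 := hj.ne'
  rw [h2]
  field_simp
  ring

/-- The increments of the empirical process of the subsample dominate the sums of increments. -/
theorem abs_sum_incrementInd_le [IsProbabilityMeasure μ] (hd : IIDSample μ Y X)
    (hG : Measurable fun z : Vec k × Vec p => G z.1 z.2) (hj : 0 < labelProb μ Y j) {n : ℕ}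
    (hn : 0 < n) (β : Vec p) (ω : Ω) :
    |∑ i ∈ Finset.range n, incrementInd μ Y X G βs j c (Y i ω, X i ω) β| ≤
      √n * |empProc μ Y X G j n c β ω - empProc μ Y X G j n c βs ω| := by
  have := isProbabilityMeasure_condProb hj
  have hrate : ∀ b : Vec p, (condProb μ Y j).real {ω' | G (X 0 ω') b ≤ c} =
      1 - rate μ Y X G j c b := by
    intro b
    have htm : MeasurableSet {ω' | G (X 0 ω') b > c} := measurableSet_lt measurable_const
      (hG.comp ((hd.measurable_X 0).prodMk measurable_const))
    rw [rate, ← probReal_compl_eq_one_sub htm]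
    congr 1
    ext ω'
    simp
  set N : ℝ := ∑ i ∈ Finset.range n, ind (Y i ω = j) with hN
  have hN0 : 0 ≤ N := Finset.sum_nonneg fun i _ => (ind_mem _).1
  have hNn : N ≤ n := by
    refine (Finset.sum_le_sum fun i _ => (ind_mem _).2).trans ?_
    simp
  have hcount : ∀ b : Vec p, ∑ i ∈ Finset.range n, ind (G (X i ω) b ≤ c ∧ Y i ω = j) =
      N - ∑ i ∈ Finset.range n, ind (Y i ω = j) * ind (G (X i ω) b > c) := by
    intro b
    rw [hN, ← Finset.sum_sub_distrib]
    refine Finset.sum_congr rfl fun i _ => ?_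
    rw [ind_and]
    by_cases h : G (X i ω) b ≤ c
    · rw [ind_of h, ind_of_not (not_lt.2 h)]; ring
    · rw [ind_of_not h, ind_of (not_le.1 h)]; ring
  have hsum : ∑ i ∈ Finset.range n, incrementInd μ Y X G βs j c (Y i ω, X i ω) β =
      (∑ i ∈ Finset.range n, ind (Y i ω = j) * ind (G (X i ω) β > c) -
        N * rate μ Y X G j c β) -
      (∑ i ∈ Finset.range n, ind (Y i ω = j) * ind (G (X i ω) βs > c) -
        N * rate μ Y X G j c βs) := by
    simp only [incrementInd, hN, Finset.sum_mul, ← Finset.sum_sub_distrib]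
    exact Finset.sum_congr rfl fun i _ => by ring
  -- With no observation in the group, `empProc` involves `1 / 0 = 0`, but every increment vanishes
  -- and the bound is trivial.
  rcases hN0.eq_or_lt with h0 | h0
  · have hz : ∀ i ∈ Finset.range n, ind (Y i ω = j) = 0 :=
      (Finset.sum_eq_zero_iff_of_nonneg fun i _ => (ind_mem _).1).1 h0.symm
    have : ∑ i ∈ Finset.range n, incrementInd μ Y X G βs j c (Y i ω, X i ω) β = 0 :=
      Finset.sum_eq_zero fun i hi => by simp [incrementInd, hz i hi]
    rw [this, abs_zero]
    positivity
  · set s := ∑ i ∈ Finset.range n, incrementInd μ Y X G βs j c (Y i ω, X i ω) β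
    have hdiff : empProc μ Y X G j n c β ω - empProc μ Y X G j n c βs ω = -(√n / N * s) := by
      rw [hsum]
      simp only [empProc, hcount, hrate, ← hN]
      field_simp
      ring
    have hn' : 0 < √(n : ℝ) := Real.sqrt_pos.2 (by exact_mod_cast hn)
    rw [hdiff, abs_neg, abs_mul, abs_of_pos (by positivity : 0 < √(n : ℝ) / N), ← mul_assoc]
    -- The group has at most `n` members, so normalizing by its size only enlarges the process.
    have : 1 ≤ √(n : ℝ) * (√n / N) := by
      rw [← mul_div_assoc, Real.mul_self_sqrt (Nat.cast_nonneg n), le_div_iff₀ h0]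
      linarith
    nlinarith [abs_nonneg s]

end

/-! ### Asymptotic expansion of weighted empirical rates -/

section

variable {Ω : Type*} [MeasurableSpace Ω] {μ : Measure Ω} [IsProbabilityMeasure μ] {k p : ℕ}
  {V Y : ℕ → Ω → ℝ} {X : ℕ → Ω → Vec k} {G : Vec k → Vec p → ℝ} {B : Set (Vec p)} {βs : Vec p}
  {j c : ℝ}

theorem lintegral_tail_ne_top (hV : MeanOneWeights μ V Y X) :
    ∫⁻ t in Set.Ioi (0 : ℝ), (μ {ω | t < |V 0 ω|}) ^ (1 / 2 : ℝ) ≠ ∞ := by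
  have h : ∀ t : ℝ, (μ {ω | t < |V 0 ω|}) ^ (1 / 2 : ℝ) =
      ‖√(μ.real {ω | t < |V 0 ω|})‖ₑ := by
    intro t
    rw [Real.enorm_of_nonneg (Real.sqrt_nonneg _), Real.sqrt_eq_rpow,
      ← ENNReal.ofReal_rpow_of_nonneg measureReal_nonneg (by norm_num), Measure.real,
      ENNReal.ofReal_toReal (measure_ne_top _ _)]
  simp_rw [h]
  exact hV.tail.2.ne

/-- The empirical process assumption, for the sums of increments under the product law. -/
theorem StochEquicontinuous.supSum_incrementInd (hd : IIDSample μ Y X)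
    (hG : Measurable fun z : Vec k × Vec p => G z.1 z.2) (hj : 0 < labelProb μ Y j)
    (hB : MeasurableSet B) (hβs : βs ∈ B) (he : StochEquicontinuous μ B (empProc μ Y X G j))
    (c : ℝ) :
    ∀ ε > (0 : ℝ), ∀ η > (0 : ℝ), ∃ δ > (0 : ℝ), ∀ᶠ n : ℕ in atTop,
      (Measure.pi fun _ : Fin n => μ.map fun ω => (Y 0 ω, X 0 ω))
        {z | ENNReal.ofReal (ε * √n) <
          supSum (incrementInd μ Y X G βs j c) (B ∩ Metric.ball βs δ) z} ≤ ENNReal.ofReal η := by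
  intro ε hε η hη
  obtain ⟨δ, hδ, hev⟩ := he ε hε η hη
  refine ⟨δ, hδ, ?_⟩
  filter_upwards [hev, eventually_gt_atTop 0] with n hn hn0
  have hn' : 0 < √(n : ℝ) := Real.sqrt_pos.2 (by exact_mod_cast hn0)
  have hlaw : (Measure.pi fun _ : Fin n => μ.map fun ω => (Y 0 ω, X 0 ω)) =
      μ.map fun ω (i : Fin n) => (Y i ω, X i ω) := by
    have : iIndepFun (fun (i : Fin n) ω => (Y i ω, X i ω)) μ :=
      hd.indep.precomp Fin.val_injective
    rw [(iIndepFun_iff_map_fun_eq_pi_map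
      fun i : Fin n => (hd.measurable_obs i).aemeasurable).1 this]
    congr 1
    ext1 i
    exact (hd.ident i).map_eq.symm
  have hnull : NullMeasurableSet {z | ENNReal.ofReal (ε * √n) <
      supSum (incrementInd μ Y X G βs j c) (B ∩ Metric.ball βs δ) z}
      (μ.map fun ω (i : Fin n) => (Y i ω, X i ω)) :=
    nullMeasurableSet_lt aemeasurable_const
      (aemeasurable_supSum (measurable_incrementInd hd hG hj) (hB.inter measurableSet_ball) _)
  rw [hlaw, Measure.map_apply₀
    (measurable_pi_iff.2 fun i : Fin n => hd.measurable_obs i).aemeasurable hnull]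
  refine (measure_mono fun ω hω => ?_).trans hn
  simp only [Set.mem_preimage, Set.mem_ofPred_eq, supSum, lt_iSup_iff] at hω
  obtain ⟨β, ⟨hβ, hβδ⟩, hlt⟩ := hω
  -- Only pairs with equal cutoffs and one endpoint at `β*` are needed.
  refine ⟨c, c, β, hβ, βs, hβs, by simpa using hδ, by simpa [dist_eq_norm] using hβδ, ?_⟩
  rw [ENNReal.ofReal_lt_ofReal_iff_of_nonneg (by positivity),
    Fin.sum_univ_eq_sum_range (fun i => incrementInd μ Y X G βs j c (Y i ω, X i ω) β) n] at hlt
  have := hlt.trans_le (abs_sum_incrementInd_le hd hG hj hn0 β ω)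
  rw [mul_comm] at this
  exact lt_of_mul_lt_mul_left this hn'.le

/-- The estimate `b n` may depend on both weights and data, so a bound uniform over a small ball is
required; consistency places `b n` in that ball with probability close to one. -/
theorem smallOP_weighted_increment (hd : IIDSample μ Y X) (hV : MeanOneWeights μ V Y X)
    (hG : Measurable fun z : Vec k × Vec p => G z.1 z.2) (hj : 0 < labelProb μ Y j)
    (hB : MeasurableSet B) (hβs : βs ∈ B) (he : StochEquicontinuous μ B (empProc μ Y X G j))
    {b : ℕ → Ω → Vec p} (hbB : ∀ n, ∀ᵐ ω ∂μ, b n ω ∈ B) (hb : SmallOP μ fun n ω => b n ω - βs) :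
    SmallOP μ (fun (n : ℕ) ω => 1 / √n * ∑ i ∈ Finset.range n,
      V i ω * incrementInd μ Y X G βs j c (Y i ω, X i ω) (b n ω)) := by
  intro ε hε η hη
  have hP : IsProbabilityMeasure (μ.map fun ω => (Y 0 ω, X 0 ω)) :=
    Measure.isProbabilityMeasure_map (hd.measurable_obs 0).aemeasurable
  have hτm : Measurable fun t : ℝ => μ {ω | t < |V 0 ω|} :=
    Antitone.measurable fun s t hst => measure_mono fun ω (hω : t < _) => hst.trans_lt hω
  obtain ⟨δ, hδ, hev⟩ := exists_measure_weighted_sum_le (μ := μ)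
    (Z := fun i ω => (Y i ω, X i ω)) (V := V) (f := incrementInd μ Y X G βs j c)
    (S := fun δ => B ∩ Metric.ball βs δ) hd.measurable_obs hd.indep
    (fun i => (hd.ident i).map_eq) hV.measurable hV.indep_data (measurable_incrementInd hd hG hj)
    (by norm_num : (0 : ℝ) ≤ 2) (fun z β => abs_incrementInd_le hj z β)
    (fun δ => hB.inter measurableSet_ball) (he.supSum_incrementInd hd hG hj hB hβs c) hτm
    (fun i t => by
      have := ((hV.ident i).comp (u := fun x => |x|) (by fun_prop)).measure_mem_eq
        (measurableSet_Ioi (a := t))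
      exact this.le)
    (lintegral_tail_ne_top hV) (by positivity : 0 < ε / 2) (by positivity : 0 < η / 2)
  filter_upwards [hev, hb δ hδ (η / 2) (by positivity), eventually_gt_atTop 0] with n h1 h2 hn0
  have hn' : 0 < √(n : ℝ) := Real.sqrt_pos.2 (by exact_mod_cast hn0)
  have hae : μ {ω | ε ≤ ‖1 / √(n : ℝ) * ∑ i ∈ Finset.range n,
      V i ω * incrementInd μ Y X G βs j c (Y i ω, X i ω) (b n ω)‖} ≤
      μ ({ω | ε ≤ ‖1 / √(n : ℝ) * ∑ i ∈ Finset.range n,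
      V i ω * incrementInd μ Y X G βs j c (Y i ω, X i ω) (b n ω)‖} ∩ {ω | b n ω ∈ B}) := by
    refine measure_mono_ae ?_
    filter_upwards [hbB n] with ω hω h using ⟨h, hω⟩
  refine hae.trans (measure_union_le_ofReal hη ?_ h1 h2)
  rintro ω ⟨hω, hωB⟩
  by_contra hcon
  simp only [Set.mem_union, Set.mem_ofPred_eq, not_or, not_le, not_exists, not_and, not_lt]
    at hcon hω
  have h3 := hcon.1 (b n ω) ⟨hωB, by simpa [dist_eq_norm] using hcon.2⟩
  rw [norm_mul, Real.norm_eq_abs, Real.norm_eq_abs, abs_of_pos (by positivity),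
    one_div_mul_eq_div, le_div_iff₀ hn'] at hω
  have : 0 < ε * √(n : ℝ) := by positivity
  linarith

/-- The influence function of the rate within the group `Y = j`. -/
def influence (μ : Measure Ω) (Y : ℕ → Ω → ℝ) (X : ℕ → Ω → Vec k) (G : Vec k → Vec p → ℝ)
    (ψβ : ℝ → Vec k → Vec p → Vec p) (βs : Vec p) (j c : ℝ) (z : ℝ × Vec k) : ℝ :=
  (labelProb μ Y j)⁻¹ * centeredInd μ Y X G βs j c z +
    inner ℝ (gradient (rate μ Y X G j c) βs) (ψβ z.1 z.2 βs)

/-- Centering the indicator splits the error into a weighted average of mean-zero data, of order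
n^{-1/2}, and P(Y = j) times the error in the average weight, covered by the law of large numbers.
-/
theorem smallOP_weighted_label (hd : IIDSample μ Y X) (hV : MeanOneWeights μ V Y X)
    (j : ℝ) :
    SmallOP μ (fun (n : ℕ) ω =>
      (∑ i ∈ Finset.range n, V i ω * ind (Y i ω = j)) / n - labelProb μ Y j) := by
  let φ : ℝ × Vec k → ℝ := fun z => ind (z.1 = j) - labelProb μ Y j
  have hφ : Measurable φ :=
    (measurable_ind (measurableSet_eq_fun measurable_fst measurable_const)).sub_const _
  have hm : MeasurableSet {ω | Y 0 ω = j} :=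
    measurableSet_eq_fun (hd.measurable_Y 0) measurable_const
  have hii : Integrable (fun ω => ind (Y 0 ω = j)) μ :=
    Integrable.of_bound (measurable_ind hm).aestronglyMeasurable 1 (ae_of_all _ fun ω => by
      rw [Real.norm_eq_abs, abs_of_nonneg (ind_mem _).1]; exact (ind_mem _).2)
  have hφ2 : MemLp (fun ω => φ (Y 0 ω, X 0 ω)) 2 μ := by
    refine MemLp.of_bound (hφ.comp (hd.measurable_obs 0)).aestronglyMeasurable
      (1 + |labelProb μ Y j|) (ae_of_all _ fun ω => ?_)
    refine (abs_sub _ _).trans ?_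
    gcongr
    rw [abs_of_nonneg (ind_mem _).1]
    exact (ind_mem _).2
  have hφ0 : ∫ ω, φ (Y 0 ω, X 0 ω) ∂μ = 0 := by
    simp only [φ]
    rw [integral_sub hii (integrable_const _)]
    have := integral_ind (μ := μ) hm
    simp only [Set.mem_ofPred_eq] at this
    rw [this]
    simp [labelProb]
  have h1 := bigOP_weighted_sum hd hV hφ hφ2 hφ0
  have h2 : SmallOP μ (fun (n : ℕ) ω => 1 / √n *
      (1 / √n * ∑ i ∈ Finset.range n, V i ω * φ (Y i ω, X i ω))) := by
    refine BigOP.smallOP_of_sqrt_smul (h1.of_le fun n ω => ?_)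
    rcases Nat.eq_zero_or_pos n with rfl | hn
    · simp
    · have hn' : 0 < √(n : ℝ) := Real.sqrt_pos.2 (by exact_mod_cast hn)
      rw [smul_eq_mul, ← mul_assoc, mul_one_div_cancel hn'.ne', one_mul]
  have h3 : SmallOP μ (fun (n : ℕ) ω => labelProb μ Y j *
      ((∑ i ∈ Finset.range n, V i ω) / n - 1)) :=
    (bigOP_const (labelProb μ Y j)).mul_smallOP (smallOP_mean_weights hV)
  refine (h2.add h3).of_le fun n ω => le_of_eq ?_
  congr 1
  have h4 : 1 / √(n : ℝ) * (1 / √(n : ℝ)) = 1 / n := by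
    rw [one_div_mul_one_div, Real.mul_self_sqrt (Nat.cast_nonneg n)]
  rw [← mul_assoc, h4]
  simp only [φ, mul_sub, Finset.sum_sub_distrib, ← Finset.sum_mul]
  ring

variable {ψβ : ℝ → Vec k → Vec p → Vec p} {b : ℕ → Ω → Vec p}

theorem AsympLinear.bigOP (hd : IIDSample μ Y X) (hV : MeanOneWeights μ V Y X)
    (hψ : Measurable fun z : ℝ × Vec k => ψβ z.1 z.2 βs)
    (hψ2 : MemLp (fun ω => ψβ (Y 0 ω) (X 0 ω) βs) 2 μ)
    (hψ0 : ∫ ω, ψβ (Y 0 ω) (X 0 ω) βs ∂μ = 0) (hlin : AsympLinear μ V Y X βs ψβ b) :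
    BigOP μ (fun n ω => √(n : ℝ) • (b n ω - βs)) := by
  have h1 : BigOP μ (fun (n : ℕ) ω =>
      (1 / √n) • ∑ i ∈ Finset.range n, V i ω • ψβ (Y i ω) (X i ω) βs) := by
    refine BigOP.of_coord fun a => ?_
    have hψa : Measurable fun z : ℝ × Vec k => ψβ z.1 z.2 βs a := by fun_prop
    have := bigOP_weighted_sum hd hV (φ := fun z => ψβ z.1 z.2 βs a) hψa
      (hψ2.of_le (hψa.comp (hd.measurable_obs 0)).aestronglyMeasurable
        (ae_of_all _ fun ω => PiLp.norm_apply_le _ a))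
      (by rw [integral_coord (hψ2.integrable (by norm_num)) a, hψ0]; rfl)
    simpa using this
  have h2 := (tendstoInMeasure_zero_iff.1 hlin).bigOP.add h1
  simpa using h2

/-- The asymptotic linear representation of a weighted empirical rate at an estimated parameter. -/
theorem smallOP_weightedRate_sub (hd : IIDSample μ Y X) (hV : MeanOneWeights μ V Y X)
    (hG : Measurable fun z : Vec k × Vec p => G z.1 z.2) (hj : 0 < labelProb μ Y j)
    (hB : MeasurableSet B) (hβs : βs ∈ B) (he : StochEquicontinuous μ B (empProc μ Y X G j))
    (hbB : ∀ n, ∀ᵐ ω ∂μ, b n ω ∈ B)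
    (hψ : Measurable fun z : ℝ × Vec k => ψβ z.1 z.2 βs)
    (hψ2 : MemLp (fun ω => ψβ (Y 0 ω) (X 0 ω) βs) 2 μ)
    (hψ0 : ∫ ω, ψβ (Y 0 ω) (X 0 ω) βs ∂μ = 0) (hlin : AsympLinear μ V Y X βs ψβ b)
    (hdiff : DifferentiableAt ℝ (rate μ Y X G j c) βs) :
    SmallOP μ (fun (n : ℕ) ω =>
      √n * (weightedRate V Y X G j c n (b n ω) ω - rate μ Y X G j c βs) -
      1 / √n * ∑ i ∈ Finset.range n, V i ω * influence μ Y X G ψβ βs j c (Y i ω, X i ω)) := by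
  have hrate := hlin.bigOP hd hV hψ hψ2 hψ0
  have hcons := hrate.smallOP_of_sqrt_smul
  set g := gradient (rate μ Y X G j c) βs with hg
  set π := labelProb μ Y j with hπ
  let D : ℕ → Ω → ℝ := fun n ω => (∑ i ∈ Finset.range n, V i ω * ind (Y i ω = j)) / n
  have hD : SmallOP μ (fun n ω => D n ω - π) := smallOP_weighted_label hd hV j
  have hDinv : SmallOP μ (fun n ω => (D n ω)⁻¹ - π⁻¹) :=
    SmallOP.continuousAt_comp (continuousAt_inv₀ hj.ne') hD
  have hDB : BigOP μ (fun n ω => (D n ω)⁻¹) := by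
    have := hDinv.bigOP.add (bigOP_const π⁻¹)
    simpa using this
  -- The four remainders are: the delta-method error, the error in the linear representation of `b
  -- n`, the replacement of `(D n)⁻¹` by `π⁻¹` in the leading sum, and the weighted increments.
  have t1 := smallOP_delta hdiff hrate
  have t2 : SmallOP μ (fun (n : ℕ) ω => inner ℝ g (√(n : ℝ) • (b n ω - βs) -
      (1 / √n) • ∑ i ∈ Finset.range n, V i ω • ψβ (Y i ω) (X i ω) βs)) := by
    refine ((bigOP_const ‖g‖).mul_smallOP ((tendstoInMeasure_zero_iff.1 hlin).of_le
      (U := fun (n : ℕ) ω => ‖√(n : ℝ) • (b n ω - βs) -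
      (1 / √n) • ∑ i ∈ Finset.range n, V i ω • ψβ (Y i ω) (X i ω) βs‖) fun n ω => by simp)).of_le
      fun n ω => ?_
    rw [norm_mul, norm_norm, norm_norm]
    exact norm_inner_le_norm _ _
  have t3 := (bigOP_weighted_sum hd hV (measurable_centeredInd (βs := βs) (c := c) hG)
    (memLp_centeredInd hd hG hj) (integral_centeredInd hd hG hj)).mul_smallOP hDinv
  have t4 := hDB.mul_smallOP (smallOP_weighted_increment (c := c) hd hV hG hj hB hβs he hbB hcons)
  -- Unless `|D n - π| ≥ π`, the denominator is nonzero and the claimed remainder is exactly the sum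
  -- of the four.
  refine (((t1.add t2).add t3).add t4).congr_event
    (A := fun n => {ω | π ≤ ‖D n ω - π‖}) (fun η hη => hD π hj η hη) ?_
  filter_upwards [eventually_gt_atTop 0] with n hn ω hω
  have hn' : 0 < √(n : ℝ) := Real.sqrt_pos.2 (by exact_mod_cast hn)
  have hn0 : (0 : ℝ) < n := by exact_mod_cast hn
  have hD0 : D n ω ≠ 0 := by
    intro h
    apply hω
    simpa [h] using le_abs_self π
  set N := ∑ i ∈ Finset.range n, V i ω * ind (Y i ω = j) with hN
  have hDN : D n ω = N / n := rfl
  have hN0 : N ≠ 0 := fun h => hD0 (by rw [hDN, h, zero_div])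
  set C := ∑ i ∈ Finset.range n, V i ω * centeredInd μ Y X G βs j c (Y i ω, X i ω) with hC
  set I := ∑ i ∈ Finset.range n, V i ω * incrementInd μ Y X G βs j c (Y i ω, X i ω) (b n ω)
    with hI
  have e1 : ∑ i ∈ Finset.range n, V i ω * ind (G (X i ω) (b n ω) > c ∧ Y i ω = j) =
      C + I + N * rate μ Y X G j c (b n ω) := by
    rw [hC, hI, hN, Finset.sum_mul, ← Finset.sum_add_distrib, ← Finset.sum_add_distrib]
    refine Finset.sum_congr rfl fun i _ => ?_
    rw [ind_and, centeredInd, incrementInd]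
    ring
  have e2 : ∑ i ∈ Finset.range n, V i ω * influence μ Y X G ψβ βs j c (Y i ω, X i ω) =
      π⁻¹ * C + inner ℝ g (∑ i ∈ Finset.range n, V i ω • ψβ (Y i ω) (X i ω) βs) := by
    rw [hC, Finset.mul_sum, inner_sum, ← Finset.sum_add_distrib]
    refine Finset.sum_congr rfl fun i _ => ?_
    rw [influence, inner_smul_right]
    ring
  have e3 : weightedRate V Y X G j c n (b n ω) ω = 1 / N * (C + I + N * rate μ Y X G j c (b n ω)) := by
    rw [weightedRate, e1]
  have e4 : √(n : ℝ) / N = 1 / √(n : ℝ) * (D n ω)⁻¹ := by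
    rw [hDN, inv_div, one_div_mul_eq_div, div_right_comm, Real.div_sqrt]
  rw [e2, e3, inner_sub_right, inner_smul_right g _ (1 / √(n : ℝ))]
  have e5 : √(n : ℝ) * (1 / N * (C + I + N * rate μ Y X G j c (b n ω)) - rate μ Y X G j c βs) =
      √(n : ℝ) / N * (C + I) + √(n : ℝ) * (rate μ Y X G j c (b n ω) - rate μ Y X G j c βs) := by
    field_simp
    ring
  rw [e5, e4]
  ring

end

/-! ### A central limit theorem for deterministic linear combinations -/

/-- Telescoping: exchange one factor at a time, the others having modulus at most one. -/
theorem norm_prod_sub_prod_le_sum {ι : Type*} (s : Finset ι) (a b : ι → ℂ)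
    (ha : ∀ i, ‖a i‖ ≤ 1) (hb : ∀ i, ‖b i‖ ≤ 1) :
    ‖∏ i ∈ s, a i - ∏ i ∈ s, b i‖ ≤ ∑ i ∈ s, ‖a i - b i‖ := by
  classical
  induction s using Finset.induction_on with
  | empty => simp
  | insert x s hx ih =>
    rw [Finset.prod_insert hx, Finset.prod_insert hx, Finset.sum_insert hx]
    have e : a x * ∏ i ∈ s, a i - b x * ∏ i ∈ s, b i =
        (a x - b x) * ∏ i ∈ s, a i + b x * (∏ i ∈ s, a i - ∏ i ∈ s, b i) := by ring
    rw [e]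
    refine (norm_add_le _ _).trans ?_
    rw [norm_mul, norm_mul]
    have h1 : ‖∏ i ∈ s, a i‖ ≤ 1 := by
      rw [norm_prod]
      exact Finset.prod_le_one (fun i _ => norm_nonneg _) fun i _ => ha i
    have h2 := hb x
    gcongr
    · exact mul_le_of_le_one_right (norm_nonneg _) h1
    · exact (mul_le_of_le_one_left (norm_nonneg _) h2).trans ih

/-- If the averages of squares converge, then the individual terms are uniformly `o(√n)`. -/
theorem eventually_forall_abs_le_of_tendsto_average {a : ℕ → ℝ} {q : ℝ}
    (h : Tendsto (fun n : ℕ => (∑ i ∈ Finset.range n, a i ^ 2) / n) atTop (𝓝 q)) {δ : ℝ}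
    (hδ : 0 < δ) : ∀ᶠ n : ℕ in atTop, ∀ i < n, |(√(n : ℝ))⁻¹ * a i| ≤ δ := by
  -- The last term of a convergent average is the difference of consecutive averages, up to the
  -- factor `n / (n + 1)`. Indices `i ≥ N` are then controlled by `i < n`, and the finitely many
  -- earlier ones by a constant.
  have h1 : Tendsto (fun n : ℕ => a n ^ 2 / (n + 1 : ℕ)) atTop (𝓝 0) := by
    have hs := (tendsto_add_atTop_iff_nat 1).2 h
    have hr : Tendsto (fun n : ℕ => (n : ℝ) / ((n + 1 : ℕ) : ℝ)) atTop (𝓝 1) := by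
      simpa using tendsto_natCast_div_add_atTop (1 : ℝ)
    have := hs.sub (h.mul hr)
    rw [mul_one, sub_self] at this
    refine this.congr' ?_
    filter_upwards [eventually_gt_atTop 0] with n hn
    have hn0 : (n : ℝ) ≠ 0 := by exact_mod_cast hn.ne'
    rw [Finset.sum_range_succ, div_mul_div_cancel₀ hn0]
    ring
  obtain ⟨N, hN⟩ := eventually_atTop.1 (h1.eventually_le_const (by positivity : 0 < δ ^ 2))
  have h2 : Tendsto (fun n : ℕ => δ ^ 2 * (n : ℝ)) atTop atTop :=
    tendsto_natCast_atTop_atTop.const_mul_atTop (by positivity)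
  filter_upwards [eventually_gt_atTop 0,
    h2.eventually_ge_atTop (∑ i ∈ Finset.range N, a i ^ 2)] with n hn hC i hi
  have hn' : 0 < √(n : ℝ) := Real.sqrt_pos.2 (by exact_mod_cast hn)
  have key : a i ^ 2 ≤ δ ^ 2 * n := by
    rcases lt_or_ge i N with hiN | hiN
    · exact (Finset.single_le_sum (f := fun i => a i ^ 2) (fun _ _ => sq_nonneg _)
        (Finset.mem_range.2 hiN)).trans hC
    · have := hN i hiN
      rw [div_le_iff₀ (by positivity)] at this
      refine this.trans ?_
      gcongr
      exact hi
  rw [abs_mul, abs_of_pos (by positivity), inv_mul_le_iff₀ hn', mul_comm]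
  refine abs_le_of_sq_le_sq ?_ (by positivity)
  rwa [mul_pow, Real.sq_sqrt (Nat.cast_nonneg n)]

theorem norm_exp_sub_le {ε t : ℝ} (hε : t ^ 2 ≤ ε) (ht : |t| ≤ 1) :
    ‖Complex.exp (-(t : ℂ) ^ 2 / 2) - (1 - (t : ℂ) ^ 2 / 2)‖ ≤ ε * t ^ 2 := by
  have ht2 : t ^ 2 ≤ 1 := by
    rw [← sq_abs]
    exact pow_le_one₀ (abs_nonneg _) ht
  have hz : ‖-(t : ℂ) ^ 2 / 2‖ = t ^ 2 / 2 := by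
    rw [norm_div, norm_neg, norm_pow, Complex.norm_real, Real.norm_eq_abs, sq_abs]
    simp
  have := Complex.norm_exp_sub_one_sub_id_le (x := -(t : ℂ) ^ 2 / 2) (by rw [hz]; linarith)
  rw [hz] at this
  have e : Complex.exp (-(t : ℂ) ^ 2 / 2) - (1 - (t : ℂ) ^ 2 / 2) =
      Complex.exp (-(t : ℂ) ^ 2 / 2) - 1 - -(t : ℂ) ^ 2 / 2 := by ring
  rw [e]
  refine this.trans ?_
  nlinarith [sq_nonneg t]

/-- Convergence of the averages of squares makes the arguments of `φ` uniformly small, so replacing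
each factor by the Gaussian exp(-t²/2) costs o(t²), and these costs add up to o(1). The Gaussian
product depends only on the average. No Lindeberg condition has to be checked. -/
theorem tendsto_prod_of_isLittleO {φ : ℝ → ℂ} (hφ1 : ∀ t, ‖φ t‖ ≤ 1)
    (hφ : (fun t : ℝ => φ t - (1 - (t : ℂ) ^ 2 / 2)) =o[𝓝 0] fun t : ℝ => t ^ 2) {a : ℕ → ℝ}
    {q : ℝ} (h : Tendsto (fun n : ℕ => (∑ i ∈ Finset.range n, a i ^ 2) / n) atTop (𝓝 q)) :
    Tendsto (fun n : ℕ => ∏ i ∈ Finset.range n, φ ((√(n : ℝ))⁻¹ * a i)) atTop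
      (𝓝 (Complex.exp (-(q : ℂ) / 2))) := by
  have hsum : ∀ n : ℕ, ∑ i ∈ Finset.range n, ((√(n : ℝ))⁻¹ * a i) ^ 2 =
      (∑ i ∈ Finset.range n, a i ^ 2) / n := by
    intro n
    simp_rw [mul_pow, inv_pow, Real.sq_sqrt (Nat.cast_nonneg (α := ℝ) n)]
    rw [← Finset.mul_sum, inv_mul_eq_div]
  have hexp : Tendsto (fun n : ℕ => ∏ i ∈ Finset.range n,
      Complex.exp (-(((√(n : ℝ))⁻¹ * a i : ℝ) : ℂ) ^ 2 / 2)) atTop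
      (𝓝 (Complex.exp (-(q : ℂ) / 2))) := by
    have e : ∀ n : ℕ, ∏ i ∈ Finset.range n,
        Complex.exp (-(((√(n : ℝ))⁻¹ * a i : ℝ) : ℂ) ^ 2 / 2) =
        Complex.exp (-(((∑ i ∈ Finset.range n, a i ^ 2) / n : ℝ) : ℂ) / 2) := by
      intro n
      rw [← Complex.exp_sum, ← hsum]
      congr 1
      push_cast
      rw [← Finset.sum_neg_distrib, Finset.sum_div]
    simp_rw [e]
    exact ((Complex.continuous_exp.comp ((Complex.continuous_ofReal.neg).div_const 2)).tendsto
      q).comp h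
  have hdiff : Tendsto (fun n : ℕ => ∏ i ∈ Finset.range n, φ ((√(n : ℝ))⁻¹ * a i) -
      ∏ i ∈ Finset.range n, Complex.exp (-(((√(n : ℝ))⁻¹ * a i : ℝ) : ℂ) ^ 2 / 2)) atTop
      (𝓝 0) := by
    rw [Metric.tendsto_atTop']
    intro ε hε
    have hq : 0 ≤ q := ge_of_tendsto' h fun n => by positivity
    -- Each factor errs by `ε'` times its squared argument, once for `φ` and once for the
    -- exponential. The squares sum to less than `q + 1`, so the total is at most `ε / 2`.
    set ε' := ε / (2 * (q + 1)) / 2 with hε'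
    have hε'0 : 0 < ε' := by positivity
    obtain ⟨δ, hδ, hball⟩ := Metric.eventually_nhds_iff.1 (hφ.def hε'0)
    set δ' := min (min (δ / 2) 1) (min ε' 1) with hδ'
    have hδ'0 : 0 < δ' := by positivity
    have hev := eventually_forall_abs_le_of_tendsto_average h hδ'0
    obtain ⟨N, hN⟩ := eventually_atTop.1 (hev.and (h.eventually_lt_const (by linarith : q < q + 1)))
    refine ⟨N, fun n hn => ?_⟩
    obtain ⟨hn1, hn2⟩ := hN n hn.le
    rw [dist_zero_right]
    have hterm : ∀ i ∈ Finset.range n, ‖φ ((√(n : ℝ))⁻¹ * a i) -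
        Complex.exp (-(((√(n : ℝ))⁻¹ * a i : ℝ) : ℂ) ^ 2 / 2)‖ ≤
        2 * ε' * ((√(n : ℝ))⁻¹ * a i) ^ 2 := by
      intro i hi
      set s := (√(n : ℝ))⁻¹ * a i
      have hs : |s| ≤ δ' := hn1 i (Finset.mem_range.1 hi)
      have hs1 : |s| < δ := by
        have : δ' ≤ δ / 2 := (min_le_left _ _).trans (min_le_left _ _)
        linarith
      have hs2 : |s| ≤ 1 := hs.trans ((min_le_left _ _).trans (min_le_right _ _))
      have hs3 : s ^ 2 ≤ ε' := by
        have : |s| ≤ ε' := hs.trans ((min_le_right _ _).trans (min_le_left _ _))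
        rw [← sq_abs]
        nlinarith [abs_nonneg s]
      have b1 := hball (y := s) (by simpa using hs1)
      have b2 := norm_exp_sub_le hs3 hs2
      rw [Real.norm_of_nonneg (sq_nonneg s)] at b1
      have e : φ s - Complex.exp (-(s : ℂ) ^ 2 / 2) = (φ s - (1 - (s : ℂ) ^ 2 / 2)) -
          (Complex.exp (-(s : ℂ) ^ 2 / 2) - (1 - (s : ℂ) ^ 2 / 2)) := by ring
      rw [e]
      refine (norm_sub_le _ _).trans ?_
      linarith
    calc _ ≤ ∑ i ∈ Finset.range n, ‖φ ((√(n : ℝ))⁻¹ * a i) -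
          Complex.exp (-(((√(n : ℝ))⁻¹ * a i : ℝ) : ℂ) ^ 2 / 2)‖ := by
          refine norm_prod_sub_prod_le_sum _ _ _ (fun i => hφ1 _) fun i => ?_
          rw [Complex.norm_exp, Real.exp_le_one_iff]
          have : (-(((√(n : ℝ))⁻¹ * a i : ℝ) : ℂ) ^ 2 / 2).re =
              -((√(n : ℝ))⁻¹ * a i) ^ 2 / 2 := by
            rw [← Complex.ofReal_pow, ← Complex.ofReal_neg]
            norm_cast
          rw [this]
          have := sq_nonneg ((√(n : ℝ))⁻¹ * a i)
          linarith
      _ ≤ ∑ i ∈ Finset.range n, 2 * ε' * ((√(n : ℝ))⁻¹ * a i) ^ 2 := Finset.sum_le_sum hterm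
      _ = 2 * ε' * ((∑ i ∈ Finset.range n, a i ^ 2) / n) := by rw [← Finset.mul_sum, hsum]
      _ ≤ 2 * ε' * (q + 1) := by gcongr
      _ < ε := by
          rw [hε']
          field_simp
          linarith
  simpa using hdiff.add hexp

theorem charFun_map_smul_const {Ω : Type*} [MeasurableSpace Ω] {μ : Measure Ω} {d : ℕ}
    {ξ : Ω → ℝ} (hξ : AEMeasurable ξ μ) (v t : Vec d) :
    charFun (μ.map fun ω => ξ ω • v) t = charFun (μ.map ξ) (inner ℝ v t) := by
  rw [charFun_apply, charFun_apply, integral_map (by fun_prop) (by fun_prop),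
    integral_map hξ (by fun_prop)]
  refine integral_congr_ae (ae_of_all _ fun ω => ?_)
  simp [real_inner_smul_left, mul_comm]

theorem charFun_map_weighted_sum {Ω : Type*} [MeasurableSpace Ω] {μ : Measure Ω} {d : ℕ}
    {ξ : ℕ → Ω → ℝ} (hi : iIndepFun ξ μ) (hident : ∀ i, IdentDistrib (ξ i) (ξ 0) μ μ)
    (v : ℕ → Vec d) (n : ℕ) (t : Vec d) :
    charFun (μ.map fun ω => (1 / √(n : ℝ)) • ∑ i ∈ Finset.range n, ξ i ω • v i) t =
      ∏ i ∈ Finset.range n, charFun (μ.map (ξ 0)) ((√(n : ℝ))⁻¹ * inner ℝ (v i) t) := by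
  have hm : ∀ i, AEMeasurable (ξ i) μ := fun i => (hident i).aemeasurable_fst
  have hmv : ∀ i, AEMeasurable (fun ω => ξ i ω • v i) μ := fun i => (hm i).smul_const _
  have hiv : iIndepFun (fun i ω => ξ i ω • v i) μ :=
    hi.comp (fun i x => x • v i) fun i => by fun_prop
  rw [charFun_map_smul_comp (Finset.aemeasurable_fun_sum _ fun i _ => hmv i),
    (hiv.restrict _).charFun_map_fun_finsetSum_eq_prod fun i _ => hmv i, Finset.prod_apply]
  refine Finset.prod_congr rfl fun i _ => ?_
  rw [charFun_map_smul_const (hm i), (hident i).map_eq, real_inner_smul_right, one_div]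

/-- A central limit theorem for weighted sums of i.i.d. standardized variables with deterministic
vector weights. -/
theorem tendsto_map_weighted_sum {Ω : Type*} [MeasurableSpace Ω] {μ : Measure Ω}
    [IsProbabilityMeasure μ] {d : ℕ} {ξ : ℕ → Ω → ℝ} (hm : ∀ i, Measurable (ξ i))
    (hi : iIndepFun ξ μ) (hident : ∀ i, IdentDistrib (ξ i) (ξ 0) μ μ) (h0 : ∫ ω, ξ 0 ω ∂μ = 0)
    (h1 : ∫ ω, ξ 0 ω ^ 2 ∂μ = 1) {v : ℕ → Vec d} {S : Matrix (Fin d) (Fin d) ℝ}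
    (hS : S.PosSemidef)
    (hv : ∀ t : Vec d, Tendsto (fun n : ℕ => (∑ i ∈ Finset.range n, inner ℝ (v i) t ^ 2) / n) atTop
      (𝓝 (t.ofLp ⬝ᵥ S.mulVec t.ofLp)))
    (f : BoundedContinuousFunction (Vec d) ℝ) :
    Tendsto (fun n : ℕ => ∫ x, f x
      ∂(μ.map fun ω => (1 / √(n : ℝ)) • ∑ i ∈ Finset.range n, ξ i ω • v i)) atTop
      (𝓝 (∫ x, f x ∂(multivariateGaussian 0 S))) := by
  have hmeas : ∀ n : ℕ, Measurable fun ω =>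
      (1 / √(n : ℝ)) • ∑ i ∈ Finset.range n, ξ i ω • v i := by
    intro n
    have h := Finset.measurable_fun_sum (Finset.range n) fun i _ => (hm i).smul_const (v i)
    exact h.const_smul (1 / √(n : ℝ))
  let L : ℕ → ProbabilityMeasure (Vec d) := fun n =>
    ⟨μ.map fun ω => (1 / √(n : ℝ)) • ∑ i ∈ Finset.range n, ξ i ω • v i,
      Measure.isProbabilityMeasure_map (hmeas n).aemeasurable⟩
  have : Tendsto L atTop (𝓝 ⟨multivariateGaussian 0 S, inferInstance⟩) := by
    refine ProbabilityMeasure.tendsto_of_tendsto_charFun fun t => ?_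
    simp only [L, ProbabilityMeasure.coe_mk]
    have hp : IsProbabilityMeasure (μ.map (ξ 0)) :=
      Measure.isProbabilityMeasure_map (hm 0).aemeasurable
    have key := tendsto_prod_of_isLittleO (φ := charFun (μ.map (ξ 0)))
      (fun t => norm_charFun_le_one t) (taylor_charFun_two (hm 0).aemeasurable h0 h1) (hv t)
    rw [charFun_multivariateGaussian hS]
    simp_rw [charFun_map_weighted_sum hi hident]
    convert! key using 3
    simp
    ring
  exact ProbabilityMeasure.tendsto_iff_forall_integral_tendsto.1 this f

/-! ### Conditional laws -/

section ConditionalLaw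

variable {Ω δ E : Type*} [MeasurableSpace Ω] {μ : Measure Ω} [MeasurableSpace δ]

/-- The filter on `ℕ × Ω` along which convergence is convergence in (outer) measure. -/
def measureFilter (μ : Measure Ω) : Filter (ℕ × Ω) where
  sets := {S | Tendsto (fun n => μ {ω | (n, ω) ∉ S}) atTop (𝓝 0)}
  univ_sets := by simp
  sets_of_superset := fun {S T} hS hST =>
    tendsto_of_tendsto_of_tendsto_of_le_of_le tendsto_const_nhds hS (fun _ => zero_le)
      fun n => measure_mono fun ω hω h => hω (hST h)
  inter_sets := fun {S T} hS hT => by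
    have h := Tendsto.add hS hT
    rw [add_zero] at h
    refine tendsto_of_tendsto_of_tendsto_of_le_of_le tendsto_const_nhds h (fun _ => zero_le)
      fun n => (measure_mono fun ω hω => ?_).trans (measure_union_le _ _)
    by_contra hcon
    simp only [Set.mem_union, Set.mem_ofPred_eq, not_or, not_not] at hcon
    exact hω ⟨hcon.1, hcon.2⟩

theorem tendsto_measureFilter_iff {u : ℕ → Ω → ℝ} {a : ℝ} :
    Tendsto (fun z : ℕ × Ω => u z.1 z.2) (measureFilter μ) (𝓝 a) ↔
      TendstoInMeasure μ u atTop fun _ => a := by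
  rw [tendstoInMeasure_iff_dist, Metric.tendsto_nhds]
  refine forall₂_congr fun ε _ => ?_
  change Tendsto (fun n => μ {ω | ¬ dist (u n ω) a < ε}) atTop (𝓝 0) ↔ _
  simp only [not_lt]

/-- Random probability measures whose integrals converge in measure converge in the
Lévy–Prokhorov distance in measure. -/
theorem tendstoInMeasure_levyProkhorovDist [PseudoMetricSpace E] [MeasurableSpace E]
    [BorelSpace E] [TopologicalSpace.SeparableSpace E] {κ : ℕ → Ω → ProbabilityMeasure E}
    {ν : ProbabilityMeasure E}
    (h : ∀ f : BoundedContinuousFunction E ℝ, TendstoInMeasure μ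
      (fun n ω => ∫ x, f x ∂(κ n ω : Measure E)) atTop fun _ => ∫ x, f x ∂(ν : Measure E)) :
    TendstoInMeasure μ (fun n ω => levyProkhorovDist (κ n ω : Measure E) ν) atTop
      (fun _ => 0) := by
  refine (tendsto_measureFilter_iff
    (u := fun n ω => levyProkhorovDist (κ n ω : Measure E) ν) (a := 0)).1 ?_
  -- Convergence in measure is now convergence along a filter, so the topological equivalence of
  -- weak and Lévy–Prokhorov convergence applies directly, without subsequences or a countable
  -- family of test functions.
  have h1 : Tendsto (fun z : ℕ × Ω => κ z.1 z.2) (measureFilter μ) (𝓝 ν) :=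
    ProbabilityMeasure.tendsto_iff_forall_integral_tendsto.2 fun f =>
      (tendsto_measureFilter_iff (u := fun n ω => ∫ x, f x ∂(κ n ω : Measure E))).2 (h f)
  have h2 := (LevyProkhorov.continuous_ofMeasure_probabilityMeasure.tendsto ν).comp h1
  rw [tendsto_iff_dist_tendsto_zero] at h2
  exact h2

/-- Given `D`, the law of a function of `D` and of an independent variable `A` is the law of that
function with the value of `D` held fixed. -/
theorem ae_condDistrib_of_indepFun {α : Type*} [MeasurableSpace α] [IsProbabilityMeasure μ]
    [MeasurableSpace E] [StandardBorelSpace E] [Nonempty E] {A : Ω → α} {D : Ω → δ}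
    (hA : Measurable A) (hD : Measurable D) (hi : IndepFun A D μ) {F : α → δ → E}
    (hF : Measurable (Function.uncurry F)) :
    ∀ᵐ ω ∂μ, condDistrib (fun ω => F (A ω) (D ω)) D μ (D ω) = μ.map fun ω' => F (A ω') (D ω) := by
  have hFd : ∀ d, Measurable fun a => F a d := fun d => hF.comp (measurable_id.prodMk measurable_const)
  have hpA : IsProbabilityMeasure (μ.map A) := Measure.isProbabilityMeasure_map hA.aemeasurable
  -- Freeze the value of `D` and draw `A` from its own law. By independence this kernel
  -- disintegrates the joint law, so it is almost everywhere the conditional law.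
  let κ : Kernel δ E := ((Kernel.const δ (μ.map A)) ×ₖ Kernel.id).map (Function.uncurry F)
  have hκ : ∀ d, κ d = μ.map fun ω' => F (A ω') d := by
    intro d
    rw [Kernel.map_apply _ hF, Kernel.prod_apply, Kernel.const_apply, Kernel.id_apply,
      Measure.prod_dirac, Measure.map_map hF (by fun_prop), Measure.map_map (by fun_prop) hA]
    rfl
  have hκm : IsMarkovKernel κ := Kernel.IsMarkovKernel.map _ hF
  have hmeas : Measurable fun ω => F (A ω) (D ω) := hF.comp (hA.prodMk hD)
  have hjoint : μ.map (fun ω => (D ω, F (A ω) (D ω))) = μ.map D ⊗ₘ κ := by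
    ext s hs
    have hpre : MeasurableSet {z : δ × α | (z.1, F z.2 z.1) ∈ s} :=
      (measurable_fst.prodMk (hF.comp measurable_swap)) hs
    have hprod := (indepFun_iff_map_prod_eq_prod_map_map hD.aemeasurable hA.aemeasurable).1 hi.symm
    rw [Measure.compProd_apply hs, Measure.map_apply (hD.prodMk hmeas) hs]
    calc μ ((fun ω => (D ω, F (A ω) (D ω))) ⁻¹' s)
        = (μ.map fun ω => (D ω, A ω)) {z : δ × α | (z.1, F z.2 z.1) ∈ s} := by
          rw [Measure.map_apply (hD.prodMk hA) hpre]; rfl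
      _ = ∫⁻ d, κ d (Prod.mk d ⁻¹' s) ∂μ.map D := by
          rw [hprod, Measure.prod_apply hpre]
          refine lintegral_congr fun d => ?_
          rw [hκ, ← Function.comp_def (fun a => F a d) A, ← Measure.map_map (hFd d) hA,
            Measure.map_apply (hFd d) (measurable_prodMk_left hs)]
          rfl
  have h := ae_of_ae_map hD.aemeasurable
    (condDistrib_ae_eq_of_measure_eq_compProd D hmeas.aemeasurable hjoint)
  filter_upwards [h] with ω hω
  rw [hω, hκ]

/-- Unconditional negligibility implies conditional negligibility. -/
theorem SmallOP.tendstoInMeasure_condDistrib [IsFiniteMeasure μ] [NormedAddCommGroup E]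
    [MeasurableSpace E] [BorelSpace E] [StandardBorelSpace E] {D : Ω → δ} (hD : Measurable D)
    {R : ℕ → Ω → E} (hR : ∀ n, Measurable (R n)) (h : SmallOP μ R) {ε : ℝ} (hε : 0 < ε) :
    TendstoInMeasure μ (fun n ω => (condDistrib (R n) D μ (D ω)).real {r | ε ≤ ‖r‖})
      atTop (fun _ => 0) := by
  rw [tendstoInMeasure_zero_iff]
  intro a ha η hη
  have hs : MeasurableSet {r : E | ε ≤ ‖r‖} := measurableSet_le measurable_const measurable_norm
  -- The conditional probability averages to the unconditional one, so Markov's inequality at level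
  -- `a` turns `a * η` into `η`.
  filter_upwards [h ε hε (a * η) (by positivity)] with n hn
  have h1 : ∫⁻ ω, condDistrib (R n) D μ (D ω) {r | ε ≤ ‖r‖} ∂μ = μ {ω | ε ≤ ‖R n ω‖} := by
    have := setLIntegral_preimage_condDistrib (μ := μ) hD (hR n).aemeasurable hs
      MeasurableSet.univ
    simpa using this
  have h2 := mul_meas_ge_le_lintegral₀ (μ := μ)
    (((Kernel.measurable_coe (condDistrib (R n) D μ) hs).comp hD).aemeasurable) (ENNReal.ofReal a)
  simp only [Function.comp_apply] at h2
  rw [h1] at h2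
  have h3 := h2.trans hn
  rw [ENNReal.ofReal_mul ha.le, ENNReal.mul_le_mul_iff_right (by simpa using ha) (by simp)] at h3
  refine (measure_mono fun ω hω => ?_).trans h3
  simp only [Set.mem_ofPred_eq, Real.norm_eq_abs, abs_of_nonneg measureReal_nonneg] at hω ⊢
  exact (ENNReal.ofReal_le_iff_le_toReal (measure_ne_top _ _)).2 hω

/-- Coupling bound: outside an event of probability at most `ε`, the variables `S + R` and `S` are
within `ε` of each other. -/
theorem levyProkhorovDist_map_add_le {Ω' : Type*} [MeasurableSpace Ω'] [NormedAddCommGroup E]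
    [MeasurableSpace E] [BorelSpace E] [SecondCountableTopology E] {P : Measure Ω'}
    [IsProbabilityMeasure P] {S R : Ω' → E} (hS : Measurable S) (hR : Measurable R) {ε : ℝ}
    (hε : 0 ≤ ε) (h : P.real {x | ε ≤ ‖R x‖} ≤ ε) :
    levyProkhorovDist (P.map fun x => S x + R x) (P.map S) ≤ ε := by
  have h1 : IsProbabilityMeasure (P.map fun x => S x + R x) :=
    Measure.isProbabilityMeasure_map (hS.add hR).aemeasurable
  have hSR : Measurable fun x => S x + R x := hS.add hR
  have h2 : IsProbabilityMeasure (P.map S) := Measure.isProbabilityMeasure_map hS.aemeasurable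
  refine levyProkhorovDist_le_of_forall_le _ _ hε fun ε' B hε' hB => ?_
  rw [Measure.map_apply hSR hB, Measure.map_apply hS Metric.isOpen_thickening.measurableSet]
  have h3 : P {x | ε ≤ ‖R x‖} ≤ ENNReal.ofReal ε' :=
    (ENNReal.le_ofReal_iff_toReal_le (measure_ne_top _ _) (hε.trans hε'.le)).2 (h.trans hε'.le)
  refine (measure_mono fun x hx => ?_).trans ((measure_union_le _ _).trans (add_le_add_right h3 _))
  by_cases hx' : ε ≤ ‖R x‖
  · exact Or.inr hx'
  · refine Or.inl (Metric.mem_thickening_iff.2 ⟨_, hx, ?_⟩)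
    rw [dist_eq_norm, sub_add_cancel_left, norm_neg]
    exact (not_le.1 hx').trans hε'

/-- Conditional Slutsky: a negligible perturbation does not affect the conditional limit. -/
theorem tendstoInMeasure_levyProkhorovDist_condDistrib_add [IsProbabilityMeasure μ]
    [NormedAddCommGroup E] [MeasurableSpace E] [BorelSpace E] [SecondCountableTopology E]
    [StandardBorelSpace E] {D : Ω → δ} (hD : Measurable D) {S R : ℕ → Ω → E}
    (hS : ∀ n, Measurable (S n)) (hR : ∀ n, Measurable (R n)) (h : SmallOP μ R) {ν : Measure E}
    [IsProbabilityMeasure ν]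
    (hν : TendstoInMeasure μ (fun n ω => levyProkhorovDist (condDistrib (S n) D μ (D ω)) ν)
      atTop (fun _ => 0)) :
    TendstoInMeasure μ
      (fun n ω => levyProkhorovDist (condDistrib (fun ω => S n ω + R n ω) D μ (D ω)) ν)
      atTop (fun _ => 0) := by
  rw [tendstoInMeasure_zero_iff] at hν ⊢
  intro ε hε η hη
  have hc := tendstoInMeasure_zero_iff.1
    (h.tendstoInMeasure_condDistrib hD hR (half_pos hε))
  filter_upwards [hν (ε / 2) (by positivity) (η / 2) (by positivity),
    hc (ε / 2) (by positivity) (η / 2) (by positivity)] with n h1 h2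
  have hadd : Measurable fun z : E × E => z.1 + z.2 := measurable_fst.add measurable_snd
  have hp : Measurable fun ω => (S n ω, R n ω) := (hS n).prodMk (hR n)
  -- The conditional laws of `S n`, `R n` and their sum are almost surely images of the conditional
  -- law of the pair; on that joint law the coupling bound can be applied. `N` collects the
  -- exceptional null set.
  have e1 := ae_of_ae_map hD.aemeasurable
    (condDistrib_comp D hp.aemeasurable (μ := μ) (measurable_fst (α := E) (β := E)))
  have e2 := ae_of_ae_map hD.aemeasurable
    (condDistrib_comp D hp.aemeasurable (μ := μ) (measurable_snd (α := E) (β := E)))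
  have e3 := ae_of_ae_map hD.aemeasurable
    (condDistrib_comp D hp.aemeasurable (μ := μ) hadd)
  have hae := (e1.and (e2.and e3))
  rw [ae_iff] at hae
  set N := {ω | ¬ _} with hN
  have hsub : {ω | ε ≤ ‖levyProkhorovDist (condDistrib (fun ω => S n ω + R n ω) D μ (D ω)) ν‖} ⊆
      ({ω | ε / 2 ≤ ‖levyProkhorovDist (condDistrib (S n) D μ (D ω)) ν‖} ∪ N) ∪
      {ω | ε / 2 ≤ ‖(condDistrib (R n) D μ (D ω)).real {r | ε / 2 ≤ ‖r‖}‖} := by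
    intro ω hω
    by_contra hcon
    simp only [Set.mem_union, not_or, hN, Set.mem_ofPred_eq, not_not, not_le] at hcon
    obtain ⟨⟨hc1, f1, f2, f3⟩, hc2⟩ := hcon
    rw [Kernel.map_apply _ measurable_fst] at f1
    rw [Kernel.map_apply _ measurable_snd] at f2
    rw [Kernel.map_apply _ hadd] at f3
    simp only [Function.comp_def] at f1 f2 f3
    rw [f2, Real.norm_eq_abs, abs_of_nonneg measureReal_nonneg, measureReal_def,
      Measure.map_apply measurable_snd (measurableSet_le measurable_const measurable_norm)] at hc2
    have h4 := levyProkhorovDist_map_add_le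
      (P := condDistrib (fun ω => (S n ω, R n ω)) D μ (D ω)) (S := Prod.fst) (R := Prod.snd)
      measurable_fst measurable_snd (half_pos hε).le hc2.le
    rw [← f1, ← f3] at h4
    have h5 := levyProkhorovDist_triangle (condDistrib (fun ω => S n ω + R n ω) D μ (D ω))
      (condDistrib (S n) D μ (D ω)) ν
    have h6 := (le_abs_self _).trans_lt hc1
    have h7 : 0 ≤ levyProkhorovDist (condDistrib (fun ω => S n ω + R n ω) D μ (D ω)) ν :=
      ENNReal.toReal_nonneg
    rw [Set.mem_ofPred_eq, Real.norm_eq_abs, abs_of_nonneg h7] at hω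
    linarith
  refine measure_union_le_ofReal hη hsub ?_ h2
  refine (measure_union_le _ _).trans ?_
  rw [hae, add_zero]
  exact h1

end ConditionalLaw

/-! ### Central limit theorems -/

section SecondMoment

variable {Ω 𝒵 : Type*} [MeasurableSpace Ω] [MeasurableSpace 𝒵] {μ : Measure Ω} {d : ℕ}

/-- The matrix `E(TT')`. -/
def secondMoment (μ : Measure Ω) (T : Ω → Vec d) : Matrix (Fin d) (Fin d) ℝ :=
  Matrix.of fun a b => ∫ ω, T ω a * T ω b ∂μ

theorem inner_sq_eq_sum (x t : Vec d) :
    inner ℝ x t ^ 2 = ∑ a, ∑ b, t a * t b * (x a * x b) := by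
  rw [PiLp.inner_apply, sq, Finset.sum_mul_sum]
  refine Finset.sum_congr rfl fun a _ => Finset.sum_congr rfl fun b _ => ?_
  simp
  ring

theorem dotProduct_secondMoment_mulVec (T : Ω → Vec d) (t : Vec d) :
    t.ofLp ⬝ᵥ (secondMoment μ T).mulVec t.ofLp =
      ∑ a, ∑ b, t a * t b * ∫ ω, T ω a * T ω b ∂μ := by
  simp only [dotProduct, Matrix.mulVec, secondMoment, Matrix.of_apply, Finset.mul_sum]
  refine Finset.sum_congr rfl fun a _ => Finset.sum_congr rfl fun b _ => ?_
  ring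

theorem memLp_coord {T : Ω → Vec d} (hT : MemLp T 2 μ) (a : Fin d) :
    MemLp (fun ω => T ω a) 2 μ :=
  hT.of_le ((EuclideanSpace.proj (𝕜 := ℝ) a).continuous.comp_aestronglyMeasurable hT.1)
    (ae_of_all _ fun ω => PiLp.norm_apply_le (T ω) a)

theorem integrable_coord_mul {T : Ω → Vec d} (hT : MemLp T 2 μ) (a b : Fin d) :
    Integrable (fun ω => T ω a * T ω b) μ :=
  (memLp_coord hT a).integrable_mul (memLp_coord hT b)

theorem dotProduct_secondMoment_mulVec_eq_integral {T : Ω → Vec d} (hT : MemLp T 2 μ) (t : Vec d) :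
    t.ofLp ⬝ᵥ (secondMoment μ T).mulVec t.ofLp = ∫ ω, inner ℝ (T ω) t ^ 2 ∂μ := by
  have hi := integrable_coord_mul hT
  simp_rw [inner_sq_eq_sum, dotProduct_secondMoment_mulVec]
  rw [integral_finsetSum _ fun a _ => integrable_finsetSum _ fun b _ => (hi a b).const_mul _]
  refine Finset.sum_congr rfl fun a _ => ?_
  rw [integral_finsetSum _ fun b _ => (hi a b).const_mul _]
  exact Finset.sum_congr rfl fun b _ => (integral_const_mul _ _).symm

theorem posSemidef_secondMoment {T : Ω → Vec d} (hT : MemLp T 2 μ) :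
    (secondMoment μ T).PosSemidef := by
  refine Matrix.PosSemidef.of_dotProduct_mulVec_nonneg ?_ fun x => ?_
  · ext a b
    simp only [Matrix.conjTranspose_apply, secondMoment, Matrix.of_apply, star_trivial]
    exact integral_congr_ae (ae_of_all _ fun ω => mul_comm _ _)
  · have h := dotProduct_secondMoment_mulVec_eq_integral hT (WithLp.toLp 2 x)
    rw [star_trivial]
    exact h ▸ integral_nonneg fun ω => sq_nonneg _

/-- The null set must not depend on `t`: the strong law is applied to the finitely many products of
coordinates, of which every quadratic form is a combination. -/
theorem ae_tendsto_average_inner_sq {Z : ℕ → Ω → 𝒵} (hi : iIndepFun Z μ)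
    (hident : ∀ i, IdentDistrib (Z i) (Z 0) μ μ) {ψ : 𝒵 → Vec d} (hψ : Measurable ψ)
    (hψ2 : MemLp (fun ω => ψ (Z 0 ω)) 2 μ) :
    ∀ᵐ ω ∂μ, ∀ t : Vec d, Tendsto
      (fun n : ℕ => (∑ i ∈ Finset.range n, inner ℝ (ψ (Z i ω)) t ^ 2) / n) atTop
      (𝓝 (t.ofLp ⬝ᵥ (secondMoment μ fun ω => ψ (Z 0 ω)).mulVec t.ofLp)) := by
  have hm : ∀ a b : Fin d, Measurable fun z => ψ z a * ψ z b := fun a b => by fun_prop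
  have h : ∀ᵐ ω ∂μ, ∀ a b : Fin d, Tendsto
      (fun n : ℕ => (∑ i ∈ Finset.range n, ψ (Z i ω) a * ψ (Z i ω) b) / n) atTop
      (𝓝 (∫ ω, ψ (Z 0 ω) a * ψ (Z 0 ω) b ∂μ)) := by
    refine ae_all_iff.2 fun a => ae_all_iff.2 fun b => ?_
    exact strong_law_ae_real (fun i ω => ψ (Z i ω) a * ψ (Z i ω) b) (integrable_coord_mul hψ2 a b)
      (fun i j hij => (hi.indepFun hij).comp (hm a b) (hm a b))
      fun i => (hident i).comp (hm a b)
  filter_upwards [h] with ω hω t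
  rw [dotProduct_secondMoment_mulVec]
  have h2 := tendsto_finsetSum Finset.univ fun a _ => tendsto_finsetSum Finset.univ
    fun b _ => (hω a b).const_mul (t a * t b)
  refine h2.congr fun n => ?_
  simp_rw [inner_sq_eq_sum, mul_div_assoc', ← Finset.sum_div, Finset.mul_sum]
  congr 1
  rw [Finset.sum_comm' (t' := Finset.univ) (s' := fun _ => Finset.range n) (by simp)]
  refine Finset.sum_congr rfl fun a _ => ?_
  rw [Finset.sum_comm]

variable [IsProbabilityMeasure μ]

/-- The multivariate central limit theorem for centered variables. -/
theorem tendstoInDistribution_sum {T : ℕ → Ω → Vec d} (hm : ∀ i, Measurable (T i))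
    (hi : iIndepFun T μ) (hident : ∀ i, IdentDistrib (T i) (T 0) μ μ)
    (hT : MemLp (T 0) 2 μ) (h0 : ∫ ω, T 0 ω ∂μ = 0) :
    TendstoInDistribution (fun (n : ℕ) ω => (1 / √(n : ℝ)) • ∑ i ∈ Finset.range n, T i ω) atTop id
      (fun _ => μ) (multivariateGaussian 0 (secondMoment μ (T 0))) := by
  have hmeas : ∀ n : ℕ, Measurable fun ω => (1 / √(n : ℝ)) • ∑ i ∈ Finset.range n, T i ω := by
    intro n
    have h := Finset.measurable_fun_sum (Finset.range n) fun i _ => hm i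
    exact h.const_smul (1 / √(n : ℝ))
  refine ⟨fun n => (hmeas n).aemeasurable, by fun_prop, ?_⟩
  refine ProbabilityMeasure.tendsto_of_tendsto_charFun fun t => ?_
  simp only [ProbabilityMeasure.coe_mk, Measure.map_id]
  rw [charFun_multivariateGaussian (posSemidef_secondMoment hT),
    dotProduct_secondMoment_mulVec_eq_integral hT]
  have ht : Measurable fun x : Vec d => inner ℝ x t := by fun_prop
  have hU2 : MemLp (fun ω => inner ℝ (T 0 ω) t) 2 μ := hT.inner_const t
  have hU0 : ∫ ω, inner ℝ (T 0 ω) t ∂μ = 0 := by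
    have := integral_inner (𝕜 := ℝ) (hT.integrable (by simp)) t
    rw [h0, inner_zero_right] at this
    exact (integral_congr_ae (ae_of_all _ fun ω => real_inner_comm _ _)).trans this
  have hvar : variance (fun ω => inner ℝ (T 0 ω) t) μ = ∫ ω, inner ℝ (T 0 ω) t ^ 2 ∂μ := by
    exact variance_of_integral_eq_zero (ht.comp (hm 0)).aemeasurable hU0
  -- Cramér–Wold: the characteristic function of the vector at `t` is that of its projection on `t`,
  -- evaluated at 1.
  have hclt := tendstoInDistribution_inv_sqrt_mul_sum_sub (P := μ)
    (X := fun i ω => inner ℝ (T i ω) t) (Y := id)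
    (P' := gaussianReal 0 (variance (fun ω => inner ℝ (T 0 ω) t) μ).toNNReal)
    HasLaw.id hU2 (hi.comp (fun _ x => inner ℝ x t) fun _ => ht) fun i => (hident i).comp ht
  have hch := ProbabilityMeasure.tendsto_iff_tendsto_charFun.1 hclt.tendsto 1
  simp only [ProbabilityMeasure.coe_mk, Measure.map_id, hU0, mul_zero, sub_zero,
    charFun_gaussianReal, hvar] at hch
  convert! hch using 2
  · rw [charFun_apply, charFun_apply, integral_map (hmeas _).aemeasurable (by fun_prop),
      integral_map (by fun_prop) (by fun_prop)]
    refine integral_congr_ae (ae_of_all _ fun ω => ?_)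
    simp [real_inner_smul_left, sum_inner]
  · rw [Real.coe_toNNReal _ (integral_nonneg fun ω => sq_nonneg _)]
    simp

/-- The conditional multiplier central limit theorem. -/
theorem tendstoInMeasure_levyProkhorovDist_multiplier {W : ℕ → Ω → ℝ} {Z : ℕ → Ω → 𝒵}
    (hW : ∀ i, Measurable (W i)) (hZ : ∀ i, Measurable (Z i))
    (hWi : iIndepFun W μ) (hWident : ∀ i, IdentDistrib (W i) (W 0) μ μ)
    (hWZ : IndepFun (fun ω i => W i ω) (fun ω i => Z i ω) μ) (hW2 : MemLp (W 0) 2 μ)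
    (h1 : ∫ ω, W 0 ω ∂μ = 1) (hvar : variance (W 0) μ = 1)
    (hi : iIndepFun Z μ) (hident : ∀ i, IdentDistrib (Z i) (Z 0) μ μ)
    {ψ : 𝒵 → Vec d} (hψ : Measurable ψ) (hψ2 : MemLp (fun ω => ψ (Z 0 ω)) 2 μ) :
    TendstoInMeasure μ (fun (n : ℕ) ω => levyProkhorovDist
      (condDistrib (fun ω => (1 / √(n : ℝ)) • ∑ i ∈ Finset.range n, (W i ω - 1) • ψ (Z i ω))
        (fun ω (i : ℕ) => Z i ω) μ (fun i => Z i ω))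
      (multivariateGaussian 0 (secondMoment μ fun ω => ψ (Z 0 ω)))) atTop (fun _ => 0) := by
  have hWm : Measurable fun ω (i : ℕ) => W i ω := measurable_pi_iff.2 hW
  have hZm : Measurable fun ω (i : ℕ) => Z i ω := measurable_pi_iff.2 hZ
  have hξ0 : ∫ ω, (W 0 ω - 1) ∂μ = 0 := by
    rw [integral_sub (hW2.integrable (by simp)) (integrable_const _), h1]
    simp
  have hξ1 : ∫ ω, (W 0 ω - 1) ^ 2 ∂μ = 1 := by
    have e := variance_eq_integral (hW 0).aemeasurable (μ := μ)
    rw [hvar, h1] at e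
    exact e.symm
  let F : ℕ → (ℕ → ℝ) → (ℕ → 𝒵) → Vec d := fun n w z =>
    (1 / √(n : ℝ)) • ∑ i ∈ Finset.range n, (w i - 1) • ψ (z i)
  have hF : ∀ n, Measurable (Function.uncurry (F n)) := by
    intro n
    have h := Finset.measurable_fun_sum (Finset.range n) (f := fun i (x : (ℕ → ℝ) × (ℕ → 𝒵)) =>
      (x.1 i - 1) • ψ (x.2 i)) fun i _ => by fun_prop
    exact h.const_smul (1 / √(n : ℝ))
  have hcond := ae_all_iff.2 fun n => ae_condDistrib_of_indepFun hWm hZm hWZ (hF n)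
  let κ : ℕ → Ω → ProbabilityMeasure (Vec d) := fun n ω =>
    ⟨condDistrib (fun ω => (1 / √(n : ℝ)) • ∑ i ∈ Finset.range n, (W i ω - 1) • ψ (Z i ω))
      (fun ω (i : ℕ) => Z i ω) μ (fun i => Z i ω), inferInstance⟩
  let ν : ProbabilityMeasure (Vec d) :=
    ⟨multivariateGaussian 0 (secondMoment μ fun ω => ψ (Z 0 ω)), inferInstance⟩
  refine tendstoInMeasure_levyProkhorovDist (κ := κ) (ν := ν) fun f => ?_
  refine tendstoInMeasure_of_tendsto_ae (fun n => ?_) ?_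
  · exact ((StronglyMeasurable.integral_condDistrib (μ := μ) (Y := fun ω => (1 / √(n : ℝ)) •
      ∑ i ∈ Finset.range n, (W i ω - 1) • ψ (Z i ω)) (X := fun ω i => Z i ω)
      (f := fun x : (ℕ → 𝒵) × Vec d => f x.2)
      (f.continuous.stronglyMeasurable.comp_measurable measurable_snd)).comp_measurable
      hZm).aestronglyMeasurable
  -- On almost every path the conditional law is, for all `n`, that of a sum with frozen vectors,
  -- and the frozen vectors have convergent averages of squares.
  · filter_upwards [hcond, ae_tendsto_average_inner_sq hi hident hψ hψ2] with ω hω hav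
    refine (tendsto_map_weighted_sum (ξ := fun i ω => W i ω - 1) (fun i => (hW i).sub_const 1)
      (hWi.comp (fun _ x => x - 1) fun _ => by fun_prop)
      (fun i => (hWident i).comp (u := fun x => x - 1) (by fun_prop)) hξ0 hξ1
      (posSemidef_secondMoment hψ2) hav f).congr fun n => ?_
    simp only [κ, ProbabilityMeasure.coe_mk]
    rw [hω n]

end SecondMoment

/-! ### The expansion of the rates -/

section Representation

variable {Ω : Type*} [MeasurableSpace Ω] {μ : Measure Ω} {k p : ℕ} {V W Y : ℕ → Ω → ℝ}
  {X : ℕ → Ω → Vec k} {G : Vec k → Vec p → ℝ} {βs : Vec p} {j c : ℝ}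
  {ψβ : ℝ → Vec k → Vec p → Vec p}

theorem IIDSample.ind_one (hd : IIDSample μ Y X) (i : ℕ) (ω : Ω) : ind (Y i ω = 1) = Y i ω := by
  rcases hd.binary i ω with h | h <;> simp [ind, h]

theorem IIDSample.ind_zero (hd : IIDSample μ Y X) (i : ℕ) (ω : Ω) :
    ind (Y i ω = 0) = 1 - Y i ω := by
  rcases hd.binary i ω with h | h <;> simp [ind, h]

theorem IIDSample.TPw_eq (hd : IIDSample μ Y X) (n : ℕ) (β : Vec p) (ω : Ω) :
    TPw V Y X G n c β ω = weightedRate V Y X G 1 c n β ω := by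
  simp only [TPw, weightedRate, hd.ind_one]

theorem IIDSample.FPw_eq (hd : IIDSample μ Y X) (n : ℕ) (β : Vec p) (ω : Ω) :
    FPw V Y X G n c β ω = weightedRate V Y X G 0 c n β ω := by
  simp only [FPw, weightedRate, hd.ind_zero]

theorem IIDSample.TPhat_eq (hd : IIDSample μ Y X) (n : ℕ) (β : Vec p) (ω : Ω) :
    TPhat Y X G n c β ω = weightedRate (fun _ _ => 1) Y X G 1 c n β ω := by
  simp only [TPhat, weightedRate, hd.ind_one, one_mul]

theorem IIDSample.FPhat_eq (hd : IIDSample μ Y X) (n : ℕ) (β : Vec p) (ω : Ω) :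
    FPhat Y X G n c β ω = weightedRate (fun _ _ => 1) Y X G 0 c n β ω := by
  simp [FPhat, weightedRate, hd.ind_zero]

theorem measurable_weightedRate (hd : IIDSample μ Y X) (hV : ∀ i, Measurable (V i))
    (hG : Measurable fun z : Vec k × Vec p => G z.1 z.2) {b : Ω → Vec p} (hb : Measurable b)
    (n : ℕ) : Measurable fun ω => weightedRate V Y X G j c n (b ω) ω := by
  have hY : ∀ i, MeasurableSet {ω | Y i ω = j} := fun i =>
    measurableSet_eq_fun (hd.measurable_Y i) measurable_const
  have hGi : ∀ i, MeasurableSet {ω | G (X i ω) (b ω) > c} := fun i =>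
    measurableSet_lt measurable_const (hG.comp ((hd.measurable_X i).prodMk hb))
  refine (Measurable.const_div ?_ 1).mul ?_
  · exact Finset.measurable_fun_sum _ fun i _ => (hV i).mul (measurable_ind (hY i))
  · exact Finset.measurable_fun_sum _ fun i _ =>
      (hV i).mul (measurable_ind ((hGi i).inter (hY i)))

theorem measurable_psi (hG : Measurable fun z : Vec k × Vec p => G z.1 z.2)
    (hψ : Measurable fun z : ℝ × Vec k => ψβ z.1 z.2 βs) :
    Measurable fun z : ℝ × Vec k => psi μ Y X G ψβ βs c z.1 z.2 := by
  have hi : Measurable fun z : ℝ × Vec k => ind (G z.2 βs > c) :=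
    measurable_ind (measurableSet_lt measurable_const
      (hG.comp (measurable_snd.prodMk measurable_const)))
  have h1 : Measurable fun z : ℝ × Vec k => psiTP μ Y X G ψβ βs c z.1 z.2 :=
    ((measurable_fst.div_const _).mul (hi.sub_const _)).add (measurable_const.inner hψ)
  have h2 : Measurable fun z : ℝ × Vec k => psiFP μ Y X G ψβ βs c z.1 z.2 :=
    (((measurable_fst.const_sub 1).div_const _).mul (hi.sub_const _)).add
      (measurable_const.inner hψ)
  refine (WithLp.measurable_toLp 2 _).comp (measurable_pi_iff.2 fun a => ?_)
  fin_cases a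
  · exact h1
  · exact h2

variable [IsProbabilityMeasure μ]

theorem memLp_influence (hd : IIDSample μ Y X)
    (hG : Measurable fun z : Vec k × Vec p => G z.1 z.2) (hj : 0 < labelProb μ Y j)
    (hψ2 : MemLp (fun ω => ψβ (Y 0 ω) (X 0 ω) βs) 2 μ) :
    MemLp (fun ω => influence μ Y X G ψβ βs j c (Y 0 ω, X 0 ω)) 2 μ :=
  ((memLp_centeredInd hd hG hj).const_mul _).add (hψ2.const_inner _)

theorem integral_influence (hd : IIDSample μ Y X)
    (hG : Measurable fun z : Vec k × Vec p => G z.1 z.2) (hj : 0 < labelProb μ Y j)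
    (hψ2 : MemLp (fun ω => ψβ (Y 0 ω) (X 0 ω) βs) 2 μ)
    (hψ0 : ∫ ω, ψβ (Y 0 ω) (X 0 ω) βs ∂μ = 0) :
    ∫ ω, influence μ Y X G ψβ βs j c (Y 0 ω, X 0 ω) ∂μ = 0 := by
  simp only [influence]
  rw [integral_add (((memLp_centeredInd hd hG hj).integrable (by simp)).const_mul _)
      ((hψ2.const_inner _).integrable (by simp)), integral_const_mul, integral_centeredInd hd hG hj,
    integral_inner (hψ2.integrable (by simp)), hψ0]
  simp

theorem IIDSample.labelProb_zero_pos (hd : IIDSample μ Y X) : 0 < labelProb μ Y 0 := by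
  rw [hd.labelProb_zero, sub_pos]
  exact hd.prevalence_lt_one

/-- The two forms agree at observations because the outcome is binary, so that it equals its own
indicator; for general `y` they differ. -/
theorem IIDSample.psi_eq (hd : IIDSample μ Y X) (i : ℕ) (ω : Ω) :
    psi μ Y X G ψβ βs c (Y i ω) (X i ω) = !₂[influence μ Y X G ψβ βs 1 c (Y i ω, X i ω),
      influence μ Y X G ψβ βs 0 c (Y i ω, X i ω)] := by
  rw [psi]
  congr 3
  · rw [psiTP, influence, centeredInd, hd.ind_one, div_eq_inv_mul, mul_assoc]
    rfl
  · rw [psiFP, influence, centeredInd, hd.ind_zero, hd.labelProb_zero, div_eq_inv_mul, mul_assoc]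
    rfl

theorem memLp_psi (hd : IIDSample μ Y X)
    (hG : Measurable fun z : Vec k × Vec p => G z.1 z.2)
    (hψ2 : MemLp (fun ω => ψβ (Y 0 ω) (X 0 ω) βs) 2 μ) :
    MemLp (fun ω => psi μ Y X G ψβ βs c (Y 0 ω) (X 0 ω)) 2 μ := by
  simp_rw [hd.psi_eq]
  refine MemLp.of_eval_piLp fun a => ?_
  fin_cases a
  · exact memLp_influence hd hG hd.prevalence_pos hψ2
  · exact memLp_influence hd hG hd.labelProb_zero_pos hψ2

theorem integral_psi (hd : IIDSample μ Y X)
    (hG : Measurable fun z : Vec k × Vec p => G z.1 z.2)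
    (hψ2 : MemLp (fun ω => ψβ (Y 0 ω) (X 0 ω) βs) 2 μ)
    (hψ0 : ∫ ω, ψβ (Y 0 ω) (X 0 ω) βs ∂μ = 0) :
    ∫ ω, psi μ Y X G ψβ βs c (Y 0 ω) (X 0 ω) ∂μ = 0 := by
  ext a
  rw [← integral_coord ((memLp_psi hd hG hψ2).integrable (by simp))]
  simp_rw [hd.psi_eq]
  fin_cases a
  · exact integral_influence hd hG hd.prevalence_pos hψ2 hψ0
  · exact integral_influence hd hG hd.labelProb_zero_pos hψ2 hψ0

/-- The remainder in the linearization of the weighted rates of both groups. -/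
theorem smallOP_weightedRate_pair (hd : IIDSample μ Y X) (hV : MeanOneWeights μ V Y X)
    (hG : Measurable fun z : Vec k × Vec p => G z.1 z.2) {B : Set (Vec p)} (hB : MeasurableSet B)
    (hβs : βs ∈ B) (he0 : StochEquicontinuous μ B (empProc μ Y X G 0))
    (he1 : StochEquicontinuous μ B (empProc μ Y X G 1)) {b : ℕ → Ω → Vec p}
    (hbB : ∀ n, ∀ᵐ ω ∂μ, b n ω ∈ B) (hψ : Measurable fun z : ℝ × Vec k => ψβ z.1 z.2 βs)
    (hψ2 : MemLp (fun ω => ψβ (Y 0 ω) (X 0 ω) βs) 2 μ)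
    (hψ0 : ∫ ω, ψβ (Y 0 ω) (X 0 ω) βs ∂μ = 0) (hlin : AsympLinear μ V Y X βs ψβ b)
    (hsmooth : SmoothRates μ Y X G βs) :
    SmallOP μ fun (n : ℕ) ω => √(n : ℝ) • !₂[weightedRate V Y X G 1 c n (b n ω) ω -
        TP μ Y X G c βs, weightedRate V Y X G 0 c n (b n ω) ω - FP μ Y X G c βs] -
      (1 / √(n : ℝ)) • ∑ i ∈ Finset.range n, V i ω • psi μ Y X G ψβ βs c (Y i ω) (X i ω) := by
  obtain ⟨r, hr, hdiff, -⟩ := hsmooth c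
  obtain ⟨hd1, hd0⟩ := hdiff βs (Metric.mem_ball_self hr)
  refine SmallOP.of_coord fun a => ?_
  simp_rw [hd.psi_eq]
  fin_cases a
  · have h := smallOP_weightedRate_sub hd hV hG hd.prevalence_pos hB hβs he1 hbB hψ hψ2 hψ0 hlin hd1
    have e : TP μ Y X G c βs = rate μ Y X G 1 c βs := rfl
    simpa [WithLp.ofLp_sum, Finset.sum_apply, e] using h
  · have h := smallOP_weightedRate_sub hd hV hG hd.labelProb_zero_pos hB hβs he0 hbB hψ hψ2 hψ0
      hlin hd0
    have e : FP μ Y X G c βs = rate μ Y X G 0 c βs := rfl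
    simpa [WithLp.ofLp_sum, Finset.sum_apply, e] using h

end Representation

end

end ROCBootstrap

/-! ### Assembly of the proposition -/

theorem mainTheorem5 {Ω : Type*} [MeasurableSpace Ω] (μ : Measure Ω) [IsProbabilityMeasure μ]
    {k p : ℕ} (Y : ℕ → Ω → ℝ) (X : ℕ → Ω → ROCBootstrap.Vec k)
    (G : ROCBootstrap.Vec k → ROCBootstrap.Vec p → ℝ)
    (hG : Measurable fun z : ROCBootstrap.Vec k × ROCBootstrap.Vec p => G z.1 z.2)
    (B : Set (ROCBootstrap.Vec p)) (βstar : ROCBootstrap.Vec p)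
    (q : ℝ → ROCBootstrap.Vec k → ROCBootstrap.Vec p → ℝ)
    (ψβ : ℝ → ROCBootstrap.Vec k → ROCBootstrap.Vec p → ROCBootstrap.Vec p)
    (W : ℕ → Ω → ℝ) (βhat βhatw : ℕ → Ω → ROCBootstrap.Vec p)
    (hiid : ROCBootstrap.IIDSample μ Y X)
    (hfirst : ROCBootstrap.FirstStage μ Y X B βstar q ψβ βhat)
    (hequi0 : ROCBootstrap.StochEquicontinuous μ B (ROCBootstrap.empProc μ Y X G 0))
    (hequi1 : ROCBootstrap.StochEquicontinuous μ B (ROCBootstrap.empProc μ Y X G 1))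
    (hsmooth : ROCBootstrap.SmoothRates μ Y X G βstar)
    (hW : ROCBootstrap.BootstrapWeights μ W Y X)
    (hboot : ROCBootstrap.IsMEstimator μ W Y X B q βhatw)
    (hbootlin : ROCBootstrap.AsympLinear μ W Y X βstar ψβ βhatw)
    (c : ℝ)
    (hTP : 0 < ∫ ω, ROCBootstrap.psiTP μ Y X G ψβ βstar c (Y 0 ω) (X 0 ω) ^ 2 ∂μ)
    (hFP : 0 < ∫ ω, ROCBootstrap.psiFP μ Y X G ψβ βstar c (Y 0 ω) (X 0 ω) ^ 2 ∂μ) :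
    -- `E(ψψ')` is a well-defined matrix of finite second moments
    MemLp (fun ω => ROCBootstrap.psi μ Y X G ψβ βstar c (Y 0 ω) (X 0 ω)) 2 μ ∧
    -- the representation, unconditionally and conditionally on the data
    TendstoInMeasure μ (fun n ω => ROCBootstrap.bootDev W Y X G βhat βhatw c n ω -
        ROCBootstrap.multSum μ W Y X G ψβ βstar c n ω) atTop (fun _ => 0) ∧
    ROCBootstrap.CondNegligible μ Y X (fun n ω => ROCBootstrap.bootDev W Y X G βhat βhatw c n ω -
        ROCBootstrap.multSum μ W Y X G ψβ βstar c n ω) ∧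
    -- conditional convergence to `N(0, E(ψψ'))`, with probability approaching one
    ROCBootstrap.CondTendstoInDistribution μ Y X (ROCBootstrap.multSum μ W Y X G ψβ βstar c)
      (multivariateGaussian 0 (ROCBootstrap.covPsi μ Y X G ψβ βstar c)) ∧
    ROCBootstrap.CondTendstoInDistribution μ Y X (ROCBootstrap.bootDev W Y X G βhat βhatw c)
      (multivariateGaussian 0 (ROCBootstrap.covPsi μ Y X G ψβ βstar c)) ∧
    -- validity: this is also the limit law of the sample deviation
    TendstoInDistribution (ROCBootstrap.sampleDev μ Y X G βstar βhat c) atTop id (fun _ => μ)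
      (multivariateGaussian 0 (ROCBootstrap.covPsi μ Y X G ψβ βstar c)) := by
  have hβB := interior_subset hfirst.interior
  have hB := hfirst.compact.isClosed.measurableSet
  obtain ⟨ε, hε, hmom⟩ := hfirst.moment
  have hψ2 : MemLp (fun ω => ψβ (Y 0 ω) (X 0 ω) βstar) 2 μ := hmom.mono_exponent (by
    rw [← ENNReal.ofReal_ofNat]
    exact ENNReal.ofReal_le_ofReal (by linarith))
  have hψm := ROCBootstrap.measurable_psi (μ := μ) (Y := Y) (X := X) (c := c) hG
    hfirst.measurable_ψβ
  have hpsi2 := ROCBootstrap.memLp_psi (c := c) hiid hG hψ2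
  have hone := ROCBootstrap.meanOneWeights_one (μ := μ) (Y := Y) (X := X)
  have hexpW := ROCBootstrap.smallOP_weightedRate_pair (c := c) hiid hW.meanOneWeights hG hB hβB
    hequi0 hequi1 (fun n => (hboot.argmax n).mono fun _ h => h.1) hfirst.measurable_ψβ hψ2
    hfirst.mean_zero hbootlin hsmooth
  have hexp1 := ROCBootstrap.smallOP_weightedRate_pair (c := c) hiid hone hG hB hβB
    hequi0 hequi1 (fun n => (hfirst.mEstimator.argmax n).mono fun _ h => h.1)
    hfirst.measurable_ψβ hψ2 hfirst.mean_zero hfirst.linear hsmooth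
  have hmeasM : ∀ n, Measurable (ROCBootstrap.multSum μ W Y X G ψβ βstar c n) := fun n =>
    (Finset.measurable_fun_sum (Finset.range n) fun i _ => ((hW.measurable i).sub_const 1).smul
      (hψm.comp (hiid.measurable_obs i))).const_smul (1 / √(n : ℝ))
  have hmeasB : ∀ n, Measurable (ROCBootstrap.bootDev W Y X G βhat βhatw c n) := by
    intro n
    refine Measurable.const_smul ((WithLp.measurable_toLp 2 _).comp
      (measurable_pi_iff.2 fun a => ?_)) (√(n : ℝ))
    simp only [hiid.TPw_eq, hiid.FPw_eq, hiid.TPhat_eq, hiid.FPhat_eq]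
    fin_cases a
    · exact (ROCBootstrap.measurable_weightedRate hiid hW.measurable hG (hboot.measurable n) n).sub
        (ROCBootstrap.measurable_weightedRate hiid hone.measurable hG
          (hfirst.mEstimator.measurable n) n)
    · exact (ROCBootstrap.measurable_weightedRate hiid hW.measurable hG (hboot.measurable n) n).sub
        (ROCBootstrap.measurable_weightedRate hiid hone.measurable hG
          (hfirst.mEstimator.measurable n) n)
  have hmeasS : ∀ n, Measurable (ROCBootstrap.sampleDev μ Y X G βstar βhat c n) := by
    intro n
    refine Measurable.const_smul ((WithLp.measurable_toLp 2 _).comp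
      (measurable_pi_iff.2 fun a => ?_)) (√(n : ℝ))
    simp only [hiid.TPhat_eq, hiid.FPhat_eq]
    fin_cases a
    · exact (ROCBootstrap.measurable_weightedRate hiid hone.measurable hG
        (hfirst.mEstimator.measurable n) n).sub_const _
    · exact (ROCBootstrap.measurable_weightedRate hiid hone.measurable hG
        (hfirst.mEstimator.measurable n) n).sub_const _
  -- In the difference of the two expansions the population rates at `β*` cancel and the weights
  -- become `W - 1`.
  have hrep : ROCBootstrap.SmallOP μ fun n ω => ROCBootstrap.bootDev W Y X G βhat βhatw c n ω -
      ROCBootstrap.multSum μ W Y X G ψβ βstar c n ω := by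
    refine (hexpW.sub hexp1).of_le fun n ω => le_of_eq (congrArg _ ?_)
    rw [ROCBootstrap.bootDev, ROCBootstrap.multSum]
    simp only [hiid.TPw_eq, hiid.FPw_eq, hiid.TPhat_eq, hiid.FPhat_eq, sub_smul,
      Finset.sum_sub_distrib, smul_sub]
    rw [sub_sub_sub_comm, ← smul_sub]
    congr 2
    ext a
    fin_cases a <;> simp <;> ring
  have hrepS : ROCBootstrap.SmallOP μ fun n ω => ROCBootstrap.sampleDev μ Y X G βstar βhat c n ω -
      (1 / √(n : ℝ)) • ∑ i ∈ Finset.range n,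
        ROCBootstrap.psi μ Y X G ψβ βstar c (Y i ω) (X i ω) := by
    refine hexp1.of_le fun n ω => le_of_eq (congrArg _ ?_)
    simp only [ROCBootstrap.sampleDev, hiid.TPhat_eq, hiid.FPhat_eq, one_smul]
  have hmult := ROCBootstrap.tendstoInMeasure_levyProkhorovDist_multiplier hW.measurable
    hiid.measurable_obs hW.indep hW.ident hW.indep_data hW.memLp_two hW.mean_one hW.var_one
    hiid.indep hiid.ident hψm hpsi2
  refine ⟨hpsi2, ROCBootstrap.tendstoInMeasure_zero_iff.2 hrep, fun ε hε =>
    hrep.tendstoInMeasure_condDistrib hiid.measurable_path (fun n => (hmeasB n).sub (hmeasM n)) hε,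
    hmult, ?_, ?_⟩
  -- The bootstrap deviation is the multiplier sum plus the negligible remainder.
  · have h := ROCBootstrap.tendstoInMeasure_levyProkhorovDist_condDistrib_add
      hiid.measurable_path hmeasM (fun n => (hmeasB n).sub (hmeasM n)) hrep hmult
    simp only [Pi.sub_apply, add_sub_cancel] at h
    exact h
  · have hclt := ROCBootstrap.tendstoInDistribution_sum
      (T := fun i ω => ROCBootstrap.psi μ Y X G ψβ βstar c (Y i ω) (X i ω))
      (fun i => hψm.comp (hiid.measurable_obs i)) (hiid.indep.comp (fun _ => _) fun _ => hψm)
      (fun i => (hiid.ident i).comp hψm) hpsi2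
      (ROCBootstrap.integral_psi hiid hG hψ2 hfirst.mean_zero)
    have hrepS' := ROCBootstrap.tendstoInMeasure_zero_iff.2 hrepS
    exact tendstoInDistribution_of_tendstoInMeasure_sub _ _ hclt hrepS'
      fun n => (hmeasS n).aemeasurable
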